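/- **Theorem (A-priori bounds).** Let $n\ge 1$ and let $\Omega\subset\mathbb R^n$ be a bounded domain with boundary $\Sigma=\partial\Omega$ of class $C^2$ and outer unit normal $\vec n$. Consider $N$ species with diffusivities $d_i>0$, $\mathbb D=\operatorname{diag}(d_1,\dots,d_N)$, and two families of reversible reactions: bulk reactions $\sum_i\alpha_i^aA_i\rightleftharpoons\sum_i\beta_i^aA_i$ ($a=1,\dots,m$) and surface reactions $\sum_i\alpha_i^{\Sigma,a}A_i\rightleftharpoons\sum_i\beta_i^{\Sigma,a}A_i$ ($a=1,\dots,m^\Sigma$), with coefficients in $\mathbb N_0$, rate constants $k_a^f,k_a^b,k_a^{\Sigma,f},k_a^{\Sigma,b}>0$ and stoichiometric vectors $\nu^a=\beta^a-\alpha^a$, $\nu^{\Sigma,a}=\beta^{\Sigma,a}-\alpha^{\Sigma,a}\in\mathbb R^N$, where $\nu^{\Sigma,1},\dots,\nu^{\Sigma,m^\Sigma}$ are linearly independent. Let $$r(c)=\sum_{a=1}^m\nu^a\,(k_a^fc^{\alpha^a}-k_a^bc^{\beta^a}),\qquad r^{\mathrm b}(c)=\sum_{a=1}^{m^\Sigma}\nu^{\Sigma,a}\,(k_a^{\Sigma,f}c^{\alpha^{\Sigma,a}}-k_a^{\Sigma,b}c^{\beta^{\Sigma,a}}),$$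 and let $e^1,\dots,e^{n^\Sigma}$ be a basis of $\{\nu^{\Sigma,a}:a\}^\perp\subset\mathbb R^N$. The fast-surface-chemistry/fast-sorption/fast-transmission limit problem is $$\begin{aligned}\partial_tc-\mathbb D\Delta c&=r(c) &&\text{in }\Omega,\\ -e^k\cdot\mathbb D\,\partial_{\vec n}c&=0\quad(k=1,\dots,n^\Sigma) &&\text{on }\Sigma,\\ r^{\mathrm b}(c)&=0 &&\text{on }\Sigma,\\ c(0,\cdot)&=c^0 &&\text{in }\overline\Omega,\end{aligned}$$ for $t\ge0$. Let $c^0\in C^2(\overline\Omega;[0,\infty)^N)$ satisfy the compatibility conditions $e^k\cdot\mathbb D\,\partial_{\vec n}c^0=0$ and $r^{\mathrm b}(c^0)=0$ on $\Sigma$. Assume there is a strictly positive conservation vector $$e\in(0,\infty)^N\cap\{\nu^a:a\}^\perp\cap\{\nu^{\Sigma,a}:a\}^\perp .$$ Then for every $T_0\in(0,\infty)$ there is a constant $C>0$, depending only on $T_0$, $c^0$ and the data of the problem, such that every maximal (non-continuable) nonnegative classical solution $c\in C^1([0,T_{\max});C(\overline\Omega;\mathbb R^N))\cap C([0,T_{\max});C^2(\overline\Omega;\mathbb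 R^N))$ with $T_{\max}\in[T_0,\infty]$ satisfies: 1. ($L_\infty L_1$) $\ \sup_{t\in[0,T_0)}\|c(t,\cdot)\|_{L_1(\Omega;\mathbb R^N)}\le C\,\|c^0\|_{L_1(\Omega;\mathbb R^N)}$; 2. ($L_1L_\infty$) $\ \sup_{z\in\overline\Omega}\|c(\cdot,z)\|_{L_1([0,T_0);\mathbb R^N)}\le C$; 3. ($L_2L_2$) $\ \|c\|_{L_2([0,T_0)\times\Omega;\mathbb R^N)}\le C$; 4. (Entropy identity) Let $\mu^0\in\mathbb R^N$ be standard chemical potentials (in units with $RT=1$) linked to the rate constants by the logarithmic closure $k_a^b/k_a^f=\exp(\sum_i\mu_i^0\nu_i^a)$ and $k_a^{\Sigma,b}/k_a^{\Sigma,f}=\exp(\sum_i\mu_i^0\nu_i^{\Sigma,a})$ for all reactions, write $\mu_i=\mu_i^0+\ln c_i$ and $\mathcal A_a=\sum_i\mu_i\nu_i^a$, and assume that $c_i(t,z)>0$ for all $i$, all $t\in(0,T_{\max})$ and all $z\in\Sigma$. Then $c_i>0$ on $(0,T_0)\times\overline\Omega$ for all $i$; the boundary contribution $\sum_i\mu_i\,d_i\,\partial_{\vec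 n}c_i$ vanishes on $(0,T_0)\times\Sigma$; and for every $t\in[0,T_0)$ the dissipation densities below are integrable on $(0,t)\times\Omega$ and $$\begin{aligned}&\int_\Omega\sum_{i=1}^Nc_i(t,z)\big(\mu_i^0+\ln c_i(t,z)-1\big)\,dz+\int_0^t\!\!\int_\Omega\sum_{i=1}^Nd_i\frac{|\nabla c_i|^2}{c_i}\,dz\,ds\\&\quad+\sum_{a=1}^m\int_0^t\!\!\int_\Omega k_a^f\,c^{\alpha^a}\,\mathcal A_a\,\big(e^{\mathcal A_a}-1\big)\,dz\,ds=\int_\Omega\sum_{i=1}^Nc_i^0(z)\big(\mu_i^0+\ln c_i^0(z)-1\big)\,dz\end{aligned}$$ (with $0\ln0=0$). -/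

import Mathlib

open MeasureTheory

noncomputable section

/-! ### Domains with `C²` boundary -/

/-- `ρ` is a `C²` defining function of `Ω` near the point `x`: near `x`, the set `Ω` is `{ρ < 0}`,
and `∇ρ(x) ≠ 0`. -/
def IsLocalDefiningFunction {n : ℕ} (Ω : Set (EuclideanSpace ℝ (Fin n)))
    (x : EuclideanSpace ℝ (Fin n)) (ρ : EuclideanSpace ℝ (Fin n) → ℝ) : Prop :=
  ContDiffAt ℝ 2 ρ x ∧ gradient ρ x ≠ 0 ∧ ∀ᶠ y in nhds x, (y ∈ Ω ↔ ρ y < 0)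

/-- Bounded domain (nonempty, open, connected) of class `C²` in `ℝⁿ`. -/
structure IsBoundedC2Domain {n : ℕ} (Ω : Set (EuclideanSpace ℝ (Fin n))) : Prop where
  isOpen : IsOpen Ω
  isConnected : IsConnected Ω
  isBounded : Bornology.IsBounded Ω
  boundary : ∀ x ∈ frontier Ω, ∃ ρ, IsLocalDefiningFunction Ω x ρ

/-- `ν` is the outer unit normal `∇ρ(x) / |∇ρ(x)|` of `Ω` at the boundary point `x`. -/
def IsOuterUnitNormal {n : ℕ} (Ω : Set (EuclideanSpace ℝ (Fin n)))
    (x ν : EuclideanSpace ℝ (Fin n)) : Prop :=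
  ∃ ρ, IsLocalDefiningFunction Ω x ρ ∧ ν = ‖gradient ρ x‖⁻¹ • gradient ρ x

/-- The derivative of `u` at a point `x` of the closed set `closure Ω` in direction `ν`; for
`x ∈ ∂Ω` and `ν` the outer unit normal this is the normal derivative `∂_n u(x)`. -/
def normalDeriv {n : ℕ} (Ω : Set (EuclideanSpace ℝ (Fin n)))
    (u : EuclideanSpace ℝ (Fin n) → ℝ) (x ν : EuclideanSpace ℝ (Fin n)) : ℝ :=
  fderivWithin ℝ u (closure Ω) x ν

/-! ### The class `C^{(1,2)}([0,T) × closure Ω)` -/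

/-- The interval `[0, T)` of real times, where `T` may be `+∞`. -/
def timeInterval (T : EReal) : Set ℝ := {t : ℝ | 0 ≤ t ∧ (t : EReal) < T}

/-- `u ∈ C¹([0,T); C(closure Ω)) ∩ C([0,T); C²(closure Ω))`. As `closure Ω` is compact for a
bounded domain, this means that `u`, `∂_t u`, `∇u` and `D²u` exist (one-sided at the boundary and at
`t = 0`) and are jointly continuous on `[0,T) × closure Ω`. -/
structure IsC12 {n : ℕ} (Ω : Set (EuclideanSpace ℝ (Fin n))) (T : EReal)
    (u : ℝ → EuclideanSpace ℝ (Fin n) → ℝ) : Prop where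
  contDiffOn_space : ∀ t ∈ timeInterval T, ContDiffOn ℝ 2 (u t) (closure Ω)
  differentiableOn_time : ∀ z ∈ closure Ω, DifferentiableOn ℝ (fun t => u t z) (timeInterval T)
  continuousOn : ContinuousOn (fun p : ℝ × EuclideanSpace ℝ (Fin n) => u p.1 p.2)
    (timeInterval T ×ˢ closure Ω)
  continuousOn_time_deriv : ContinuousOn (fun p : ℝ × EuclideanSpace ℝ (Fin n) =>
    derivWithin (fun t => u t p.2) (timeInterval T) p.1) (timeInterval T ×ˢ closure Ω)
  continuousOn_fderiv : ContinuousOn (fun p : ℝ × EuclideanSpace ℝ (Fin n) =>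
    fderivWithin ℝ (u p.1) (closure Ω) p.2) (timeInterval T ×ˢ closure Ω)
  continuousOn_second_fderiv : ContinuousOn (fun p : ℝ × EuclideanSpace ℝ (Fin n) =>
    iteratedFDerivWithin ℝ 2 (u p.1) (closure Ω) p.2) (timeInterval T ×ˢ closure Ω)

/-! ### Mass-action kinetics -/

/-- `m` reversible reactions `∑ᵢ αᵢᵃ Aᵢ ⇌ ∑ᵢ βᵢᵃ Aᵢ` between `N` species, with forward and backward
rate constants `k_a^f, k_a^b > 0`. -/
structure ReactionNetwork (N m : ℕ) where
  α : Fin m → Fin N → ℕ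
  β : Fin m → Fin N → ℕ
  kf : Fin m → ℝ
  kb : Fin m → ℝ
  kf_pos : ∀ a, 0 < kf a
  kb_pos : ∀ a, 0 < kb a

namespace ReactionNetwork

variable {N m : ℕ} (R : ReactionNetwork N m)

/-- The stoichiometric vectors `νᵃ = βᵃ - αᵃ`. -/
def ν (a : Fin m) (i : Fin N) : ℝ := (R.β a i : ℝ) - (R.α a i : ℝ)

/-- The forward reaction velocity `k_a^f c^{αᵃ}`. -/
def forward (a : Fin m) (c : Fin N → ℝ) : ℝ := R.kf a * ∏ i, c i ^ R.α a i

/-- The backward reaction velocity `k_a^b c^{βᵃ}`. -/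
def backward (a : Fin m) (c : Fin N → ℝ) : ℝ := R.kb a * ∏ i, c i ^ R.β a i

/-- The reaction rates `rᵢ(c) = ∑ₐ νᵢᵃ (k_a^f c^{αᵃ} - k_a^b c^{βᵃ})`. -/
def rate (c : Fin N → ℝ) (i : Fin N) : ℝ := ∑ a, R.ν a i * (R.forward a c - R.backward a c)

/-- The affinity `𝒜ₐ = ∑ᵢ μᵢ νᵢᵃ` for the chemical potentials `μᵢ = μᵢ⁰ + ln cᵢ`. -/
def affinity (μ₀ : Fin N → ℝ) (a : Fin m) (c : Fin N → ℝ) : ℝ :=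
  ∑ i, (μ₀ i + Real.log (c i)) * R.ν a i

/-- The logarithmic closure `ln (R_a^f / R_a^b) = -𝒜ₐ` relating the rate constants to the standard
chemical potentials: `k_a^b / k_a^f = exp (∑ᵢ μᵢ⁰ νᵢᵃ)`. -/
def LogarithmicClosure (μ₀ : Fin N → ℝ) : Prop :=
  ∀ a, R.kb a / R.kf a = Real.exp (∑ i, μ₀ i * R.ν a i)

/-- The orthogonal complement of the stoichiometric vectors, i.e. the conservation vectors. -/
def conservationSpace : Submodule ℝ (Fin N → ℝ) where
  carrier := {v | ∀ a, ∑ i, v i * R.ν a i = 0}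
  zero_mem' := by intro a; simp
  add_mem' := by
    intro v w hv hw a
    have h : ∑ i, (v + w) i * R.ν a i = ∑ i, v i * R.ν a i + ∑ i, w i * R.ν a i := by
      rw [← Finset.sum_add_distrib]
      exact Finset.sum_congr rfl fun i _ => by rw [Pi.add_apply, add_mul]
    rw [h, hv a, hw a, add_zero]
  smul_mem' := by
    intro r v hv a
    have h : ∑ i, (r • v) i * R.ν a i = r * ∑ i, v i * R.ν a i := by
      rw [Finset.mul_sum]
      exact Finset.sum_congr rfl fun i _ => by rw [Pi.smul_apply, smul_eq_mul, mul_assoc]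
    rw [h, hv a, mul_zero]

end ReactionNetwork

/-! ### The limit problem for fast sorption, fast surface chemistry and fast transmission -/

/-- Both boundary conditions for a concentration profile `c` on `∂Ω`: the no-flux conditions
`-eᵏ · 𝔻 ∂_n c = 0` for a basis `(eᵏ)` of the conservation vectors of the surface chemistry, and the
equilibrium condition `r^b(c) = 0` for the surface chemistry. -/
def SatisfiesBoundaryConditions {n N mS nS : ℕ} (Ω : Set (EuclideanSpace ℝ (Fin n)))
    (d : Fin N → ℝ) (surf : ReactionNetwork N mS)
    (eb : Module.Basis (Fin nS) ℝ surf.conservationSpace)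
    (c : EuclideanSpace ℝ (Fin n) → EuclideanSpace ℝ (Fin N)) : Prop :=
  (∀ z ∈ frontier Ω, ∀ ν, IsOuterUnitNormal Ω z ν → ∀ k,
    -∑ i, (eb k : Fin N → ℝ) i * (d i * normalDeriv Ω (fun y => c y i) z ν) = 0) ∧
  (∀ z ∈ frontier Ω, ∀ i, surf.rate (fun j => c z j) i = 0)

/-- Nonnegative initial data of class `C²(closure Ω)` satisfying the compatibility conditions. -/
structure IsAdmissibleInitialDatum {n N mS nS : ℕ} (Ω : Set (EuclideanSpace ℝ (Fin n)))
    (d : Fin N → ℝ) (surf : ReactionNetwork N mS)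
    (eb : Module.Basis (Fin nS) ℝ surf.conservationSpace)
    (c₀ : EuclideanSpace ℝ (Fin n) → EuclideanSpace ℝ (Fin N)) : Prop where
  contDiffOn : ∀ i, ContDiffOn ℝ 2 (fun z => c₀ z i) (closure Ω)
  nonneg : ∀ z ∈ closure Ω, ∀ i, 0 ≤ c₀ z i
  compatible : SatisfiesBoundaryConditions Ω d surf eb c₀

/-- `c` is a nonnegative classical solution, on the time interval `[0, T)`, of
`∂_t c - 𝔻 Δc = r(c)` in `Ω`, `-eᵏ · 𝔻 ∂_n c = 0` and `r^b(c) = 0` on `∂Ω`, `c(0,·) = c₀`, where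
`𝔻 = diag(d₁, …, d_N)`. Only the values of `c` on `[0,T) × closure Ω` matter. -/
structure IsClassicalSolution {n N m mS nS : ℕ} (Ω : Set (EuclideanSpace ℝ (Fin n)))
    (d : Fin N → ℝ) (bulk : ReactionNetwork N m) (surf : ReactionNetwork N mS)
    (eb : Module.Basis (Fin nS) ℝ surf.conservationSpace)
    (c₀ : EuclideanSpace ℝ (Fin n) → EuclideanSpace ℝ (Fin N)) (T : EReal)
    (c : ℝ → EuclideanSpace ℝ (Fin n) → EuclideanSpace ℝ (Fin N)) : Prop where
  pos_time : 0 < T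
  regular : ∀ i, IsC12 Ω T (fun t z => c t z i)
  nonneg : ∀ t ∈ timeInterval T, ∀ z ∈ closure Ω, ∀ i, 0 ≤ c t z i
  bulk_eq : ∀ t ∈ timeInterval T, ∀ z ∈ Ω, ∀ i,
    derivWithin (fun s => c s z i) (timeInterval T) t
      - d i * Laplacian.laplacian (fun y => c t y i) z = bulk.rate (fun j => c t z j) i
  boundary_eq : ∀ t ∈ timeInterval T, SatisfiesBoundaryConditions Ω d surf eb (c t)
  initial_eq : ∀ z ∈ closure Ω, c 0 z = c₀ z

/-- A classical solution on `[0, Tmax)` that cannot be continued to a larger time interval. -/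
structure IsMaximalClassicalSolution {n N m mS nS : ℕ} (Ω : Set (EuclideanSpace ℝ (Fin n)))
    (d : Fin N → ℝ) (bulk : ReactionNetwork N m) (surf : ReactionNetwork N mS)
    (eb : Module.Basis (Fin nS) ℝ surf.conservationSpace)
    (c₀ : EuclideanSpace ℝ (Fin n) → EuclideanSpace ℝ (Fin N)) (Tmax : EReal)
    (c : ℝ → EuclideanSpace ℝ (Fin n) → EuclideanSpace ℝ (Fin N)) : Prop where
  isSolution : IsClassicalSolution Ω d bulk surf eb c₀ Tmax c
  not_continuable : ∀ T' : EReal, Tmax < T' → ∀ c',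
    IsClassicalSolution Ω d bulk surf eb c₀ T' c' →
      ¬ ∀ t ∈ timeInterval Tmax, ∀ z ∈ closure Ω, c' t z = c t z

/-! ### Free energy and its dissipation -/

/-- The free energy `∫_Ω ∑ᵢ cᵢ (μᵢ⁰ + ln cᵢ - 1) dz` (with `0 ln 0 = 0`). -/
def freeEnergy {n N : ℕ} (Ω : Set (EuclideanSpace ℝ (Fin n))) (μ₀ : Fin N → ℝ)
    (c : EuclideanSpace ℝ (Fin n) → EuclideanSpace ℝ (Fin N)) : ℝ :=
  ∫ z in Ω, ∑ i, c z i * (μ₀ i + Real.log (c z i) - 1)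

/-- The density `∑ᵢ dᵢ |∇cᵢ|² / cᵢ` of the dissipation by diffusion. -/
def diffusionDissipation {n N : ℕ} (d : Fin N → ℝ)
    (c : EuclideanSpace ℝ (Fin n) → EuclideanSpace ℝ (Fin N))
    (z : EuclideanSpace ℝ (Fin n)) : ℝ :=
  ∑ i, d i * (‖gradient (fun y => c y i) z‖ ^ 2 / c z i)

/-- The density `k_a^f c^{αᵃ} 𝒜ₐ (exp 𝒜ₐ - 1)` of the dissipation by the `a`-th bulk reaction. -/
def reactionDissipation {N m : ℕ} (R : ReactionNetwork N m) (μ₀ : Fin N → ℝ) (a : Fin m)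
    (c : Fin N → ℝ) : ℝ :=
  R.forward a c * (R.affinity μ₀ a c * (Real.exp (R.affinity μ₀ a c) - 1))

end

/-! Put `p = ∑ eᵢ cᵢ` and `q = ∑ eᵢ dᵢ cᵢ`. Pairing the system with the conservation vector `e`
removes all bulk reactions and turns the boundary conditions into a Neumann condition, so `∂_t p = Δ
q` and `∂_n q = 0` (`IsClassicalSolution.isDiffusionPair`). Since `c ≥ 0` and all weights are
positive, `p` and `q` each control `|c|`, and the three bounds become statements about such a pair.

Integrating over `Ω` conserves the mass of `p`, which is the `L_∞ L_1` bound. For the others let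
`w(t) = ∫₀ᵗ q`. Integrating the equation in time gives `Δ w = p - p(0)`, and with `D ≥ dᵢ` one has
`∂_t w = q ≤ D p = D (Δ w + p(0))`. Thus `w` is a subsolution of a scalar heat equation with bounded
source, and a truncation argument yields `w ≤ K t` (`IsDiffusionPair.primitive_le`): this is the
`L_1 L_∞` bound. Multiplying `Δ w = p - p(0)` by `q` and integrating by parts gives `∫∫ p q = ∫ w(T)
p(0) - ½ ∫ |∇ w(T)|²`, so the bound on `w` also bounds `∫∫ p q`, which dominates `‖c‖²` in `L_2 L_2`
(`IsDiffusionPair.intervalIntegral_mul_le`).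

For the entropy identity, `r^b(c) = 0` and the independence of the surface stoichiometric vectors
force every surface reaction to be balanced separately. By the logarithmic closure every surface
affinity is then zero: the vector `μ` is itself a conservation vector of the surface chemistry, and
the no-flux conditions apply to it. The field `∑ dᵢ μᵢ ∇cᵢ` therefore has no normal component, and
its divergence gives the balance. Logarithms need positive concentrations: mass action is
quasi-positive, and an exponential barrier carries positivity from the boundary to the interior
(`IsC12.pos_of_supersolution`). As `c⁰` may vanish, the balance is proved on `[s, t]` with `s > 0`;
the limit `s → 0` uses the continuity of `x ln x` and the sign of the dissipation.

Every integration by parts has zero flux, so only a divergence theorem for tangential fields is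
needed (`setIntegral_covectorDiv_eq_zero`). It is obtained without surface measure: cutoffs
approaching the boundary have gradients of size `1 / |ρ|`, while the normal component of a
tangential field is `O(|ρ|)`, so the error terms stay bounded and converge to zero pointwise. -/

section

/-! ### Fields that are `C¹` up to the boundary -/

/-- The Euclidean space `ℝⁿ`. -/
abbrev Euc (n : ℕ) := EuclideanSpace ℝ (Fin n)

/-- The `j`-th standard basis vector. -/
noncomputable abbrev stdVec {n : ℕ} (j : Fin n) : Euc n := EuclideanSpace.basisFun (Fin n) ℝ j

/-- `F` is continuous on `closure Ω` and differentiable with bounded derivative in `Ω`. -/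
structure IsC1UpTo {n : ℕ} {V : Type*} [NormedAddCommGroup V] [NormedSpace ℝ V]
    (Ω : Set (Euc n)) (F : Euc n → V) : Prop where
  continuousOn : ContinuousOn F (closure Ω)
  differentiableAt : ∀ z ∈ Ω, DifferentiableAt ℝ F z
  bounded_fderiv : ∃ C, ∀ z ∈ Ω, ‖fderiv ℝ F z‖ ≤ C

/-- The divergence of a covector field. -/
noncomputable def covectorDiv {n : ℕ} (F : Euc n → Euc n →L[ℝ] ℝ) (z : Euc n) : ℝ :=
  ∑ j, fderiv ℝ F z (stdVec j) (stdVec j)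

/-- `F` has no flux through the boundary of `Ω`. -/
def HasZeroFlux {n : ℕ} (Ω : Set (Euc n)) (F : Euc n → Euc n →L[ℝ] ℝ) : Prop :=
  ∀ z ∈ frontier Ω, ∀ ν, IsOuterUnitNormal Ω z ν → F z ν = 0

variable {n : ℕ} {V W : Type*} [NormedAddCommGroup V] [NormedSpace ℝ V]
  [NormedAddCommGroup W] [NormedSpace ℝ W] {Ω : Set (Euc n)}

theorem exists_norm_bound_of_continuousOn_closure {X : Type*} [NormedAddCommGroup X]
    (hb : Bornology.IsBounded Ω) {F : Euc n → X}
    (hF : ContinuousOn F (closure Ω)) : ∃ C, 0 ≤ C ∧ ∀ z ∈ closure Ω, ‖F z‖ ≤ C := by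
  obtain ⟨C, hC⟩ := hb.isCompact_closure.exists_bound_of_continuousOn hF
  exact ⟨max C 0, le_max_right _ _, fun z hz => (hC z hz).trans (le_max_left _ _)⟩

namespace IsC1UpTo

theorem exists_bound {F : Euc n → V} (hF : IsC1UpTo Ω F) :
    ∃ C, 0 ≤ C ∧ ∀ z ∈ Ω, ‖fderiv ℝ F z‖ ≤ C := by
  obtain ⟨C, hC⟩ := hF.bounded_fderiv
  exact ⟨max C 0, le_max_right _ _, fun z hz => (hC z hz).trans (le_max_left _ _)⟩

theorem mono {Ω' : Set (Euc n)} (h : Ω' ⊆ Ω) {F : Euc n → V} (hF : IsC1UpTo Ω F) :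
    IsC1UpTo Ω' F :=
  ⟨hF.continuousOn.mono (closure_mono h), fun z hz => hF.differentiableAt z (h hz),
    hF.bounded_fderiv.imp fun _ hC z hz => hC z (h hz)⟩

theorem of_hasFDerivAt {F : Euc n → V} {F' : Euc n → Euc n →L[ℝ] V}
    (hc : ContinuousOn F (closure Ω)) (hd : ∀ z ∈ Ω, HasFDerivAt F (F' z) z)
    {C : ℝ} (hC : ∀ z ∈ Ω, ‖F' z‖ ≤ C) : IsC1UpTo Ω F :=
  ⟨hc, fun z hz => (hd z hz).differentiableAt,
    C, fun z hz => by rw [(hd z hz).fderiv]; exact hC z hz⟩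

theorem of_contDiff {F : Euc n → V} (hb : Bornology.IsBounded Ω) (hF : ContDiff ℝ 1 F) :
    IsC1UpTo Ω F := by
  obtain ⟨C, -, hC⟩ := exists_norm_bound_of_continuousOn_closure hb
    (hF.continuous_fderiv one_ne_zero).continuousOn
  exact ⟨hF.continuous.continuousOn, fun z _ => hF.differentiable one_ne_zero z,
    C, fun z hz => hC z (subset_closure hz)⟩

theorem const (v : V) : IsC1UpTo Ω (fun _ => v) :=
  ⟨continuousOn_const, fun _ _ => differentiableAt_const _, 0, fun z _ => by simp⟩

theorem add {F G : Euc n → V} (hF : IsC1UpTo Ω F) (hG : IsC1UpTo Ω G) :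
    IsC1UpTo Ω (fun z => F z + G z) := by
  obtain ⟨C, hC⟩ := hF.bounded_fderiv
  obtain ⟨D, hD⟩ := hG.bounded_fderiv
  refine of_hasFDerivAt (hF.continuousOn.add hG.continuousOn) (fun z hz =>
    (hF.differentiableAt z hz).hasFDerivAt.add (hG.differentiableAt z hz).hasFDerivAt)
    (C := C + D) fun z hz => (norm_add_le _ _).trans (add_le_add (hC z hz) (hD z hz))

theorem sum {ι : Type*} (s : Finset ι) {F : ι → Euc n → V} (hF : ∀ i ∈ s, IsC1UpTo Ω (F i)) :
    IsC1UpTo Ω (fun z => ∑ i ∈ s, F i z) := by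
  classical
  induction s using Finset.induction_on with
  | empty => simpa using const (0 : V)
  | insert i s hi ih =>
    simp only [Finset.sum_insert hi]
    exact (hF i (Finset.mem_insert_self _ _)).add
      (ih fun j hj => hF j (Finset.mem_insert_of_mem hj))

theorem clm_comp (L : V →L[ℝ] W) {F : Euc n → V} (hF : IsC1UpTo Ω F) :
    IsC1UpTo Ω (fun z => L (F z)) := by
  obtain ⟨C, hC0, hC⟩ := hF.exists_bound
  exact of_hasFDerivAt (L.continuous.comp_continuousOn hF.continuousOn)
    (fun z hz => L.hasFDerivAt.comp z (hF.differentiableAt z hz).hasFDerivAt)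
    (C := ‖L‖ * C) fun z hz => (ContinuousLinearMap.opNorm_comp_le _ _).trans
      (mul_le_mul_of_nonneg_left (hC z hz) (norm_nonneg _))

theorem smul (hb : Bornology.IsBounded Ω) {h : Euc n → ℝ} {F : Euc n → V}
    (hh : IsC1UpTo Ω h) (hF : IsC1UpTo Ω F) : IsC1UpTo Ω (fun z => h z • F z) := by
  obtain ⟨C, hC0, hC⟩ := hF.exists_bound
  obtain ⟨D, hD0, hD⟩ := hh.exists_bound
  obtain ⟨A, hA0, hA⟩ := exists_norm_bound_of_continuousOn_closure hb hF.continuousOn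
  obtain ⟨B, hB0, hB⟩ := exists_norm_bound_of_continuousOn_closure hb hh.continuousOn
  refine of_hasFDerivAt (hh.continuousOn.smul hF.continuousOn) (fun z hz =>
    (hh.differentiableAt z hz).hasFDerivAt.smul (hF.differentiableAt z hz).hasFDerivAt)
    (C := B * C + D * A) fun z hz => ?_
  refine (norm_add_le _ _).trans (add_le_add ?_ ?_)
  · rw [norm_smul]
    exact mul_le_mul (hB z (subset_closure hz)) (hC z hz) (norm_nonneg _) hB0
  · rw [ContinuousLinearMap.norm_smulRight_apply]
    exact mul_le_mul (hD z hz) (hA z (subset_closure hz)) (norm_nonneg _) hD0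

theorem const_smul (a : ℝ) {F : Euc n → V} (hF : IsC1UpTo Ω F) :
    IsC1UpTo Ω (fun z => a • F z) :=
  hF.clm_comp (a • ContinuousLinearMap.id ℝ V)

/-- Composition with a `C¹` function of one real variable. -/
theorem comp_real (hb : Bornology.IsBounded Ω) {h : Euc n → ℝ} (hh : IsC1UpTo Ω h)
    {f f' : ℝ → ℝ} (hf : ∀ z ∈ closure Ω, HasDerivAt f (f' (h z)) (h z))
    (hf' : ContinuousOn (fun z => f' (h z)) (closure Ω)) : IsC1UpTo Ω (fun z => f (h z)) := by
  obtain ⟨C, hC0, hC⟩ := hh.exists_bound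
  obtain ⟨B, hB0, hB⟩ := exists_norm_bound_of_continuousOn_closure hb hf'
  refine of_hasFDerivAt (fun z hz => (hf z hz).continuousAt.comp_continuousWithinAt
    (hh.continuousOn z hz)) (fun z hz => (hf z (subset_closure hz)).comp_hasFDerivAt z
      (hh.differentiableAt z hz).hasFDerivAt) (C := B * C) fun z hz => ?_
  rw [norm_smul]
  exact mul_le_mul (hB z (subset_closure hz)) (hC z hz) (norm_nonneg _) hB0

/-- Mean value inequality along a segment whose last point may lie on the boundary. -/
theorem norm_sub_le_of_segment {F : Euc n → V} (hF : IsC1UpTo Ω F) {C : ℝ}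
    (hC : ∀ z ∈ Ω, ‖fderiv ℝ F z‖ ≤ C) {y v : Euc n} {s : ℝ} (hs : 0 ≤ s)
    (hseg : ∀ τ ∈ Set.Ico 0 s, y + τ • v ∈ Ω) (hend : y + s • v ∈ closure Ω) :
    ‖F (y + s • v) - F y‖ ≤ C * ‖v‖ * s := by
  have hline : ∀ τ : ℝ, HasDerivAt (fun τ : ℝ => y + τ • v) v τ := fun τ => by
    simpa using ((hasDerivAt_id τ).smul_const v).const_add y
  have := norm_image_sub_le_of_norm_deriv_right_le_segment (a := 0) (b := s)
    (f := fun τ => F (y + τ • v)) (f' := fun τ => fderiv ℝ F (y + τ • v) v) (C := C * ‖v‖)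
    (fun τ hτ => by
      have hmem : ∀ τ ∈ Set.Icc 0 s, y + τ • v ∈ closure Ω := fun τ hτ => by
        rcases hτ.2.eq_or_lt with h | h
        · rw [h]; exact hend
        · exact subset_closure (hseg τ ⟨hτ.1, h⟩)
      exact ContinuousWithinAt.comp (f := fun τ : ℝ => y + τ • v) (hF.continuousOn _ (hmem τ hτ))
        (hline τ).continuousAt.continuousWithinAt hmem)
    (fun τ hτ => ((hF.differentiableAt _ (hseg τ hτ)).hasFDerivAt.comp_hasDerivAt τ
      (hline τ)).hasDerivWithinAt)
    (fun τ hτ => ((fderiv ℝ F (y + τ • v)).le_opNorm v).trans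
      (mul_le_mul_of_nonneg_right (hC _ (hseg τ hτ)) (norm_nonneg _))) s ⟨hs, le_rfl⟩
  simpa using this

end IsC1UpTo

theorem covectorDiv_smul {h : Euc n → ℝ} {F : Euc n → Euc n →L[ℝ] ℝ} {z : Euc n}
    (hh : DifferentiableAt ℝ h z) (hF : DifferentiableAt ℝ F z) :
    covectorDiv (fun z => h z • F z) z =
      h z * covectorDiv F z + ∑ j, fderiv ℝ h z (stdVec j) * F z (stdVec j) := by
  simp only [covectorDiv]
  rw [fderiv_fun_smul hh hF, Finset.mul_sum, ← Finset.sum_add_distrib]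
  simp

theorem covectorDiv_sum {ι : Type*} (s : Finset ι) {F : ι → Euc n → Euc n →L[ℝ] ℝ} {z : Euc n}
    (hF : ∀ i ∈ s, DifferentiableAt ℝ (F i) z) :
    covectorDiv (fun z => ∑ i ∈ s, F i z) z = ∑ i ∈ s, covectorDiv (F i) z := by
  simp only [covectorDiv]
  rw [(HasFDerivAt.fun_sum fun i hi => (hF i hi).hasFDerivAt).fderiv, Finset.sum_comm]
  simp

theorem covectorDiv_const_smul (a : ℝ) {F : Euc n → Euc n →L[ℝ] ℝ} {z : Euc n}
    (hF : DifferentiableAt ℝ F z) :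
    covectorDiv (fun z => a • F z) z = a * covectorDiv F z := by
  rw [covectorDiv_smul (differentiableAt_const a) hF]
  simp

theorem covectorDiv_congr {F G : Euc n → Euc n →L[ℝ] ℝ} {z : Euc n} (h : F =ᶠ[nhds z] G) :
    covectorDiv F z = covectorDiv G z := by
  simp only [covectorDiv, h.fderiv_eq]

/-- No regularity is needed: directional derivatives of an arbitrary map into a complete space are
measurable. Together with a bound on the derivative this replaces continuity of the divergence
everywhere below. -/
theorem measurable_covectorDiv (F : Euc n → Euc n →L[ℝ] ℝ) : Measurable (covectorDiv F) := by
  refine Finset.measurable_sum _ fun j _ => ?_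
  have h : Measurable fun z => fderiv ℝ F z (stdVec j) := measurable_fderiv_apply_const ℝ F _
  exact (ContinuousLinearMap.measurable_apply (stdVec j)).comp h

theorem norm_stdVec (j : Fin n) : ‖stdVec j‖ = 1 := by simp [stdVec]

theorem abs_covectorDiv_le {F : Euc n → Euc n →L[ℝ] ℝ} {z : Euc n} :
    |covectorDiv F z| ≤ n * ‖fderiv ℝ F z‖ := by
  refine (Finset.abs_sum_le_sum_abs _ _).trans ?_
  calc _ ≤ ∑ _j : Fin n, ‖fderiv ℝ F z‖ := Finset.sum_le_sum fun j _ => by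
        have := (fderiv ℝ F z).le_opNorm₂ (stdVec j) (stdVec j)
        simpa [norm_stdVec] using this
    _ = _ := by simp

theorem integrableOn_of_forall_norm_le (hΩ : IsOpen Ω) (hb : Bornology.IsBounded Ω)
    {f : Euc n → ℝ} (hf : AEStronglyMeasurable f (volume.restrict Ω)) {C : ℝ}
    (hC : ∀ z ∈ Ω, ‖f z‖ ≤ C) : IntegrableOn f Ω := by
  have : IsFiniteMeasure (volume.restrict Ω) := ⟨by simpa using hb.measure_lt_top⟩
  exact Integrable.of_bound hf C ((ae_restrict_iff' hΩ.measurableSet).2 (Filter.Eventually.of_forall hC))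

theorem IsC1UpTo.integrableOn_covectorDiv (hΩ : IsOpen Ω) (hb : Bornology.IsBounded Ω)
    {F : Euc n → Euc n →L[ℝ] ℝ} (hF : IsC1UpTo Ω F) : IntegrableOn (covectorDiv F) Ω := by
  obtain ⟨C, hC⟩ := hF.bounded_fderiv
  exact integrableOn_of_forall_norm_le hΩ hb (measurable_covectorDiv F).aestronglyMeasurable
    (C := n * C) fun z hz => abs_covectorDiv_le.trans
      (mul_le_mul_of_nonneg_left (hC z hz) (Nat.cast_nonneg n))

/-! ### The divergence theorem for fields without flux -/

/-- Each partial derivative integrates to zero, by integration by parts against the constant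
function 1. The derivative is only bounded, not continuous; that suffices for integrability on the
compact support. -/
theorem integral_covectorDiv_eq_zero_of_hasCompactSupport {K : Euc n → Euc n →L[ℝ] ℝ}
    (hK : Differentiable ℝ K) (hc : HasCompactSupport K) {C : ℝ}
    (hC : ∀ z, ‖fderiv ℝ K z‖ ≤ C) : ∫ z, covectorDiv K z = 0 := by
  have key : ∀ j, Integrable (fun z => fderiv ℝ K z (stdVec j) (stdVec j)) ∧
      ∫ z, fderiv ℝ K z (stdVec j) (stdVec j) = 0 := by
    intro j
    have hg : ∀ z, HasFDerivAt (fun z => K z (stdVec j))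
        ((ContinuousLinearMap.apply ℝ ℝ (stdVec j)).comp (fderiv ℝ K z)) z := fun z =>
      (ContinuousLinearMap.apply ℝ ℝ (stdVec j)).hasFDerivAt.comp z (hK z).hasFDerivAt
    have hint : Integrable (fun z => fderiv ℝ K z (stdVec j) (stdVec j)) := by
      have hm : Measurable (fun z => fderiv ℝ K z (stdVec j) (stdVec j)) :=
        (ContinuousLinearMap.measurable_apply (stdVec j)).comp
          (measurable_fderiv_apply_const ℝ K (stdVec j))
      refine (integrableOn_iff_integrable_of_support_subset
        (s := tsupport K) fun z hz => ?_).1 ?_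
      · by_contra h
        apply hz
        have : fderiv ℝ K z = 0 := by
          have := (notMem_tsupport_iff_eventuallyEq.1 h).fderiv_eq (𝕜 := ℝ)
          rw [this]; simp
        simp [this]
      · have : IsFiniteMeasure (volume.restrict (tsupport K)) :=
          ⟨by simpa using (hc.isCompact).measure_lt_top⟩
        refine Integrable.of_bound hm.aestronglyMeasurable C (Filter.Eventually.of_forall fun z => ?_)
        have := (fderiv ℝ K z).le_opNorm₂ (stdVec j) (stdVec j)
        simp only [norm_stdVec, mul_one] at this
        exact this.trans (hC z)
    refine ⟨hint, ?_⟩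
    have hgc : HasCompactSupport (fun z => K z (stdVec j)) :=
      hc.comp_left (g := fun L : Euc n →L[ℝ] ℝ => L (stdVec j)) (by simp)
    have hgcont : Continuous (fun z => K z (stdVec j)) :=
      (ContinuousLinearMap.apply ℝ ℝ (stdVec j)).continuous.comp hK.continuous
    have := integral_bilinear_hasFDerivAt_right_eq_neg_left_of_integrable (μ := volume)
      (f := fun _ : Euc n => (1 : ℝ)) (f' := fun _ => 0) (g := fun z => K z (stdVec j))
      (g' := fun z => (ContinuousLinearMap.apply ℝ ℝ (stdVec j)).comp (fderiv ℝ K z))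
      (v := stdVec j) (B := ContinuousLinearMap.mul ℝ ℝ) (by simp) (by simpa using hint)
      (by simpa using hgcont.integrable_of_hasCompactSupport hgc)
      (fun x _ => hasFDerivAt_const _ _) (fun x _ => hg x)
    simpa using this
  simp only [covectorDiv]
  rw [integral_finsetSum _ fun j _ => (key j).1]
  exact Finset.sum_eq_zero fun j _ => (key j).2

/-- Extension by zero: since the support of `h` lies inside `Ω`, the product `h • F` is
differentiable on the whole space whatever `F` does outside `Ω`, and the compactly supported case
applies. -/
theorem IsC1UpTo.setIntegral_covectorDiv_smul_eq_zero (hb : Bornology.IsBounded Ω)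
    {F : Euc n → Euc n →L[ℝ] ℝ} (hF : IsC1UpTo Ω F) {h : Euc n → ℝ}
    (hh : ContDiff ℝ 1 h) (hs : tsupport h ⊆ Ω) :
    ∫ z in Ω, covectorDiv (fun z => h z • F z) z = 0 := by
  have hout : ∀ z, z ∉ Ω → (fun z => h z • F z) =ᶠ[nhds z] fun _ => 0 := fun z hz => by
    filter_upwards [notMem_tsupport_iff_eventuallyEq.1 fun H => hz (hs H)] with y hy
    simp [hy]
  have hC1 := (IsC1UpTo.of_contDiff hb hh).smul hb hF
  have hfd : ∀ z, z ∉ Ω → fderiv ℝ (fun z => h z • F z) z = 0 := fun z hz => by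
    rw [(hout z hz).fderiv_eq]; simp
  obtain ⟨C, hC0, hC⟩ := hC1.exists_bound
  have hcs : HasCompactSupport h :=
    HasCompactSupport.of_support_subset_isCompact hb.isCompact_closure
      ((subset_tsupport h).trans (hs.trans subset_closure))
  rw [setIntegral_eq_integral_of_forall_compl_eq_zero fun z hz => by
    simp [covectorDiv, hfd z hz]]
  refine integral_covectorDiv_eq_zero_of_hasCompactSupport (fun z => ?_) hcs.smul_right
    (C := C) fun z => ?_
  · by_cases hz : z ∈ Ω
    · exact hC1.differentiableAt z hz
    · exact (hout z hz).differentiableAt_iff.2 (differentiableAt_const _)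
  · by_cases hz : z ∈ Ω
    · exact hC z hz
    · rw [hfd z hz]
      exact ContinuousLinearMap.opNorm_zero.trans_le hC0

end

/-! ### Tangential fields and cutoffs near a boundary point -/

section

variable {n : ℕ} {Ω : Set (Euc n)}

/-- Passes from the normal direction `∇ρ`, in which the flux condition is stated, to the coordinate
sum produced by the product rule for divergences. -/
theorem inner_covector_gradient (L : Euc n →L[ℝ] ℝ) (f : Euc n → ℝ) (z : Euc n) :
    L (gradient f z) = ∑ j, fderiv ℝ f z (stdVec j) * L (stdVec j) := by
  conv_lhs => rw [← (EuclideanSpace.basisFun (Fin n) ℝ).sum_repr' (gradient f z)]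
  rw [map_sum]
  refine Finset.sum_congr rfl fun j _ => ?_
  rw [map_smul, smul_eq_mul, real_inner_comm]
  congr 1
  simp [gradient]

/-- Near a boundary point, the normal component of a tangential field is controlled by the
defining function. -/
theorem exists_radius_flux_bound (hb : Bornology.IsBounded Ω) (hΩ : IsOpen Ω) {x₀ : Euc n}
    (hx₀ : x₀ ∈ frontier Ω) {ρ : Euc n → ℝ} (hρ : IsLocalDefiningFunction Ω x₀ ρ) :
    ∃ r > 0, (∀ y ∈ Metric.ball x₀ r, ContDiffAt ℝ 2 ρ y ∧ (y ∈ Ω ↔ ρ y < 0)) ∧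
      ∀ F, IsC1UpTo Ω F → HasZeroFlux Ω F → ∃ C, 0 ≤ C ∧ ∀ y ∈ Ω ∩ Metric.ball x₀ r,
        |∑ j, fderiv ℝ ρ y (stdVec j) * F y (stdVec j)| ≤ C * |ρ y| := by
  obtain ⟨hcd, hgrad, hev⟩ := hρ
  set v := gradient ρ x₀ with hv
  have hvpos : 0 < ‖v‖ := norm_pos_iff.2 hgrad
  have hv2 : fderiv ℝ ρ x₀ v = ‖v‖ ^ 2 := by
    rw [← real_inner_self_eq_norm_sq, ← InnerProductSpace.toDual_apply_apply (𝕜 := ℝ)]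
    simp [hv, gradient]
  -- The derivative of `ρ` in direction `v` equals `‖v‖²` at `x₀`, so half of it remains a lower
  -- bound nearby.
  set κ := ‖v‖ ^ 2 / 2 with hκ
  have hκpos : 0 < κ := by positivity
  have hfd1 : ContDiffAt ℝ 1 (fderiv ℝ ρ) x₀ := hcd.fderiv_right (by norm_num)
  have hfd2 : ContinuousAt (fderiv ℝ (fderiv ℝ ρ)) x₀ :=
    (hfd1.fderiv_right (m := 0) (by norm_num)).continuousAt
  have e1 : ∀ᶠ y in nhds x₀, κ < fderiv ℝ ρ y v := by
    have : ContinuousAt (fun y => fderiv ℝ ρ y v) x₀ := hfd1.continuousAt.clm_apply continuousAt_const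
    refine this.eventually_const_lt ?_
    change κ < fderiv ℝ ρ x₀ v
    rw [hv2, hκ]; linarith [sq_pos_of_pos hvpos]
  have e2 : ∀ᶠ y in nhds x₀, ‖fderiv ℝ (fderiv ℝ ρ) y‖ < ‖fderiv ℝ (fderiv ℝ ρ) x₀‖ + 1 :=
    (ContinuousAt.norm (E := Euc n →L[ℝ] Euc n →L[ℝ] ℝ) hfd2).eventually_lt_const (lt_add_one _)
  obtain ⟨R, hR, hball⟩ := Metric.eventually_nhds_iff_ball.1
    ((hcd.eventually (by simp)).and (hev.and (e1.and e2)))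
  have hρ0 : ρ x₀ = 0 := by
    have hmem : x₀ ∈ Metric.ball x₀ R := Metric.mem_ball_self hR
    have hnot : x₀ ∉ Ω := fun h => by
      have := hx₀.2; rw [hΩ.interior_eq] at this; exact this h
    refine le_antisymm ?_ (not_lt.1 fun h => hnot ((hball x₀ hmem).2.1.2 h))
    by_contra! h
    have hpos : ∀ᶠ y in nhds x₀, 0 < ρ y := hcd.continuousAt.eventually_const_lt h
    obtain ⟨y, ⟨hy1, hy2⟩, hy3⟩ := mem_closure_iff_nhds.1 (frontier_subset_closure hx₀) _
      (hpos.and hev)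
    have h1 : 0 < ρ y := hy1
    have h2 : ρ y < 0 := (show y ∈ Ω ↔ ρ y < 0 from hy2).1 hy3
    linarith
  -- With this threshold a segment in direction `v` of parameter length `|ρ y| / κ` is shorter than
  -- `R / 4`, so from a point within `R / 4` of `x₀` it stays in the ball of radius `R / 2`.
  have e3 : ∀ᶠ y in nhds x₀, |ρ y| < R / 4 * κ / ‖v‖ := by
    refine hcd.continuousAt.abs.eventually_lt_const ?_
    change |ρ x₀| < _
    rw [hρ0, abs_zero]; positivity
  obtain ⟨r', hr', hball'⟩ := Metric.eventually_nhds_iff_ball.1 e3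
  set r := min r' (R / 4) with hr
  have hrle : r ≤ R / 4 := min_le_right _ _
  have hsub : Metric.ball x₀ r ⊆ Metric.ball x₀ R := Metric.ball_subset_ball (by linarith)
  refine ⟨r, lt_min hr' (by linarith), fun y hy => ⟨(hball y (hsub hy)).1, (hball y (hsub hy)).2.1⟩,
    fun F hF hflux => ?_⟩
  -- Half the radius keeps the closure of `Ω'` inside the ball where `∇ρ` is `C¹` with bounded
  -- derivative, so that `⟨∇ρ, F⟩` is `C¹` up to the boundary of `Ω'`.
  set Ω' := Ω ∩ Metric.ball x₀ (R / 2) with hΩ'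
  have hcl : closure Ω' ⊆ Metric.ball x₀ R := fun y hy =>
    Metric.closedBall_subset_ball (by linarith) (Metric.closure_ball_subset_closedBall
      (closure_mono Set.inter_subset_right hy))
  have hcd' : ∀ y ∈ closure Ω', ContDiffAt ℝ 1 (fderiv ℝ ρ) y := fun y hy =>
    (hball y (hcl hy)).1.fderiv_right (by norm_num)
  have hb' : Bornology.IsBounded Ω' := hb.subset Set.inter_subset_left
  have hF' : IsC1UpTo Ω' F := hF.mono Set.inter_subset_left
  have hdρ : IsC1UpTo Ω' (fderiv ℝ ρ) :=
    ⟨fun y hy => (hcd' y hy).continuousAt.continuousWithinAt,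
      fun y hy => (hcd' y (subset_closure hy)).differentiableAt (by norm_num),
      _, fun y hy => (hball y (hcl (subset_closure hy))).2.2.2.le⟩
  have hg : IsC1UpTo Ω' (fun y => ∑ j, fderiv ℝ ρ y (stdVec j) * F y (stdVec j)) :=
    IsC1UpTo.sum _ fun j _ => IsC1UpTo.smul hb'
      (hdρ.clm_comp (ContinuousLinearMap.apply ℝ ℝ (stdVec j)))
      (hF'.clm_comp (ContinuousLinearMap.apply ℝ ℝ (stdVec j)))
  obtain ⟨C, hC0, hC⟩ := hg.exists_bound
  refine ⟨C * ‖v‖ / κ, by positivity, fun y hy => ?_⟩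
  have hyρ : ρ y < 0 := (hball y (hsub hy.2)).2.1.1 hy.1
  have hySmall : |ρ y| < R / 4 * κ / ‖v‖ :=
    hball' y (Metric.ball_subset_ball (min_le_left _ _) hy.2)
  -- Along `v` the function `ρ` grows at rate at least `κ`, so it reaches zero no later than
  -- parameter `S`.
  set S := |ρ y| / κ with hS
  have hS0 : 0 < S := div_pos (abs_pos.2 hyρ.ne) hκpos
  have hSv : S * ‖v‖ < R / 4 := by
    rw [lt_div_iff₀ hvpos] at hySmall
    rw [hS, div_mul_eq_mul_div, div_lt_iff₀ hκpos]
    exact hySmall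
  have hpath : ∀ τ ∈ Set.Icc 0 S, y + τ • v ∈ Metric.ball x₀ (R / 2) := fun τ hτ => by
    rw [mem_ball_iff_norm]
    have h1 : ‖y - x₀‖ < R / 4 := (mem_ball_iff_norm.1 hy.2).trans_le hrle
    have h2 : ‖τ • v‖ ≤ S * ‖v‖ := by
      rw [norm_smul, Real.norm_of_nonneg hτ.1]
      exact mul_le_mul_of_nonneg_right hτ.2 hvpos.le
    calc ‖y + τ • v - x₀‖ = ‖(y - x₀) + τ • v‖ := by congr 1; abel
      _ ≤ ‖y - x₀‖ + ‖τ • v‖ := norm_add_le _ _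
      _ < R / 2 := by linarith
  have hpathR : ∀ τ ∈ Set.Icc 0 S, y + τ • v ∈ Metric.ball x₀ R := fun τ hτ =>
    Metric.ball_subset_ball (by linarith) (hpath τ hτ)
  have hder : ∀ τ ∈ Set.Icc 0 S, HasDerivAt (fun τ : ℝ => ρ (y + τ • v))
      (fderiv ℝ ρ (y + τ • v) v) τ := fun τ hτ => by
    have hl : HasDerivAt (fun τ : ℝ => y + τ • v) v τ := by
      simpa using ((hasDerivAt_id τ).smul_const v).const_add y
    exact ((hball _ (hpathR τ hτ)).1.differentiableAt (by norm_num)).hasFDerivAt.comp_hasDerivAt τ hl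
  have hcont : ContinuousOn (fun τ : ℝ => ρ (y + τ • v)) (Set.Icc 0 S) := fun τ hτ =>
    (hder τ hτ).continuousAt.continuousWithinAt
  have hmono : StrictMonoOn (fun τ : ℝ => ρ (y + τ • v)) (Set.Icc 0 S) := by
    refine strictMonoOn_of_deriv_pos (convex_Icc 0 S) hcont fun τ hτ => ?_
    rw [interior_Icc] at hτ
    have hτ' := Set.Ioo_subset_Icc_self hτ
    rw [(hder τ hτ').deriv]
    exact hκpos.trans (hball _ (hpathR τ hτ')).2.2.1
  have hend : 0 ≤ ρ (y + S • v) := by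
    have := (convex_Icc 0 S).mul_sub_le_image_sub_of_le_deriv hcont
      (fun τ hτ => (hder τ (interior_subset hτ)).differentiableAt.differentiableWithinAt)
      (C := κ) (fun τ hτ => by
        rw [(hder τ (interior_subset hτ)).deriv]
        exact (hball _ (hpathR τ (interior_subset hτ))).2.2.1.le)
      0 ⟨le_rfl, hS0.le⟩ S ⟨hS0.le, le_rfl⟩ hS0.le
    have h2 : κ * S = -ρ y := by rw [hS, abs_of_neg hyρ]; field_simp
    simp only [zero_smul, add_zero, sub_zero] at this
    linarith
  -- By strict monotonicity this zero is the first exit from `Ω`: the segment before it lies in `Ω'`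
  -- and its end point lies on the boundary.
  obtain ⟨s, hs, hs0⟩ : ∃ s ∈ Set.Icc 0 S, ρ (y + s • v) = 0 :=
    intermediate_value_Icc hS0.le hcont ⟨by simpa using hyρ.le, hend⟩
  have hin : ∀ τ ∈ Set.Ico 0 s, y + τ • v ∈ Ω' := fun τ hτ => by
    have hτ' : τ ∈ Set.Icc 0 S := ⟨hτ.1, hτ.2.le.trans hs.2⟩
    refine ⟨(hball _ (hpathR τ hτ')).2.1.2 ?_, hpath τ hτ'⟩
    have : ρ (y + τ • v) < ρ (y + s • v) := hmono hτ' hs hτ.2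
    rwa [hs0] at this
  have hs_pos : 0 < s := hs.1.lt_of_ne fun h => by
    rw [← h, zero_smul, add_zero] at hs0; exact hyρ.ne hs0
  have hclos : y + s • v ∈ closure Ω' := by
    have hlim : Filter.Tendsto (fun τ : ℝ => y + τ • v) (nhdsWithin s (Set.Iio s))
        (nhds (y + s • v)) :=
      ((by fun_prop : Continuous fun τ : ℝ => y + τ • v).tendsto s).mono_left nhdsWithin_le_nhds
    refine mem_closure_of_tendsto hlim ?_
    filter_upwards [Ico_mem_nhdsLT hs_pos] with τ hτ using hin τ hτ
  have hfront : y + s • v ∈ frontier Ω :=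
    ⟨closure_mono Set.inter_subset_left hclos, fun h => by
      have := (hball _ (hpathR s hs)).2.1.1 (interior_subset h)
      exact this.ne hs0⟩
  have hzero : ∑ j, fderiv ℝ ρ (y + s • v) (stdVec j) * F (y + s • v) (stdVec j) = 0 := by
    have hgr : gradient ρ (y + s • v) ≠ 0 := fun h => by
      have h1 := hκpos.trans (hball _ (hpathR s hs)).2.2.1
      have h2 : fderiv ℝ ρ (y + s • v) = 0 := by
        simpa [gradient] using h
      rw [h2] at h1; simp at h1
    -- The same `ρ` is a defining function at the exit point, because the required properties hold
    -- throughout the large ball. Hence `⟨∇ρ, F⟩` vanishes there, and the mean value inequality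
    -- along the segment bounds it at `y`.
    have hν := hflux _ hfront _ ⟨ρ, ⟨(hball _ (hpathR s hs)).1, hgr, by
      filter_upwards [Metric.isOpen_ball.mem_nhds (hpathR s hs)] with x hx
      exact (hball x hx).2.1⟩, rfl⟩
    rw [map_smul, smul_eq_mul, mul_eq_zero, inv_eq_zero, norm_eq_zero] at hν
    rw [← inner_covector_gradient]
    exact hν.resolve_left hgr
  have hmv := hg.norm_sub_le_of_segment hC hs.1 hin hclos
  rw [hzero, zero_sub, norm_neg, Real.norm_eq_abs] at hmv
  refine hmv.trans ?_
  calc C * ‖v‖ * s ≤ C * ‖v‖ * S := mul_le_mul_of_nonneg_left hs.2 (by positivity)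
    _ = C * ‖v‖ / κ * |ρ y| := by rw [hS]; ring

/-- The derivative is supported in `[0, 1]`, hence so is its product with `s + 1`. At the cutoff
argument `s = -(k+1)ρ - 1` the weight `|s + 1|` is `(k+1)|ρ|`, so the bound is uniform in `k`. -/
theorem exists_bound_deriv_smoothTransition :
    ∃ M, 0 ≤ M ∧ ∀ s, |deriv Real.smoothTransition s| * |s + 1| ≤ M ∧
      (1 < s → deriv Real.smoothTransition s = 0) := by
  have hcont : Continuous (deriv Real.smoothTransition) :=
    (Real.smoothTransition.contDiff (n := 1)).continuous_deriv le_rfl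
  have h1 : ∀ s, 1 < s → deriv Real.smoothTransition s = 0 := fun s hs => by
    have : Real.smoothTransition =ᶠ[nhds s] fun _ => 1 := by
      filter_upwards [lt_mem_nhds hs] with x hx using Real.smoothTransition.one_of_one_le hx.le
    rw [this.deriv_eq]; simp
  have h0 : ∀ s, s < 0 → deriv Real.smoothTransition s = 0 := fun s hs => by
    have : Real.smoothTransition =ᶠ[nhds s] fun _ => 0 := by
      filter_upwards [gt_mem_nhds hs] with x hx using Real.smoothTransition.zero_of_nonpos hx.le
    rw [this.deriv_eq]; simp
  obtain ⟨M, hM⟩ := (isCompact_Icc (a := (0 : ℝ)) (b := 1)).exists_bound_of_continuousOn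
    (f := fun s => deriv Real.smoothTransition s * (s + 1)) (by fun_prop)
  refine ⟨max M 0, le_max_right _ _, fun s => ⟨?_, h1 s⟩⟩
  rcases lt_or_ge s 0 with h | h
  · simp [h0 s h]
  rcases lt_or_ge 1 s with h' | h'
  · simp [h1 s h']
  rw [← abs_mul]
  exact (hM s ⟨h, h'⟩).trans (le_max_left _ _)

end

/-! ### Localization and the global zero-flux divergence theorem -/

section

variable {n : ℕ} {Ω : Set (Euc n)}

/-- Zero-flux divergence theorem for fields localized near a point of the closure. -/
theorem exists_radius_setIntegral_covectorDiv_eq_zero (hΩ : IsBoundedC2Domain Ω) {x₀ : Euc n}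
    (hx₀ : x₀ ∈ closure Ω) :
    ∃ r > 0, ∀ F, IsC1UpTo Ω F → HasZeroFlux Ω F → ∀ f : Euc n → ℝ, ContDiff ℝ 1 f →
      tsupport f ⊆ Metric.ball x₀ r → ∫ z in Ω, covectorDiv (fun z => f z • F z) z = 0 := by
  by_cases hin : x₀ ∈ Ω
  · obtain ⟨r, hr, hsub⟩ := Metric.isOpen_iff.1 hΩ.isOpen x₀ hin
    exact ⟨r, hr, fun F hF _ f hf hs =>
      hF.setIntegral_covectorDiv_smul_eq_zero hΩ.isBounded hf (hs.trans hsub)⟩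
  have hfr : x₀ ∈ frontier Ω := ⟨hx₀, fun h => hin (interior_subset h)⟩
  obtain ⟨ρ, hρ⟩ := hΩ.boundary x₀ hfr
  obtain ⟨r, hr, hnear, hbound⟩ := exists_radius_flux_bound hΩ.isBounded hΩ.isOpen hfr hρ
  refine ⟨r, hr, fun F hF hflux f hf hs => ?_⟩
  obtain ⟨C, hC0, hC⟩ := hbound F hF hflux
  obtain ⟨M, hM0, hM⟩ := exists_bound_deriv_smoothTransition
  have hfC1 := IsC1UpTo.of_contDiff hΩ.isBounded hf
  have hfF := hfC1.smul hΩ.isBounded hF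
  obtain ⟨A, hA0, hA⟩ := exists_norm_bound_of_continuousOn_closure hΩ.isBounded hfC1.continuousOn
  obtain ⟨D, hD0, hD⟩ := hfF.exists_bound
  -- the cutoff functions vanish near the boundary and tend to `1` in `Ω`
  set s : ℕ → Euc n → ℝ := fun k z => -((k + 1 : ℝ) * ρ z) - 1 with hsdef
  set h : ℕ → Euc n → ℝ := fun k z => Real.smoothTransition (s k z) * f z with hh
  have hoff : ∀ k z, z ∉ tsupport f → h k =ᶠ[nhds z] 0 := fun k z hz => by
    filter_upwards [notMem_tsupport_iff_eventuallyEq.1 hz] with y hy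
    simp [hh, hy]
  have hsC : ∀ k, ∀ z ∈ Metric.ball x₀ r, ContDiffAt ℝ 1 (s k) z := fun k z hz =>
    (((contDiffAt_const (c := (k + 1 : ℝ))).mul ((hnear z hz).1.of_le (by norm_num))).neg).sub contDiffAt_const
  have hhC : ∀ k, ContDiff ℝ 1 (h k) := fun k => contDiff_iff_contDiffAt.2 fun z => by
    by_cases hz : z ∈ tsupport f
    · exact (Real.smoothTransition.contDiffAt.comp z (hsC k z (hs hz))).mul hf.contDiffAt
    · exact contDiffAt_const.congr_of_eventuallyEq (hoff k z hz)
  -- The shift by `-1` in `s` matters: where `ρ ≥ 0` one has `s ≤ -1`, so the cutoff vanishes on a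
  -- whole neighbourhood of each such point, not only at the point.
  have hhs : ∀ k, tsupport (h k) ⊆ Ω := fun k z hz => by
    by_contra hzΩ
    have hzf : z ∈ tsupport f := by
      by_contra H
      exact notMem_tsupport_iff_eventuallyEq.2 (hoff k z H) hz
    have hρz : 0 ≤ ρ z := not_lt.1 fun H => hzΩ ((hnear z (hs hzf)).2.2 H)
    have hsz : s k z < 0 := by
      have : 0 ≤ (k + 1 : ℝ) * ρ z := by positivity
      simp only [hsdef]; linarith
    refine notMem_tsupport_iff_eventuallyEq.2 ?_ hz
    filter_upwards [(hsC k z (hs hzf)).continuousAt.eventually_lt_const hsz] with y hy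
    simp [hh, Real.smoothTransition.zero_of_nonpos hy.le]
  have hformula : ∀ k, ∀ z ∈ Ω, z ∈ Metric.ball x₀ r →
      covectorDiv (fun z => h k z • F z) z =
        Real.smoothTransition (s k z) * covectorDiv (fun z => f z • F z) z
        - deriv Real.smoothTransition (s k z) * (k + 1) * f z *
          ∑ j, fderiv ℝ ρ z (stdVec j) * F z (stdVec j) := by
    intro k z hz hzr
    have hds : HasFDerivAt (s k) (-((k + 1 : ℝ) • fderiv ℝ ρ z)) z :=
      ((((hnear z hzr).1.differentiableAt (by norm_num)).hasFDerivAt.const_mul (k + 1 : ℝ)).neg).sub_const 1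
    have hdχ : HasFDerivAt (fun z => Real.smoothTransition (s k z))
        (deriv Real.smoothTransition (s k z) • (-((k + 1 : ℝ) • fderiv ℝ ρ z))) z :=
      ((Real.smoothTransition.contDiff (n := 1)).differentiable one_ne_zero _).hasDerivAt.comp_hasFDerivAt z hds
    have heq : (fun z => h k z • F z) =
        fun z => Real.smoothTransition (s k z) • (fun z => f z • F z) z := by
      funext y; simp [hh, mul_smul]
    rw [heq, covectorDiv_smul hdχ.differentiableAt (hfF.differentiableAt z hz), hdχ.fderiv,
      sub_eq_add_neg, Finset.mul_sum, ← Finset.sum_neg_distrib]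
    congr 1
    refine Finset.sum_congr rfl fun j _ => ?_
    simp only [smul_apply, neg_apply, smul_eq_mul]
    ring
  have hoffdiv : ∀ k, ∀ z, z ∉ tsupport f → covectorDiv (fun z => h k z • F z) z = 0 ∧
      covectorDiv (fun z => f z • F z) z = 0 := by
    have hz0 : ∀ g : Euc n → ℝ, ∀ z, g =ᶠ[nhds z] 0 → covectorDiv (fun z => g z • F z) z = 0 := by
      intro g z hg
      have : (fun z => g z • F z) =ᶠ[nhds z] fun _ => 0 := by
        filter_upwards [hg] with y hy; simp [hy]
      rw [covectorDiv_congr this]; simp [covectorDiv]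
    exact fun k z hz => ⟨hz0 _ _ (hoff k z hz), hz0 _ _ (notMem_tsupport_iff_eventuallyEq.1 hz)⟩
  have hlim : Filter.Tendsto (fun k => ∫ z in Ω, covectorDiv (fun z => h k z • F z) z)
      Filter.atTop (nhds (∫ z in Ω, covectorDiv (fun z => f z • F z) z)) := by
    have : IsFiniteMeasure (volume.restrict Ω) := ⟨by simpa using hΩ.isBounded.measure_lt_top⟩
    refine tendsto_integral_of_dominated_convergence (fun _ => n * D + A * (C * M))
      (fun k => (measurable_covectorDiv _).aestronglyMeasurable) (integrable_const _)
      (fun k => (ae_restrict_iff' hΩ.isOpen.measurableSet).2 (Filter.Eventually.of_forall ?_))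
      ((ae_restrict_iff' hΩ.isOpen.measurableSet).2 (Filter.Eventually.of_forall ?_))
    · intro z hz
      by_cases hzf : z ∈ tsupport f
      · rw [hformula k z hz (hs hzf)]
        refine (norm_sub_le _ _).trans (add_le_add ?_ ?_)
        · rw [norm_mul, Real.norm_of_nonneg (Real.smoothTransition.nonneg _)]
          refine (mul_le_of_le_one_left (norm_nonneg _) (Real.smoothTransition.le_one _)).trans ?_
          exact abs_covectorDiv_le.trans (mul_le_mul_of_nonneg_left (hD z hz) (Nat.cast_nonneg n))
        · have h1 := hC z ⟨hz, hs hzf⟩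
          have h2 := (hM (s k z)).1
          have h3 : |s k z + 1| = (k + 1) * |ρ z| := by
            have : s k z + 1 = -((k + 1 : ℝ) * ρ z) := by simp [hsdef]
            rw [this, abs_neg, abs_mul, abs_of_nonneg (by positivity : (0 : ℝ) ≤ k + 1)]
          have h4 : |f z| ≤ A := hA z (subset_closure hz)
          rw [Real.norm_eq_abs, abs_mul, abs_mul, abs_mul,
            abs_of_nonneg (by positivity : (0 : ℝ) ≤ k + 1)]
          -- The factor `|ρ|` from the tangential bound absorbs the factor `k + 1` from the gradient
          -- of the cutoff.
          calc _ ≤ |deriv Real.smoothTransition (s k z)| * (k + 1) * |f z| * (C * |ρ z|) :=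
                mul_le_mul_of_nonneg_left h1 (by positivity)
            _ = |f z| * (C * (|deriv Real.smoothTransition (s k z)| * |s k z + 1|)) := by
                rw [h3]; ring
            _ ≤ A * (C * M) := by gcongr
      · rw [(hoffdiv k z hzf).1, norm_zero]
        positivity
    · intro z hz
      by_cases hzf : z ∈ tsupport f
      · have hρz : ρ z < 0 := (hnear z (hs hzf)).2.1 hz
        refine tendsto_const_nhds.congr' ?_
        -- From this index on `(k + 1)(-ρ z) > 2`, that is `s > 1`: the cutoff is identically 1 near
        -- `z` and the integrands equal their limit.
        obtain ⟨K, hK⟩ := exists_nat_gt (2 / (-ρ z))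
        filter_upwards [Filter.eventually_ge_atTop K] with k hk
        have hk' : (K : ℝ) ≤ k := by exact_mod_cast hk
        have hs1 : 1 < s k z := by
          rw [div_lt_iff₀ (by linarith)] at hK
          have : (K : ℝ) * (-ρ z) ≤ (k + 1 : ℝ) * (-ρ z) :=
            mul_le_mul_of_nonneg_right (by linarith) (by linarith)
          simp only [hsdef]; linarith
        rw [hformula k z hz (hs hzf), (hM (s k z)).2 hs1,
          Real.smoothTransition.one_of_one_le hs1.le]
        simp
      · simp only [(hoffdiv _ z hzf).1, (hoffdiv 0 z hzf).2]
        exact tendsto_const_nhds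
  have hzero : ∀ k, ∫ z in Ω, covectorDiv (fun z => h k z • F z) z = 0 := fun k =>
    hF.setIntegral_covectorDiv_smul_eq_zero hΩ.isBounded (hhC k) (hhs k)
  simp only [hzero] at hlim
  exact (tendsto_nhds_unique hlim tendsto_const_nhds)

/-- **Divergence theorem** for fields without flux through the boundary of a `C²` domain. -/
theorem setIntegral_covectorDiv_eq_zero (hΩ : IsBoundedC2Domain Ω)
    {F : Euc n → Euc n →L[ℝ] ℝ} (hF : IsC1UpTo Ω F) (hflux : HasZeroFlux Ω F) :
    ∫ z in Ω, covectorDiv F z = 0 := by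
  choose! r hr hloc using fun x hx => exists_radius_setIntegral_covectorDiv_eq_zero hΩ (x₀ := x) hx
  obtain ⟨t, ht, hcover⟩ := hΩ.isBounded.isCompact_closure.elim_nhds_subcover
    (fun x => Metric.ball x (r x / 3)) fun x hx => Metric.ball_mem_nhds x (by have := hr x hx; positivity)
  have hbump : ∀ x ∈ t, ∃ f : Euc n → ℝ, ContDiff ℝ 1 f ∧ tsupport f ⊆ Metric.ball x (r x) ∧
      ∀ y ∈ Metric.ball x (r x / 3), f y = 1 := fun x hx => by
    have hrx := hr x (ht x hx)
    let b : ContDiffBump x := ⟨r x / 3, r x / 2, by positivity, by linarith⟩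
    exact ⟨b, b.contDiff, by
      rw [b.tsupport_eq]; exact Metric.closedBall_subset_ball (by change r x / 2 < r x; linarith),
      fun y hy => b.one_of_mem_closedBall (Metric.ball_subset_closedBall hy)⟩
  choose! f hfC hfs hf1 using hbump
  -- The function `g` is the product of the factors `1 - f x` over `u`. Inserting `x` subtracts `div
  -- (f x • g • F)`, whose integral is zero by the local result; once all of `t` is used, `g`
  -- vanishes near every point of `Ω`.
  have key : ∀ u ⊆ t, ∃ g : Euc n → ℝ, ContDiff ℝ 1 g ∧
      (∀ x ∈ u, ∀ y ∈ Metric.ball x (r x / 3), g y = 0) ∧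
      ∫ z in Ω, covectorDiv (fun z => g z • F z) z = ∫ z in Ω, covectorDiv F z := by
    classical
    intro u
    induction u using Finset.induction_on with
    | empty => exact fun _ => ⟨fun _ => 1, contDiff_const, by simp, by simp⟩
    | insert x u hx ih =>
      intro hu
      obtain ⟨g, hg, hg0, hgi⟩ := ih fun y hy => hu (Finset.mem_insert_of_mem hy)
      have hxt := hu (Finset.mem_insert_self x u)
      have hgF := (IsC1UpTo.of_contDiff hΩ.isBounded hg).smul hΩ.isBounded hF
      have hfgF := (IsC1UpTo.of_contDiff hΩ.isBounded (hfC x hxt)).smul hΩ.isBounded hgF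
      refine ⟨fun y => (1 - f x y) * g y, (contDiff_const.sub (hfC x hxt)).mul hg, ?_, ?_⟩
      · intro x' hx' y hy
        rcases Finset.mem_insert.1 hx' with rfl | h
        · simp [hf1 x' hxt y hy]
        · simp [hg0 x' h y hy]
      · have h0 := hloc x (ht x hxt) _ hgF (fun z hz ν hν => by simp [hflux z hz ν hν]) _
          (hfC x hxt) (hfs x hxt)
        rw [← hgi, ← sub_zero (∫ z in Ω, covectorDiv (fun z => g z • F z) z), ← h0, ← integral_sub
          (hgF.integrableOn_covectorDiv hΩ.isOpen hΩ.isBounded)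
          (hfgF.integrableOn_covectorDiv hΩ.isOpen hΩ.isBounded)]
        refine setIntegral_congr_fun hΩ.isOpen.measurableSet fun z hz => ?_
        have hd := (hgF.differentiableAt z hz).hasFDerivAt.sub
          (hfgF.differentiableAt z hz).hasFDerivAt
        have heq : (fun z => ((1 - f x z) * g z) • F z) =
            (fun z => g z • F z) - fun z => f x z • g z • F z := by
          funext y
          ext w
          simp only [Pi.sub_apply, sub_apply, smul_apply, smul_eq_mul]
          ring
        simp only [covectorDiv, heq]
        rw [hd.fderiv, ← Finset.sum_sub_distrib]
        simp
  obtain ⟨g, -, hg0, hgi⟩ := key t subset_rfl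
  rw [← hgi]
  refine setIntegral_eq_zero_of_forall_eq_zero fun z hz => ?_
  obtain ⟨x, hx, hzx⟩ := Set.mem_iUnion₂.1 (hcover (subset_closure hz))
  have : (fun z => g z • F z) =ᶠ[nhds z] fun _ => 0 := by
    filter_upwards [Metric.isOpen_ball.mem_nhds hzx] with y hy
    simp [hg0 x hx y hy]
  rw [covectorDiv_congr this]
  simp [covectorDiv]

end

section

variable {n : ℕ} {Ω : Set (Euc n)}

/-! ### Integrals over time-space cylinders -/

theorem integrableOn_cylinder (hb : Bornology.IsBounded Ω) {a b : ℝ} {f : ℝ × Euc n → ℝ}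
    (hf : ContinuousOn f (Set.Icc a b ×ˢ closure Ω)) : IntegrableOn f (Set.Ioc a b ×ˢ Ω) :=
  (hf.integrableOn_compact (isCompact_Icc.prod hb.isCompact_closure)).mono_set
    (Set.prod_mono Set.Ioc_subset_Icc_self subset_closure)

theorem volume_restrict_prod (s : Set ℝ) (Ω : Set (Euc n)) :
    (volume : Measure (ℝ × Euc n)).restrict (s ×ˢ Ω) =
      (volume.restrict s).prod (volume.restrict Ω) := by
  rw [Measure.volume_eq_prod, Measure.prod_restrict]

theorem integrableOn_of_continuousOn_closure (hb : Bornology.IsBounded Ω) {f : Euc n → ℝ}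
    (hf : ContinuousOn f (closure Ω)) : IntegrableOn f Ω :=
  (hf.integrableOn_compact hb.isCompact_closure).mono_set subset_closure

theorem continuousOn_slice_space {X : Type*} [TopologicalSpace X] {s : Set ℝ} {K : Set (Euc n)}
    {g : ℝ → Euc n → X} (hg : ContinuousOn (fun p : ℝ × Euc n => g p.1 p.2) (s ×ˢ K))
    {t : ℝ} (ht : t ∈ s) : ContinuousOn (g t) K :=
  hg.comp (f := fun z => (t, z)) (by fun_prop) fun z hz => ⟨ht, hz⟩

theorem continuousOn_slice_time {X : Type*} [TopologicalSpace X] {s : Set ℝ} {K : Set (Euc n)}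
    {g : ℝ → Euc n → X} (hg : ContinuousOn (fun p : ℝ × Euc n => g p.1 p.2) (s ×ˢ K))
    {z : Euc n} (hz : z ∈ K) : ContinuousOn (fun t => g t z) s :=
  hg.comp (f := fun t => (t, z)) (by fun_prop) fun t ht => ⟨ht, hz⟩

theorem setIntegral_cylinder {a b : ℝ} (hab : a ≤ b) {g : ℝ → Euc n → ℝ}
    (hg : IntegrableOn (fun p : ℝ × Euc n => g p.1 p.2) (Set.Ioc a b ×ˢ Ω)) :
    ∫ p in Set.Ioc a b ×ˢ Ω, g p.1 p.2 = ∫ t in a..b, ∫ z in Ω, g t z := by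
  rw [intervalIntegral.integral_of_le hab, volume_restrict_prod, integral_prod]
  rwa [IntegrableOn, volume_restrict_prod] at hg

/-- The fundamental theorem of calculus in time, integrated over space. -/
theorem setIntegral_sub_eq_intervalIntegral (hb : Bornology.IsBounded Ω) (hΩ : IsOpen Ω)
    {a b : ℝ} (hab : a ≤ b) {g g' : ℝ → Euc n → ℝ}
    (hg : ContinuousOn (fun p : ℝ × Euc n => g p.1 p.2) (Set.Icc a b ×ˢ closure Ω))
    (hg' : ContinuousOn (fun p : ℝ × Euc n => g' p.1 p.2) (Set.Icc a b ×ˢ closure Ω))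
    (hder : ∀ z ∈ Ω, ∀ t ∈ Set.Ioo a b, HasDerivAt (fun t => g t z) (g' t z) t) :
    (∫ z in Ω, g b z) - ∫ z in Ω, g a z = ∫ t in a..b, ∫ z in Ω, g' t z := by
  rw [← integral_sub
    (integrableOn_of_continuousOn_closure hb (continuousOn_slice_space hg ⟨hab, le_rfl⟩))
    (integrableOn_of_continuousOn_closure hb (continuousOn_slice_space hg ⟨le_rfl, hab⟩)),
    intervalIntegral.integral_of_le hab]
  have hint := integrableOn_cylinder hb hg'
  rw [IntegrableOn, volume_restrict_prod] at hint
  -- Fubini reduces the claim to the fundamental theorem of calculus at each fixed point of `Ω`.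
  rw [integral_integral_swap hint]
  refine setIntegral_congr_fun hΩ.measurableSet fun z hz => ?_
  have hz' := subset_closure hz
  have hct := continuousOn_slice_time hg' hz'
  rw [← intervalIntegral.integral_of_le hab,
    intervalIntegral.integral_eq_sub_of_hasDerivAt_of_le hab (continuousOn_slice_time hg hz')
      (hder z hz) (hct.intervalIntegrable_of_Icc hab)]

/-- Primitives in time of jointly continuous functions are jointly continuous. -/
theorem continuousOn_primitive {V : Type} [NormedAddCommGroup V] [NormedSpace ℝ V]
    [FiniteDimensional ℝ V] (hb : Bornology.IsBounded Ω) {T : ℝ} {f : ℝ → Euc n → V}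
    (hf : ContinuousOn (fun p : ℝ × Euc n => f p.1 p.2) (Set.Icc 0 T ×ˢ closure Ω)) :
    ContinuousOn (fun p : ℝ × Euc n => ∫ s in (0 : ℝ)..p.1, f s p.2)
      (Set.Icc 0 T ×ˢ closure Ω) := by
  have hcl : IsClosed (Set.Icc 0 T ×ˢ closure Ω) :=
    (isCompact_Icc.prod hb.isCompact_closure).isClosed
  -- A continuous extension to the whole space-time lets the continuity theorem for parametric
  -- integrals of globally continuous integrands apply; on the cylinder the primitive is unchanged.
  have hTE : TietzeExtension.{0, 0} V := TietzeExtension.of_tvs ℝ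
  obtain ⟨g, hg⟩ := ContinuousMap.exists_restrict_eq hcl ⟨_, hf.domRestrict⟩
  have hg' : ∀ s ∈ Set.Icc 0 T, ∀ z ∈ closure Ω, g (s, z) = f s z := fun s hs z hz =>
    congrArg (fun h => h ⟨(s, z), hs, hz⟩) hg
  have hc : Continuous fun p : ℝ × Euc n => ∫ s in (0 : ℝ)..p.1, g (s, p.2) :=
    intervalIntegral.continuous_parametric_intervalIntegral_of_continuous (X := ℝ × Euc n)
      (f := fun p s => g (s, p.2)) (by unfold Function.uncurry; fun_prop) continuous_fst
  refine hc.continuousOn.congr fun p hp => ?_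
  refine intervalIntegral.integral_congr fun s hs => ?_
  rw [Set.uIcc_of_le hp.1.1] at hs
  exact (hg' s ⟨hs.1, hs.2.trans hp.1.2⟩ _ hp.2).symm

theorem hasDerivAt_primitive {V : Type*} [NormedAddCommGroup V] [NormedSpace ℝ V]
    [CompleteSpace V] {T : ℝ} {f : ℝ → V} (hf : ContinuousOn f (Set.Icc 0 T)) {t : ℝ}
    (ht : t ∈ Set.Ioo 0 T) : HasDerivAt (fun t => ∫ s in (0 : ℝ)..t, f s) (f t) t := by
  refine intervalIntegral.integral_hasDerivAt_right
    ((hf.mono (Set.Icc_subset_Icc_right ht.2.le)).intervalIntegrable_of_Icc ht.1.le) ?_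
    (hf.continuousAt (Icc_mem_nhds ht.1 ht.2))
  exact (hf.mono Set.Ioo_subset_Icc_self).stronglyMeasurableAtFilter isOpen_Ioo t ht

/-- Differentiation in space of a primitive in time. -/
theorem hasFDerivAt_primitive {V : Type*} [NormedAddCommGroup V] [NormedSpace ℝ V]
    (hΩ : IsOpen Ω) {t : ℝ} (ht : 0 ≤ t) {f : ℝ → Euc n → V}
    {f' : ℝ → Euc n → Euc n →L[ℝ] V}
    (hf : ∀ z ∈ Ω, ContinuousOn (fun s => f s z) (Set.Icc 0 t))
    (hf' : ∀ z ∈ Ω, ContinuousOn (fun s => f' s z) (Set.Icc 0 t))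
    {C : ℝ} (hC : ∀ s ∈ Set.Icc 0 t, ∀ z ∈ Ω, ‖f' s z‖ ≤ C)
    (hder : ∀ s ∈ Set.Icc 0 t, ∀ z ∈ Ω, HasFDerivAt (f s) (f' s z) z) {z : Euc n} (hz : z ∈ Ω) :
    HasFDerivAt (fun z => ∫ s in (0 : ℝ)..t, f s z) (∫ s in (0 : ℝ)..t, f' s z) z := by
  have hsub : Set.uIoc 0 t ⊆ Set.Icc 0 t := by
    rw [Set.uIoc_of_le ht]; exact Set.Ioc_subset_Icc_self
  refine intervalIntegral.hasFDerivAt_integral_of_dominated_of_fderiv_le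
    (F := fun z s => f s z) (F' := fun z s => f' s z) (bound := fun _ => C) (hΩ.mem_nhds hz)
    ?_ ((hf z hz).intervalIntegrable_of_Icc ht) ?_ ?_ intervalIntegrable_const ?_
  · filter_upwards [hΩ.mem_nhds hz] with y hy
    exact ((hf y hy).mono hsub).aestronglyMeasurable measurableSet_uIoc
  · exact ((hf' z hz).mono hsub).aestronglyMeasurable measurableSet_uIoc
  · exact Filter.Eventually.of_forall fun s hs y hy => hC s (hsub hs) y hy
  · exact Filter.Eventually.of_forall fun s hs y hy => hder s (hsub hs) y hy

/-! ### The class `C^{(1,2)}` -/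

theorem Icc_subset_timeInterval {T : EReal} {t : ℝ} (ht : t ∈ timeInterval T) {a : ℝ}
    (ha : 0 ≤ a) : Set.Icc a t ⊆ timeInterval T := fun _ hs =>
  ⟨ha.trans hs.1, (EReal.coe_le_coe_iff.2 hs.2).trans_lt ht.2⟩

theorem timeInterval_mem_nhds {T : EReal} {t : ℝ} (ht : t ∈ timeInterval T) (h0 : 0 < t) :
    timeInterval T ∈ nhds t :=
  Filter.inter_mem (Ici_mem_nhds h0)
    ((isOpen_Iio.preimage continuous_coe_real_ereal).mem_nhds ht.2)

theorem closure_mem_nhds (hΩ : IsOpen Ω) {z : Euc n} (hz : z ∈ Ω) : closure Ω ∈ nhds z :=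
  Filter.mem_of_superset (hΩ.mem_nhds hz) subset_closure

namespace IsC12

variable {T : EReal} {u : ℝ → Euc n → ℝ}

theorem contDiffAt (hu : IsC12 Ω T u) (hΩ : IsOpen Ω) {t : ℝ} (ht : t ∈ timeInterval T)
    {z : Euc n} (hz : z ∈ Ω) : ContDiffAt ℝ 2 (u t) z :=
  (hu.contDiffOn_space t ht).contDiffAt (closure_mem_nhds hΩ hz)

theorem fderivWithin_eventuallyEq (hΩ : IsOpen Ω) {f : Euc n → ℝ} {z : Euc n} (hz : z ∈ Ω) :
    fderivWithin ℝ f (closure Ω) =ᶠ[nhds z] fderiv ℝ f := by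
  filter_upwards [hΩ.mem_nhds hz] with y hy
  exact fderivWithin_of_mem_nhds (closure_mem_nhds hΩ hy)

theorem hasFDerivAt (hu : IsC12 Ω T u) (hΩ : IsOpen Ω) {t : ℝ} (ht : t ∈ timeInterval T)
    {z : Euc n} (hz : z ∈ Ω) : HasFDerivAt (u t) (fderivWithin ℝ (u t) (closure Ω) z) z := by
  rw [(fderivWithin_eventuallyEq hΩ hz).eq_of_nhds]
  exact ((hu.contDiffAt hΩ ht hz).differentiableAt (by norm_num)).hasFDerivAt

theorem differentiableAt_fderivWithin (hu : IsC12 Ω T u) (hΩ : IsOpen Ω) {t : ℝ}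
    (ht : t ∈ timeInterval T) {z : Euc n} (hz : z ∈ Ω) :
    DifferentiableAt ℝ (fderivWithin ℝ (u t) (closure Ω)) z :=
  (fderivWithin_eventuallyEq hΩ hz).differentiableAt_iff.2
    (((hu.contDiffAt hΩ ht hz).fderiv_right (m := 1) (by norm_num)).differentiableAt (by norm_num))

theorem iteratedFDerivWithin_apply (hΩ : IsOpen Ω) {f : Euc n → ℝ} {z : Euc n} (hz : z ∈ Ω)
    (v w : Euc n) : iteratedFDerivWithin ℝ 2 f (closure Ω) z ![v, w] =
      fderiv ℝ (fderivWithin ℝ f (closure Ω)) z v w := by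
  rw [(fderivWithin_eventuallyEq hΩ hz).fderiv_eq,
    iteratedFDerivWithin_congr_set (t := Set.univ) (Filter.eventuallyEq_univ.2
      (closure_mem_nhds hΩ hz)), iteratedFDerivWithin_univ, iteratedFDeriv_two_apply]
  simp

theorem covectorDiv_fderivWithin (hΩ : IsOpen Ω) {f : Euc n → ℝ} {z : Euc n} (hz : z ∈ Ω) :
    covectorDiv (fderivWithin ℝ f (closure Ω)) z = Laplacian.laplacian f z := by
  rw [InnerProductSpace.laplacian_eq_iteratedFDeriv_orthonormalBasis f
    (EuclideanSpace.basisFun (Fin n) ℝ)]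
  simp only [covectorDiv]
  refine Finset.sum_congr rfl fun j _ => ?_
  rw [(fderivWithin_eventuallyEq hΩ hz).fderiv_eq, iteratedFDeriv_two_apply]
  simp

theorem continuousOn_fderiv_fderivWithin (hu : IsC12 Ω T u) (hΩ : IsOpen Ω) :
    ContinuousOn (fun p : ℝ × Euc n => fderiv ℝ (fderivWithin ℝ (u p.1) (closure Ω)) p.2)
      (timeInterval T ×ˢ Ω) := by
  refine continuousOn_clm_apply.2 fun v => continuousOn_clm_apply.2 fun w => ?_
  have h : ContinuousOn (fun p : ℝ × Euc n =>
      iteratedFDerivWithin ℝ 2 (u p.1) (closure Ω) p.2 ![v, w]) (timeInterval T ×ˢ Ω) :=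
    (ContinuousMultilinearMap.apply ℝ (fun _ : Fin 2 => Euc n) ℝ ![v, w]).continuous.comp_continuousOn
      (hu.continuousOn_second_fderiv.mono (Set.prod_mono subset_rfl subset_closure))
  exact h.congr fun p hp => (iteratedFDerivWithin_apply hΩ hp.2 v w).symm

theorem exists_bound_fderiv_fderivWithin (hu : IsC12 Ω T u) (hΩ : IsOpen Ω)
    (hb : Bornology.IsBounded Ω) {t : ℝ} (ht : t ∈ timeInterval T) :
    ∃ C, 0 ≤ C ∧ ∀ s ∈ Set.Icc 0 t, ∀ z ∈ Ω,
      ‖fderiv ℝ (fderivWithin ℝ (u s) (closure Ω)) z‖ ≤ C := by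
  obtain ⟨C, hC⟩ := ((isCompact_Icc (a := (0 : ℝ)) (b := t)).prod
    hb.isCompact_closure).exists_bound_of_continuousOn (hu.continuousOn_second_fderiv.mono
      (Set.prod_mono (Icc_subset_timeInterval ht le_rfl) subset_rfl))
  refine ⟨max C 0, le_max_right _ _, fun s hs z hz => ?_⟩
  refine ContinuousLinearMap.opNorm_le_bound₂ _ (le_max_right _ _) fun v w => ?_
  rw [← iteratedFDerivWithin_apply hΩ hz]
  refine (ContinuousMultilinearMap.le_opNorm _ _).trans ?_
  rw [Fin.prod_univ_two, mul_assoc]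
  exact mul_le_mul_of_nonneg_right ((hC (s, z) ⟨hs, subset_closure hz⟩).trans (le_max_left _ _))
    (by positivity)

theorem isC1UpTo (hu : IsC12 Ω T u) (hΩ : IsOpen Ω) (hb : Bornology.IsBounded Ω) {t : ℝ}
    (ht : t ∈ timeInterval T) : IsC1UpTo Ω (u t) := by
  obtain ⟨C, -, hC⟩ := exists_norm_bound_of_continuousOn_closure hb
    (continuousOn_slice_space (g := fun t z => fderivWithin ℝ (u t) (closure Ω) z)
      hu.continuousOn_fderiv ht)
  exact IsC1UpTo.of_hasFDerivAt (continuousOn_slice_space hu.continuousOn ht)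
    (fun z hz => hu.hasFDerivAt hΩ ht hz) fun z hz => hC z (subset_closure hz)

theorem isC1UpTo_fderivWithin (hu : IsC12 Ω T u) (hΩ : IsOpen Ω) (hb : Bornology.IsBounded Ω)
    {t : ℝ} (ht : t ∈ timeInterval T) : IsC1UpTo Ω (fderivWithin ℝ (u t) (closure Ω)) := by
  obtain ⟨C, -, hC⟩ := hu.exists_bound_fderiv_fderivWithin hΩ hb ht
  exact ⟨continuousOn_slice_space (g := fun t z => fderivWithin ℝ (u t) (closure Ω) z)
    hu.continuousOn_fderiv ht, fun z hz => hu.differentiableAt_fderivWithin hΩ ht hz,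
    C, fun z hz => hC t ⟨ht.1, le_rfl⟩ z hz⟩

theorem hasDerivAt (hu : IsC12 Ω T u) {t : ℝ} (ht : t ∈ timeInterval T) (h0 : 0 < t)
    {z : Euc n} (hz : z ∈ closure Ω) :
    HasDerivAt (fun s => u s z) (derivWithin (fun s => u s z) (timeInterval T) t) t :=
  ((hu.differentiableOn_time z hz t ht).hasDerivWithinAt).hasDerivAt (timeInterval_mem_nhds ht h0)

end IsC12

end

section

variable {n : ℕ} {Ω : Set (Euc n)}

/-! ### A priori bounds for `∂_t p = Δ q` with Neumann boundary conditions -/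

/-- An exponent of at least 2 makes the truncated power differentiable at the kink. The maximum
principle uses the fourth power as a functional and the cube as a test function. -/
theorem hasDerivAt_max_zero_pow (k : ℕ) (x : ℝ) :
    HasDerivAt (fun x : ℝ => max x 0 ^ (k + 2)) ((k + 2) * max x 0 ^ (k + 1)) x := by
  rcases lt_trichotomy x 0 with hx | rfl | hx
  · have : (fun x : ℝ => max x 0 ^ (k + 2)) =ᶠ[nhds x] fun _ => 0 := by
      filter_upwards [gt_mem_nhds hx] with y hy
      simp [max_eq_right hy.le]
    simpa [max_eq_right hx.le] using (hasDerivAt_const x (0 : ℝ)).congr_of_eventuallyEq this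
  · have : (fun x : ℝ => max x 0 ^ (k + 2)) =O[nhds 0] fun x : ℝ => ‖x - 0‖ ^ 2 := by
      refine Asymptotics.IsBigO.of_bound 1 ?_
      filter_upwards [Metric.ball_mem_nhds (0 : ℝ) one_pos] with y hy
      rw [mem_ball_zero_iff, Real.norm_eq_abs] at hy
      have h0 : 0 ≤ max y 0 := le_max_right _ _
      have h1 : max y 0 ≤ |y| := max_le (le_abs_self y) (abs_nonneg y)
      rw [Real.norm_of_nonneg (by positivity), one_mul, sub_zero, norm_pow, norm_norm,
        Real.norm_eq_abs, pow_add]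
      calc max y 0 ^ k * max y 0 ^ 2 ≤ 1 * |y| ^ 2 := by
            gcongr
            exact pow_le_one₀ h0 (h1.trans hy.le)
        _ = |y| ^ 2 := one_mul _
    have h2 := (this.trans_isLittleO (Asymptotics.isLittleO_pow_sub_sub (0 : ℝ) one_lt_two))
    rw [hasDerivAt_iff_isLittleO]
    simpa using h2
  · have : (fun x : ℝ => max x 0 ^ (k + 2)) =ᶠ[nhds x] fun x => x ^ (k + 2) := by
      filter_upwards [lt_mem_nhds hx] with y hy
      simp [max_eq_left hy.le]
    have h := (hasDerivAt_pow (k + 2) x).congr_of_eventuallyEq this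
    simpa [max_eq_left hx.le] using h

/-- A continuous nonnegative function whose integral over an open set is not positive vanishes at
every point of it; the resulting sign extends to the closure by continuity. -/
theorem nonpos_of_setIntegral_pow_nonpos (hΩ : IsOpen Ω) (hb : Bornology.IsBounded Ω)
    {v : Euc n → ℝ} (hv : ContinuousOn v (closure Ω)) (k : ℕ)
    (h : ∫ z in Ω, max (v z) 0 ^ (k + 1) ≤ 0) : ∀ z ∈ closure Ω, v z ≤ 0 := by
  have hc : ContinuousOn (fun z => max (v z) 0 ^ (k + 1)) (closure Ω) :=
    (hv.sup continuousOn_const).pow _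
  have hpos : ∀ z, 0 ≤ max (v z) 0 ^ (k + 1) := fun z => pow_nonneg (le_max_right _ _) _
  have h0 := (setIntegral_eq_zero_iff_of_nonneg_ae (Filter.Eventually.of_forall hpos)
    (integrableOn_of_continuousOn_closure hb hc)).1
    (le_antisymm h (integral_nonneg hpos))
  have h1 := Measure.eqOn_open_of_ae_eq h0 hΩ (hc.mono subset_closure) continuousOn_const
  refine fun z hz => le_on_closure (fun y hy => ?_) hv continuousOn_const hz
  have := h1 hy
  simp only [Pi.zero_apply] at this
  exact max_eq_right_iff.1 (pow_eq_zero_iff (Nat.succ_ne_zero k) |>.1 this)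

/-- Functions `p, q` on `[0,T] × closure Ω` with `∂_t p = p' = Δ q` and `∂_n q = 0`, where `Dq` is
the spatial derivative of `q`. -/
structure IsDiffusionPair (Ω : Set (Euc n)) (T : ℝ) (p p' q : ℝ → Euc n → ℝ)
    (Dq : ℝ → Euc n → Euc n →L[ℝ] ℝ) : Prop where
  nonneg : 0 ≤ T
  cont_p : ContinuousOn (fun x : ℝ × Euc n => p x.1 x.2) (Set.Icc 0 T ×ˢ closure Ω)
  cont_p' : ContinuousOn (fun x : ℝ × Euc n => p' x.1 x.2) (Set.Icc 0 T ×ˢ closure Ω)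
  cont_q : ContinuousOn (fun x : ℝ × Euc n => q x.1 x.2) (Set.Icc 0 T ×ˢ closure Ω)
  cont_Dq : ContinuousOn (fun x : ℝ × Euc n => Dq x.1 x.2) (Set.Icc 0 T ×ˢ closure Ω)
  hasDerivAt : ∀ z ∈ closure Ω, ∀ t ∈ Set.Ioo 0 T, HasDerivAt (fun t => p t z) (p' t z) t
  hasFDerivAt : ∀ t ∈ Set.Icc 0 T, ∀ z ∈ Ω, HasFDerivAt (q t) (Dq t z) z
  differentiableAt : ∀ t ∈ Set.Icc 0 T, ∀ z ∈ Ω, DifferentiableAt ℝ (Dq t) z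
  cont_fderiv : ∀ z ∈ Ω, ContinuousOn (fun t => fderiv ℝ (Dq t) z) (Set.Icc 0 T)
  bound : ∃ C, ∀ t ∈ Set.Icc 0 T, ∀ z ∈ Ω, ‖fderiv ℝ (Dq t) z‖ ≤ C
  eq_div : ∀ t ∈ Set.Icc 0 T, ∀ z ∈ Ω, p' t z = covectorDiv (Dq t) z
  flux : ∀ t ∈ Set.Icc 0 T, HasZeroFlux Ω (Dq t)

namespace IsDiffusionPair

variable {T : ℝ} {p p' q : ℝ → Euc n → ℝ} {Dq : ℝ → Euc n → Euc n →L[ℝ] ℝ}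

theorem isC1UpTo_Dq (h : IsDiffusionPair Ω T p p' q Dq) {t : ℝ} (ht : t ∈ Set.Icc 0 T) :
    IsC1UpTo Ω (Dq t) :=
  ⟨continuousOn_slice_space h.cont_Dq ht, h.differentiableAt t ht, h.bound.imp fun _ hC => hC t ht⟩

theorem isC1UpTo_q (h : IsDiffusionPair Ω T p p' q Dq) (hb : Bornology.IsBounded Ω) {t : ℝ}
    (ht : t ∈ Set.Icc 0 T) : IsC1UpTo Ω (q t) := by
  obtain ⟨C, -, hC⟩ := exists_norm_bound_of_continuousOn_closure hb
    (continuousOn_slice_space h.cont_Dq ht)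
  exact IsC1UpTo.of_hasFDerivAt (continuousOn_slice_space h.cont_q ht) (h.hasFDerivAt t ht)
    fun z hz => hC z (subset_closure hz)

/-- Conservation of the total mass of `p`. -/
theorem setIntegral_eq (h : IsDiffusionPair Ω T p p' q Dq) (hΩ : IsBoundedC2Domain Ω) :
    ∫ z in Ω, p T z = ∫ z in Ω, p 0 z := by
  rw [← sub_eq_zero, setIntegral_sub_eq_intervalIntegral hΩ.isBounded hΩ.isOpen h.nonneg h.cont_p
    h.cont_p' fun z hz => h.hasDerivAt z (subset_closure hz)]
  refine intervalIntegral.integral_zero_ae (Filter.Eventually.of_forall fun t ht => ?_)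
  rw [Set.uIoc_of_le h.nonneg] at ht
  have ht' := Set.Ioc_subset_Icc_self ht
  rw [setIntegral_congr_fun hΩ.isOpen.measurableSet (h.eq_div t ht')]
  exact setIntegral_covectorDiv_eq_zero hΩ (h.isC1UpTo_Dq ht') (h.flux t ht')

/-- The time primitive of `q`. -/
noncomputable def primitive (q : ℝ → Euc n → ℝ) (t : ℝ) (z : Euc n) : ℝ := ∫ s in (0 : ℝ)..t, q s z

/-- The time primitive of `Dq`. -/
noncomputable def primitiveD (Dq : ℝ → Euc n → Euc n →L[ℝ] ℝ) (t : ℝ) (z : Euc n) :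
    Euc n →L[ℝ] ℝ := ∫ s in (0 : ℝ)..t, Dq s z

theorem continuousOn_primitive' (h : IsDiffusionPair Ω T p p' q Dq) (hb : Bornology.IsBounded Ω) :
    ContinuousOn (fun x : ℝ × Euc n => primitive q x.1 x.2) (Set.Icc 0 T ×ˢ closure Ω) :=
  continuousOn_primitive hb h.cont_q

theorem continuousOn_primitiveD (h : IsDiffusionPair Ω T p p' q Dq)
    (hb : Bornology.IsBounded Ω) :
    ContinuousOn (fun x : ℝ × Euc n => primitiveD Dq x.1 x.2) (Set.Icc 0 T ×ˢ closure Ω) :=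
  continuousOn_primitive hb h.cont_Dq

theorem hasFDerivAt_primitive' (h : IsDiffusionPair Ω T p p' q Dq) (hΩ : IsOpen Ω)
    (hb : Bornology.IsBounded Ω) {t : ℝ} (ht : t ∈ Set.Icc 0 T) {z : Euc n} (hz : z ∈ Ω) :
    HasFDerivAt (primitive q t) (primitiveD Dq t z) z := by
  have hsub : Set.Icc 0 t ⊆ Set.Icc 0 T := Set.Icc_subset_Icc_right ht.2
  obtain ⟨C, hC⟩ := (isCompact_Icc.prod hb.isCompact_closure).exists_bound_of_continuousOn h.cont_Dq
  exact hasFDerivAt_primitive hΩ ht.1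
    (fun z hz => (continuousOn_slice_time h.cont_q (subset_closure hz)).mono hsub)
    (fun z hz => (continuousOn_slice_time h.cont_Dq (subset_closure hz)).mono hsub)
    (fun s hs z hz => hC (s, z) ⟨hsub hs, subset_closure hz⟩)
    (fun s hs z hz => h.hasFDerivAt s (hsub hs) z hz) hz

theorem hasFDerivAt_primitiveD (h : IsDiffusionPair Ω T p p' q Dq) (hΩ : IsOpen Ω)
    {t : ℝ} (ht : t ∈ Set.Icc 0 T) {z : Euc n} (hz : z ∈ Ω) :
    HasFDerivAt (primitiveD Dq t) (∫ s in (0 : ℝ)..t, fderiv ℝ (Dq s) z) z := by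
  have hsub : Set.Icc 0 t ⊆ Set.Icc 0 T := Set.Icc_subset_Icc_right ht.2
  obtain ⟨C, hC⟩ := h.bound
  exact hasFDerivAt_primitive hΩ ht.1
    (fun z hz => (continuousOn_slice_time h.cont_Dq (subset_closure hz)).mono hsub)
    (fun z hz => (h.cont_fderiv z hz).mono hsub) (fun s hs z hz => hC s (hsub hs) z hz)
    (fun s hs z hz => (h.differentiableAt s (hsub hs) z hz).hasFDerivAt) hz

/-- The time integral of `∂_t p = Δ q`. It expresses `p` through the Laplacian of a single function
and is the identity behind both the pointwise and the `L_2` bound. -/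
theorem covectorDiv_primitiveD (h : IsDiffusionPair Ω T p p' q Dq) (hΩ : IsOpen Ω)
    {t : ℝ} (ht : t ∈ Set.Icc 0 T) {z : Euc n} (hz : z ∈ Ω) :
    covectorDiv (primitiveD Dq t) z = p t z - p 0 z := by
  have hsub : Set.Icc 0 t ⊆ Set.Icc 0 T := Set.Icc_subset_Icc_right ht.2
  have hz' := subset_closure hz
  have hint := ContinuousOn.intervalIntegrable_of_Icc (E := Euc n →L[ℝ] Euc n →L[ℝ] ℝ)
    (μ := volume) ht.1 ((h.cont_fderiv z hz).mono hsub)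
  simp only [covectorDiv]
  rw [(h.hasFDerivAt_primitiveD hΩ ht hz).fderiv]
  have hcomm : ∀ j : Fin n, (∫ s in (0 : ℝ)..t, fderiv ℝ (Dq s) z) (stdVec j) (stdVec j) =
      ∫ s in (0 : ℝ)..t, fderiv ℝ (Dq s) z (stdVec j) (stdVec j) := fun j => by
    have hint' : IntervalIntegrable (fun s => fderiv ℝ (Dq s) z (stdVec j)) volume 0 t :=
      ContinuousOn.intervalIntegrable_of_Icc ht.1
        (((h.cont_fderiv z hz).mono hsub).clm_apply continuousOn_const)
    rw [ContinuousLinearMap.intervalIntegral_apply hint,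
      ContinuousLinearMap.intervalIntegral_apply hint']
  rw [Finset.sum_congr rfl fun j _ => hcomm j, ← intervalIntegral.integral_finsetSum]
  · rw [← intervalIntegral.integral_eq_sub_of_hasDerivAt_of_le ht.1
      ((continuousOn_slice_time h.cont_p hz').mono hsub)
      (fun s hs => h.hasDerivAt z hz' s ⟨hs.1, hs.2.trans_le ht.2⟩)
      (((continuousOn_slice_time h.cont_p' hz').mono hsub).intervalIntegrable_of_Icc ht.1)]
    refine intervalIntegral.integral_congr fun s hs => ?_
    rw [Set.uIcc_of_le ht.1] at hs
    exact (h.eq_div s (hsub hs) z hz).symm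
  · intro j _
    refine ContinuousOn.intervalIntegrable_of_Icc ht.1 ?_
    exact ((((h.cont_fderiv z hz).mono hsub).clm_apply continuousOn_const).clm_apply
      continuousOn_const)

theorem isC1UpTo_primitive (h : IsDiffusionPair Ω T p p' q Dq) (hΩ : IsOpen Ω)
    (hb : Bornology.IsBounded Ω) {t : ℝ} (ht : t ∈ Set.Icc 0 T) :
    IsC1UpTo Ω (primitive q t) := by
  obtain ⟨C, -, hC⟩ := exists_norm_bound_of_continuousOn_closure hb
    (continuousOn_slice_space (h.continuousOn_primitiveD hb) ht)
  exact IsC1UpTo.of_hasFDerivAt (continuousOn_slice_space (h.continuousOn_primitive' hb) ht)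
    (fun z hz => h.hasFDerivAt_primitive' hΩ hb ht hz) fun z hz => hC z (subset_closure hz)

theorem isC1UpTo_primitiveD (h : IsDiffusionPair Ω T p p' q Dq) (hΩ : IsOpen Ω)
    (hb : Bornology.IsBounded Ω) {t : ℝ} (ht : t ∈ Set.Icc 0 T) :
    IsC1UpTo Ω (primitiveD Dq t) := by
  obtain ⟨C, hC⟩ := h.bound
  refine IsC1UpTo.of_hasFDerivAt (continuousOn_slice_space (h.continuousOn_primitiveD hb) ht)
    (fun z hz => h.hasFDerivAt_primitiveD hΩ ht hz) (C := C * |t - 0|) fun z hz => ?_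
  refine intervalIntegral.norm_integral_le_of_norm_le_const fun s hs => ?_
  rw [Set.uIoc_of_le ht.1] at hs
  exact hC s ⟨hs.1.le, hs.2.trans ht.2⟩ z hz

theorem hasZeroFlux_primitiveD (h : IsDiffusionPair Ω T p p' q Dq) {t : ℝ}
    (ht : t ∈ Set.Icc 0 T) : HasZeroFlux Ω (primitiveD Dq t) := by
  intro z hz ν hν
  have hint := ((continuousOn_slice_time h.cont_Dq (frontier_subset_closure hz)).mono
    (Set.Icc_subset_Icc_right ht.2)).intervalIntegrable_of_Icc (μ := volume) ht.1
  have := (ContinuousLinearMap.apply ℝ ℝ ν).intervalIntegral_comp_comm hint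
  change (∫ s in (0 : ℝ)..t, Dq s z) ν = 0
  refine Eq.trans this.symm ?_
  refine intervalIntegral.integral_zero_ae (Filter.Eventually.of_forall fun s hs => ?_)
  rw [Set.uIoc_of_le ht.1] at hs
  exact h.flux s ⟨hs.1.le, hs.2.trans ht.2⟩ z hz ν hν

/-- The maximum principle for the time primitive of `q`. -/
theorem primitive_le (h : IsDiffusionPair Ω T p p' q Dq) (hΩ : IsBoundedC2Domain Ω)
    {D K : ℝ} (hD : 0 ≤ D)
    (hq : ∀ t ∈ Set.Icc 0 T, ∀ z ∈ Ω, q t z ≤ D * p t z) (hK : ∀ z ∈ Ω, D * p 0 z ≤ K) :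
    ∀ z ∈ closure Ω, primitive q T z ≤ K * T := by
  have hb := hΩ.isBounded
  have ho := hΩ.isOpen
  set v : ℝ → Euc n → ℝ := fun t z => primitive q t z - K * t with hv
  have hvc : ContinuousOn (fun x : ℝ × Euc n => v x.1 x.2) (Set.Icc 0 T ×ˢ closure Ω) :=
    (h.continuousOn_primitive' hb).sub (by fun_prop)
  have hmc : ContinuousOn (fun x : ℝ × Euc n => max (v x.1 x.2) 0) (Set.Icc 0 T ×ˢ closure Ω) :=
    hvc.sup continuousOn_const
  -- The fourth power is chosen because its time derivative contains the cube of the positive part,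
  -- which is still `C¹` and so is admissible in the divergence theorem.
  have hint := setIntegral_sub_eq_intervalIntegral hb ho h.nonneg
    (g := fun t z => max (v t z) 0 ^ (2 + 2))
    (g' := fun t z => (2 + 2) * max (v t z) 0 ^ (2 + 1) * (q t z - K)) (hmc.pow _)
    ((continuousOn_const.mul (hmc.pow _)).mul (h.cont_q.sub continuousOn_const))
    (fun z hz t ht => by
      have h1 : HasDerivAt (fun t => v t z) (q t z - K) t :=
        ((hasDerivAt_primitive (continuousOn_slice_time h.cont_q (subset_closure hz)) ht).sub
          ((hasDerivAt_id t).const_mul K)).congr_deriv (by rw [mul_one])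
      have h2 := (hasDerivAt_max_zero_pow 2 (v t z)).comp t h1
      refine h2.congr_deriv ?_
      norm_num)
  have hle : ∫ t in (0 : ℝ)..T, ∫ z in Ω, (2 + 2) * max (v t z) 0 ^ (2 + 1) * (q t z - K) ≤ 0 := by
    rw [← neg_nonneg, ← intervalIntegral.integral_neg]
    refine intervalIntegral.integral_nonneg h.nonneg fun t ht => neg_nonneg.2 ?_
    have hvt : IsC1UpTo Ω (v t) := by
      simpa [hv, sub_eq_add_neg] using (h.isC1UpTo_primitive ho hb ht).add (IsC1UpTo.const (-(K * t)))
    have hcub : IsC1UpTo Ω (fun z => max (v t z) 0 ^ (1 + 2)) :=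
      hvt.comp_real hb (f := fun x => max x 0 ^ (1 + 2))
        (f' := fun x => ((1 : ℕ) + 2) * max x 0 ^ (1 + 1))
        (fun z _ => hasDerivAt_max_zero_pow 1 (v t z))
        (continuousOn_const.mul ((hvt.continuousOn.sup continuousOn_const).pow _))
    have hG := h.isC1UpTo_primitiveD ho hb ht
    have hF := hcub.smul hb hG
    have hzero := setIntegral_covectorDiv_eq_zero hΩ hF fun z hz ν hν => by
      simp [h.hasZeroFlux_primitiveD ht z hz ν hν]
    -- Since `q - K ≤ D (p - p(0)) = D Δ w`, the integrand is at most `4 D v₊³ Δ w = 4 D (div (v₊³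
    -- ∇w) - 3 v₊² |∇w|²)`; the square is discarded and the divergence integrates to zero.
    calc ∫ z in Ω, (2 + 2) * max (v t z) 0 ^ (2 + 1) * (q t z - K)
        ≤ ∫ z in Ω, 4 * D * covectorDiv
            (fun z => max (v t z) 0 ^ (1 + 2) • primitiveD Dq t z) z := by
          refine setIntegral_mono_on ?_ ((hF.integrableOn_covectorDiv ho hb).const_mul _)
            ho.measurableSet fun z hz => ?_
          · exact integrableOn_of_continuousOn_closure hb ((continuousOn_const.mul
              ((continuousOn_slice_space (g := fun t z => max (v t z) 0) hmc ht).pow _)).mul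
              ((continuousOn_slice_space h.cont_q ht).sub continuousOn_const))
          · have hdv : HasFDerivAt (v t) (primitiveD Dq t z) z :=
              (h.hasFDerivAt_primitive' ho hb ht hz).sub_const _
            have hdc : HasFDerivAt (fun z => max (v t z) 0 ^ (1 + 2))
                ((((1 : ℕ) + 2) * max (v t z) 0 ^ (1 + 1)) • primitiveD Dq t z) z :=
              (hasDerivAt_max_zero_pow 1 (v t z)).comp_hasFDerivAt z hdv
            rw [covectorDiv_smul (hcub.differentiableAt z hz) (hG.differentiableAt z hz),
              h.covectorDiv_primitiveD ho ht hz, hdc.fderiv]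
            have h1 := hq t ht z hz
            have h2 := hK z hz
            have hm : 0 ≤ max (v t z) 0 := le_max_right _ _
            have h3 : 0 ≤ ∑ j, (((((1 : ℕ) + 2) * max (v t z) 0 ^ (1 + 1)) • primitiveD Dq t z)
                (stdVec j)) * primitiveD Dq t z (stdVec j) := by
              refine Finset.sum_nonneg fun j _ => ?_
              rw [smul_apply, smul_eq_mul, mul_assoc]
              exact mul_nonneg (by positivity) (mul_self_nonneg _)
            have h4 : max (v t z) 0 ^ (2 + 1) * (q t z - K) ≤
                max (v t z) 0 ^ (2 + 1) * (D * (p t z - p 0 z)) :=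
              mul_le_mul_of_nonneg_left (by linarith) (by positivity)
            have h5 := mul_nonneg hD h3
            norm_num at h4 h5 ⊢
            linarith
      _ = 0 := by rw [integral_const_mul, hzero, mul_zero]
  have h0 : ∫ z in Ω, max (v 0 z) 0 ^ (2 + 2) = 0 := by simp [hv, primitive]
  -- The index `3` stands for the exponent `3 + 1 = 4`.
  have hfin := nonpos_of_setIntegral_pow_nonpos ho hb
    (continuousOn_slice_space hvc ⟨h.nonneg, le_rfl⟩) 3 (by
      have : ∫ z in Ω, max (v T z) 0 ^ (2 + 2) ≤ 0 := by
        rw [h0, sub_zero] at hint; rw [hint]; exact hle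
      exact this)
  intro z hz
  have := hfin z hz
  simp only [hv] at this
  linarith

/-- The space-time bound for the product `p q`. -/
theorem intervalIntegral_mul_le (h : IsDiffusionPair Ω T p p' q Dq) (hΩ : IsBoundedC2Domain Ω)
    {B : ℝ} (hB : ∀ z ∈ Ω, primitive q T z * p 0 z ≤ B) :
    ∫ t in (0 : ℝ)..T, ∫ z in Ω, p t z * q t z ≤ B * volume.real Ω := by
  have hb := hΩ.isBounded
  have ho := hΩ.isOpen
  have hp0 : ContinuousOn (fun x : ℝ × Euc n => p 0 x.2) (Set.Icc 0 T ×ˢ closure Ω) :=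
    (continuousOn_slice_space h.cont_p ⟨le_rfl, h.nonneg⟩).comp continuousOn_snd fun x hx => hx.2
  have hGj : ∀ j : Fin n, ContinuousOn (fun x : ℝ × Euc n => primitiveD Dq x.1 x.2 (stdVec j))
      (Set.Icc 0 T ×ˢ closure Ω) := fun j =>
    (h.continuousOn_primitiveD hb).clm_apply continuousOn_const
  have hDj : ∀ j : Fin n, ContinuousOn (fun x : ℝ × Euc n => Dq x.1 x.2 (stdVec j))
      (Set.Icc 0 T ×ˢ closure Ω) := fun j => h.cont_Dq.clm_apply continuousOn_const
  -- Here `g = w p(0) - ½ |∇w|²`, with time derivative `g' = q p(0) - ∇q · ∇w`; at `t = 0` both `w`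
  -- and `∇w` vanish.
  set g : ℝ → Euc n → ℝ := fun t z =>
    primitive q t z * p 0 z - (∑ j, primitiveD Dq t z (stdVec j) ^ 2) / 2 with hg
  set g' : ℝ → Euc n → ℝ := fun t z =>
    q t z * p 0 z - ∑ j, Dq t z (stdVec j) * primitiveD Dq t z (stdVec j) with hg'
  have hgc : ContinuousOn (fun x : ℝ × Euc n => g x.1 x.2) (Set.Icc 0 T ×ˢ closure Ω) :=
    ((h.continuousOn_primitive' hb).mul hp0).sub
      ((continuousOn_finsetSum _ fun j _ => (hGj j).pow 2).div_const 2)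
  have hgc' : ContinuousOn (fun x : ℝ × Euc n => g' x.1 x.2) (Set.Icc 0 T ×ˢ closure Ω) :=
    (h.cont_q.mul hp0).sub (continuousOn_finsetSum _ fun j _ => (hDj j).mul (hGj j))
  have hint := setIntegral_sub_eq_intervalIntegral hb ho h.nonneg hgc hgc' fun z hz t ht => by
    have h1 := hasDerivAt_primitive (continuousOn_slice_time h.cont_q (subset_closure hz)) ht
    have h2 := hasDerivAt_primitive (continuousOn_slice_time h.cont_Dq (subset_closure hz)) ht
    have h3 : ∀ j : Fin n, HasDerivAt (fun t => primitiveD Dq t z (stdVec j) ^ 2)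
        (2 * primitiveD Dq t z (stdVec j) * Dq t z (stdVec j)) t := fun j =>
      (((ContinuousLinearMap.apply ℝ ℝ (stdVec j)).hasFDerivAt.comp_hasDerivAt t h2).pow 2).congr_deriv
        (by simp [primitiveD])
    have h4 := (h1.mul_const (p 0 z)).sub
      ((HasDerivAt.fun_sum fun j (_ : j ∈ Finset.univ) => h3 j).div_const 2)
    refine h4.congr_deriv ?_
    simp only [hg', Finset.sum_div]
    congr 1
    exact Finset.sum_congr rfl fun j _ => by ring
  -- The difference of the integrands is `q (p - p(0)) + ∇q · ∇w = div (q ∇w)`, whose integral is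
  -- zero because `∇w` is tangential.
  have hslice : ∀ t ∈ Set.Icc 0 T, ∫ z in Ω, p t z * q t z = ∫ z in Ω, g' t z := fun t ht => by
    have hq := h.isC1UpTo_q hb ht
    have hG := h.isC1UpTo_primitiveD ho hb ht
    have hF := hq.smul hb hG
    have hzero := setIntegral_covectorDiv_eq_zero hΩ hF fun z hz ν hν => by
      simp [h.hasZeroFlux_primitiveD ht z hz ν hν]
    rw [← add_zero (∫ z in Ω, g' t z), ← hzero, ← integral_add
      (integrableOn_of_continuousOn_closure hb (continuousOn_slice_space hgc' ht))
      (hF.integrableOn_covectorDiv ho hb)]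
    refine setIntegral_congr_fun ho.measurableSet fun z hz => ?_
    simp only [hg']
    rw [covectorDiv_smul (hq.differentiableAt z hz) (hG.differentiableAt z hz),
      h.covectorDiv_primitiveD ho ht hz, (h.hasFDerivAt t ht z hz).fderiv]
    ring
  have hcongr : ∫ t in (0 : ℝ)..T, ∫ z in Ω, p t z * q t z = ∫ t in (0 : ℝ)..T, ∫ z in Ω, g' t z :=
    intervalIntegral.integral_congr fun t ht => by
      rw [Set.uIcc_of_le h.nonneg] at ht
      exact hslice t ht
  have h0 : ∫ z in Ω, g 0 z = 0 := by simp [hg, primitive, primitiveD]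
  have hconst : IntegrableOn (fun _ : Euc n => B) Ω :=
    integrableOn_const hb.measure_lt_top.ne
  rw [hcongr, ← hint, h0, sub_zero]
  calc ∫ z in Ω, g T z ≤ ∫ _z in Ω, B := by
        refine setIntegral_mono_on (integrableOn_of_continuousOn_closure hb
          (continuousOn_slice_space hgc ⟨h.nonneg, le_rfl⟩)) hconst ho.measurableSet fun z hz => ?_
        have h1 := hB z hz
        have h2 : 0 ≤ ∑ j, primitiveD Dq T z (stdVec j) ^ 2 :=
          Finset.sum_nonneg fun j _ => sq_nonneg _
        simp only [hg]
        linarith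
    _ = B * volume.real Ω := by rw [setIntegral_const, smul_eq_mul, mul_comm]

end IsDiffusionPair

end

section

variable {n N m mS nS : ℕ} {Ω : Set (Euc n)}

/-! ### The three a priori bounds -/

theorem exists_pos_forall_le {f : Fin N → ℝ} (hf : ∀ i, 0 < f i) : ∃ ε > 0, ∀ i, ε ≤ f i := by
  rcases isEmpty_or_nonempty (Fin N) with h | h
  · exact ⟨1, one_pos, fun i => h.elim i⟩
  · obtain ⟨i, hi⟩ := Finite.exists_min f
    exact ⟨f i, hf i, hi⟩

/-- Used with `v` a conservation vector, where every term vanishes, and with `v` the chemical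
potentials, where the inner sums are the affinities. -/
theorem ReactionNetwork.sum_mul_rate {R : ReactionNetwork N m} (v c : Fin N → ℝ) :
    ∑ i, v i * R.rate c i = ∑ a, (∑ i, v i * R.ν a i) * (R.forward a c - R.backward a c) := by
  simp only [ReactionNetwork.rate, Finset.mul_sum, Finset.sum_mul]
  rw [Finset.sum_comm]
  exact Finset.sum_congr rfl fun a _ => Finset.sum_congr rfl fun i _ => by ring

/-- The no-flux conditions hold for all conservation vectors of the surface chemistry. -/
theorem SatisfiesBoundaryConditions.sum_normalDeriv_eq_zero {d : Fin N → ℝ}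
    {surf : ReactionNetwork N mS} {eb : Module.Basis (Fin nS) ℝ surf.conservationSpace}
    {c : Euc n → EuclideanSpace ℝ (Fin N)} (h : SatisfiesBoundaryConditions Ω d surf eb c)
    {v : Fin N → ℝ} (hv : v ∈ surf.conservationSpace) {z : Euc n} (hz : z ∈ frontier Ω)
    {ν : Euc n} (hν : IsOuterUnitNormal Ω z ν) :
    ∑ i, v i * (d i * normalDeriv Ω (fun y => c y i) z ν) = 0 := by
  have hrep : ∀ i, v i = ∑ k, eb.repr ⟨v, hv⟩ k * (eb k : Fin N → ℝ) i := fun i => by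
    have h1 := congrArg (fun w : surf.conservationSpace => (w : Fin N → ℝ) i)
      (eb.sum_repr ⟨v, hv⟩)
    simp only [Submodule.coe_sum, Submodule.coe_smul, Finset.sum_apply, Pi.smul_apply,
      smul_eq_mul] at h1
    exact h1.symm
  calc ∑ i, v i * (d i * normalDeriv Ω (fun y => c y i) z ν)
      = ∑ k, eb.repr ⟨v, hv⟩ k * ∑ i, (eb k : Fin N → ℝ) i *
          (d i * normalDeriv Ω (fun y => c y i) z ν) := by
        simp only [Finset.mul_sum]
        rw [Finset.sum_comm]
        refine Finset.sum_congr rfl fun i _ => ?_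
        rw [hrep i, Finset.sum_mul]
        exact Finset.sum_congr rfl fun k _ => by rw [mul_assoc]
    _ = 0 := Finset.sum_eq_zero fun k _ => by
        rw [neg_eq_zero.1 (h.1 z hz ν hν k), mul_zero]

namespace IsClassicalSolution

variable {d : Fin N → ℝ} {bulk : ReactionNetwork N m} {surf : ReactionNetwork N mS}
  {eb : Module.Basis (Fin nS) ℝ surf.conservationSpace}
  {c₀ : Euc n → EuclideanSpace ℝ (Fin N)} {Tmax : EReal}
  {c : ℝ → Euc n → EuclideanSpace ℝ (Fin N)}

theorem continuousOn (h : IsClassicalSolution Ω d bulk surf eb c₀ Tmax c) :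
    ContinuousOn (fun x : ℝ × Euc n => c x.1 x.2) (timeInterval Tmax ×ˢ closure Ω) :=
  (PiLp.continuous_toLp 2 (fun _ : Fin N => ℝ)).comp_continuousOn
    (continuousOn_pi.2 fun i => (h.regular i).continuousOn)

/-- Orthogonality of `e` to the bulk vectors cancels the reaction terms in the equation for `p`;
orthogonality to the surface vectors makes `e` a combination of the `eᵏ`, which gives the Neumann
condition for `q`. -/
theorem isDiffusionPair (h : IsClassicalSolution Ω d bulk surf eb c₀ Tmax c)
    (hΩ : IsBoundedC2Domain Ω) {e : Fin N → ℝ} (he_bulk : e ∈ bulk.conservationSpace)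
    (he_surf : e ∈ surf.conservationSpace) {T : ℝ} (hT : T ∈ timeInterval Tmax) :
    IsDiffusionPair Ω T (fun t z => ∑ i, e i * c t z i)
      (fun t z => ∑ i, e i * derivWithin (fun s => c s z i) (timeInterval Tmax) t)
      (fun t z => ∑ i, e i * d i * c t z i)
      (fun t z => ∑ i, (e i * d i) • fderivWithin ℝ (fun y => c t y i) (closure Ω) z) := by
  have hb := hΩ.isBounded
  have ho := hΩ.isOpen
  have hIcc : Set.Icc 0 T ⊆ timeInterval Tmax := Icc_subset_timeInterval hT le_rfl
  have hsub : Set.Icc 0 T ×ˢ closure Ω ⊆ timeInterval Tmax ×ˢ closure Ω :=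
    Set.prod_mono hIcc subset_rfl
  have hfd : ∀ t ∈ Set.Icc 0 T, ∀ z ∈ Ω, HasFDerivAt
      (fun z => ∑ i, (e i * d i) • fderivWithin ℝ (fun y => c t y i) (closure Ω) z)
      (∑ i, (e i * d i) • fderiv ℝ (fderivWithin ℝ (fun y => c t y i) (closure Ω)) z) z :=
    fun t ht z hz => HasFDerivAt.fun_sum fun i _ =>
      ((h.regular i).differentiableAt_fderivWithin ho (hIcc ht) hz).hasFDerivAt.const_smul (e i * d i)
  refine ⟨hT.1, ?_, ?_, ?_, ?_, ?_, ?_, fun t ht z hz => (hfd t ht z hz).differentiableAt, ?_, ?_,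
    ?_, ?_⟩
  · exact continuousOn_finsetSum _ fun i _ =>
      continuousOn_const.mul ((h.regular i).continuousOn.mono hsub)
  · exact continuousOn_finsetSum _ fun i _ =>
      continuousOn_const.mul ((h.regular i).continuousOn_time_deriv.mono hsub)
  · exact continuousOn_finsetSum _ fun i _ =>
      continuousOn_const.mul ((h.regular i).continuousOn.mono hsub)
  · exact continuousOn_finsetSum _ fun i _ =>
      ((h.regular i).continuousOn_fderiv.mono hsub).const_smul (e i * d i)
  · exact fun z hz t ht => HasDerivAt.fun_sum fun i _ =>
      ((h.regular i).hasDerivAt (hIcc (Set.Ioo_subset_Icc_self ht)) ht.1 hz).const_mul (e i)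
  · exact fun t ht z hz => HasFDerivAt.fun_sum fun i _ =>
      ((h.regular i).hasFDerivAt ho (hIcc ht) hz).const_mul (e i * d i)
  · intro z hz
    have h1 : ContinuousOn (fun t => ∑ i, (e i * d i) •
        fderiv ℝ (fderivWithin ℝ (fun y => c t y i) (closure Ω)) z) (Set.Icc 0 T) :=
      continuousOn_finsetSum _ fun i _ => ((continuousOn_slice_time
        (g := fun t z => fderiv ℝ (fderivWithin ℝ (fun y => c t y i) (closure Ω)) z)
        ((h.regular i).continuousOn_fderiv_fderivWithin ho) hz).mono hIcc).const_smul (e i * d i)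
    exact h1.congr fun t ht => (hfd t ht z hz).fderiv
  · choose C hC0 hC using fun i => (h.regular i).exists_bound_fderiv_fderivWithin ho hb hT
    refine ⟨∑ i, ‖e i * d i‖ * C i, fun t ht z hz => ?_⟩
    rw [(hfd t ht z hz).fderiv]
    refine (norm_sum_le (E := Euc n →L[ℝ] Euc n →L[ℝ] ℝ) _ _).trans
      (Finset.sum_le_sum fun i _ => ?_)
    refine (ContinuousLinearMap.opNorm_smul_le _ _).trans ?_
    exact mul_le_mul_of_nonneg_left (hC i t ht z hz) (norm_nonneg _)
  · intro t ht z hz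
    have hd := fun i => (h.regular i).differentiableAt_fderivWithin ho (hIcc ht) hz
    rw [covectorDiv_sum (F := fun i z => (e i * d i) •
      fderivWithin ℝ (fun y => c t y i) (closure Ω) z) _ fun i _ => (hd i).const_smul (e i * d i)]
    have h0 : ∑ i, e i * bulk.rate (fun j => c t z j) i = 0 := by
      rw [ReactionNetwork.sum_mul_rate]
      exact Finset.sum_eq_zero fun a _ => by rw [he_bulk a, zero_mul]
    rw [← sub_eq_zero, ← Finset.sum_sub_distrib, ← h0]
    refine Finset.sum_congr rfl fun i _ => ?_
    rw [covectorDiv_const_smul _ (hd i), IsC12.covectorDiv_fderivWithin ho hz,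
      ← h.bulk_eq t (hIcc ht) z hz i]
    ring
  · intro t ht z hz ν hν
    have := (h.boundary_eq t (hIcc ht)).sum_normalDeriv_eq_zero he_surf hz hν
    rw [sum_apply, ← this]
    refine Finset.sum_congr rfl fun i _ => ?_
    rw [smul_apply, smul_eq_mul, mul_assoc]
    rfl

end IsClassicalSolution

/-- The time `T₀` may equal `Tmax`, where the solution need not be defined, so estimates are proved
on `[0, T]` with `T < T₀`, uniformly in `T`. Monotone convergence along `T ↑ T₀` then covers the
whole interval. -/
theorem lintegral_Ico_le {f : ℝ → ENNReal} {T₀ : ℝ} {C : ENNReal}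
    (h : ∀ T, T < T₀ → ∫⁻ t in Set.Ioc 0 T, f t ≤ C) : ∫⁻ t in Set.Ico 0 T₀, f t ≤ C := by
  rw [← setLIntegral_congr (Ioo_ae_eq_Ico (μ := volume) (a := (0 : ℝ)) (b := T₀))]
  obtain ⟨u, hu, hlt, hlim⟩ := exists_seq_strictMono_tendsto T₀
  have hU : Set.Ioo 0 T₀ = ⋃ k, Set.Ioc 0 (u k) := by
    ext t
    simp only [Set.mem_Ioo, Set.mem_iUnion, Set.mem_Ioc, exists_and_left]
    refine and_congr_right fun _ => ⟨fun ht => ?_, fun ⟨k, hk⟩ => hk.trans_lt (hlt k)⟩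
    exact ((hlim.eventually_const_lt ht).exists).imp fun _ hk => hk.le
  rw [hU, setLIntegral_iUnion_of_directed _ (Monotone.directed_le fun i j hij =>
    Set.Ioc_subset_Ioc_right (hu.monotone hij))]
  exact iSup_le fun k => h _ (hlt k)

theorem norm_le_sum_of_nonneg {x : EuclideanSpace ℝ (Fin N)} (hx : ∀ i, 0 ≤ x i) :
    ‖x‖ ≤ ∑ i, x i := by
  rw [EuclideanSpace.norm_eq]
  refine Real.sqrt_le_iff.2 ⟨Finset.sum_nonneg fun i _ => hx i, ?_⟩
  simp only [Real.norm_eq_abs, sq_abs]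
  exact Finset.sum_sq_le_sq_sum_of_nonneg fun i _ => hx i

theorem enorm_le_ofReal_of_norm_le {V : Type*} [NormedAddCommGroup V] {x : V} {r : ℝ}
    (h : ‖x‖ ≤ r) : ‖x‖ₑ ≤ ENNReal.ofReal r := by
  rw [← ofReal_norm]
  exact ENNReal.ofReal_le_ofReal h

namespace IsClassicalSolution

variable {d : Fin N → ℝ} {bulk : ReactionNetwork N m} {surf : ReactionNetwork N mS}
  {eb : Module.Basis (Fin nS) ℝ surf.conservationSpace}
  {c₀ : Euc n → EuclideanSpace ℝ (Fin N)} {Tmax : EReal}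
  {c : ℝ → Euc n → EuclideanSpace ℝ (Fin N)} {e : Fin N → ℝ}

theorem norm_le_div (h : IsClassicalSolution Ω d bulk surf eb c₀ Tmax c) {ε : ℝ} (hε : 0 < ε)
    {w : Fin N → ℝ} (hw : ∀ i, ε ≤ w i) {t : ℝ} (ht : t ∈ timeInterval Tmax) {z : Euc n}
    (hz : z ∈ closure Ω) : ‖c t z‖ ≤ (∑ i, w i * c t z i) / ε := by
  rw [le_div_iff₀ hε]
  calc ‖c t z‖ * ε ≤ (∑ i, c t z i) * ε :=
        mul_le_mul_of_nonneg_right (norm_le_sum_of_nonneg (h.nonneg t ht z hz)) hε.le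
    _ = ∑ i, ε * c t z i := by rw [mul_comm, Finset.mul_sum]
    _ ≤ ∑ i, w i * c t z i := Finset.sum_le_sum fun i _ =>
        mul_le_mul_of_nonneg_right (hw i) (h.nonneg t ht z hz i)

/-- The mass of `p` is conserved, and comparing `p` with `‖c‖` costs `1/ε` at time `T` and `∑ eᵢ` at
time `0`. -/
theorem eLpNorm_one_le (h : IsClassicalSolution Ω d bulk surf eb c₀ Tmax c)
    (hΩ : IsBoundedC2Domain Ω) (he_bulk : e ∈ bulk.conservationSpace)
    (he_surf : e ∈ surf.conservationSpace) {ε : ℝ} (hε : 0 < ε) (hεe : ∀ i, ε ≤ e i)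
    {T : ℝ} (hT : T ∈ timeInterval Tmax) :
    eLpNorm (c T) 1 (volume.restrict Ω) ≤
      ENNReal.ofReal ((∑ i, e i) / ε) * eLpNorm c₀ 1 (volume.restrict Ω) := by
  have hb := hΩ.isBounded
  have ho := hΩ.isOpen
  have hpair := h.isDiffusionPair hΩ he_bulk he_surf hT
  have hmass := hpair.setIntegral_eq hΩ
  have h0 : (0 : ℝ) ∈ timeInterval Tmax := ⟨le_rfl, by simpa using h.pos_time⟩
  have hlint : ∀ t ∈ Set.Icc 0 T, ∫⁻ z in Ω, ENNReal.ofReal ((∑ i, e i * c t z i) / ε) =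
      ENNReal.ofReal ((∫ z in Ω, ∑ i, e i * c t z i) / ε) := fun t ht => by
    rw [← integral_div, ofReal_integral_eq_lintegral_ofReal]
    · exact (integrableOn_of_continuousOn_closure hb
        (continuousOn_slice_space (g := fun t z => ∑ i, e i * c t z i) hpair.cont_p ht)).div_const ε
    · refine (ae_restrict_iff' ho.measurableSet).2 (Filter.Eventually.of_forall fun z hz => ?_)
      exact div_nonneg (Finset.sum_nonneg fun i _ => mul_nonneg (hε.le.trans (hεe i))
        (h.nonneg t (Icc_subset_timeInterval hT le_rfl ht) z (subset_closure hz) i)) hε.le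
  rw [eLpNorm_one_eq_lintegral_enorm, eLpNorm_one_eq_lintegral_enorm]
  calc ∫⁻ z in Ω, ‖c T z‖ₑ ≤ ∫⁻ z in Ω, ENNReal.ofReal ((∑ i, e i * c T z i) / ε) :=
        setLIntegral_mono' ho.measurableSet fun z hz =>
          enorm_le_ofReal_of_norm_le (h.norm_le_div hε hεe hT (subset_closure hz))
    _ = ∫⁻ z in Ω, ENNReal.ofReal ((∑ i, e i * c 0 z i) / ε) := by
        rw [hlint T ⟨hT.1, le_rfl⟩, hlint 0 ⟨le_rfl, hT.1⟩, hmass]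
    _ ≤ ∫⁻ z in Ω, ENNReal.ofReal ((∑ i, e i) / ε) * ‖c₀ z‖ₑ := by
        refine setLIntegral_mono' ho.measurableSet fun z hz => ?_
        rw [← ofReal_norm, ← ENNReal.ofReal_mul (div_nonneg
          (Finset.sum_nonneg fun i _ => hε.le.trans (hεe i)) hε.le),
          h.initial_eq z (subset_closure hz)]
        refine ENNReal.ofReal_le_ofReal ?_
        rw [div_mul_eq_mul_div, Finset.sum_mul]
        refine div_le_div_of_nonneg_right (Finset.sum_le_sum fun i _ => ?_) hε.le
        exact mul_le_mul_of_nonneg_left ((le_abs_self _).trans (PiLp.norm_apply_le (c₀ z) i))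
          (hε.le.trans (hεe i))
    _ = _ := lintegral_const_mul' _ _ ENNReal.ofReal_ne_top

theorem primitive_le (h : IsClassicalSolution Ω d bulk surf eb c₀ Tmax c)
    (hΩ : IsBoundedC2Domain Ω) (he_bulk : e ∈ bulk.conservationSpace)
    (he_surf : e ∈ surf.conservationSpace) (he : ∀ i, 0 < e i) {D : ℝ} (hD0 : 0 ≤ D)
    (hD : ∀ i, d i ≤ D) {P : ℝ} (hP : ∀ z ∈ closure Ω, ∑ i, e i * c₀ z i ≤ P)
    {T : ℝ} (hT : T ∈ timeInterval Tmax) {z : Euc n} (hz : z ∈ closure Ω) :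
    ∫ t in (0 : ℝ)..T, ∑ i, e i * d i * c t z i ≤ D * P * T := by
  refine (h.isDiffusionPair hΩ he_bulk he_surf hT).primitive_le hΩ hD0 (K := D * P) ?_ ?_ z hz
  · intro t ht z hz
    rw [Finset.mul_sum]
    refine Finset.sum_le_sum fun i _ => ?_
    have h1 := h.nonneg t (Icc_subset_timeInterval hT le_rfl ht) z (subset_closure hz) i
    calc e i * d i * c t z i = d i * (e i * c t z i) := by ring
      _ ≤ D * (e i * c t z i) := mul_le_mul_of_nonneg_right (hD i) (mul_nonneg (he i).le h1)
  · intro z hz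
    have hz' := subset_closure hz
    simp only [h.initial_eq z hz']
    exact mul_le_mul_of_nonneg_left (hP z hz') hD0

/-- For fixed `z` the time integral of `q` is the primitive `w`, already bounded pointwise up to the
boundary; dividing by the smallest weight `eᵢ dᵢ` recovers `‖c‖`. -/
theorem eLpNorm_time_le (h : IsClassicalSolution Ω d bulk surf eb c₀ Tmax c)
    (hΩ : IsBoundedC2Domain Ω) (he_bulk : e ∈ bulk.conservationSpace)
    (he_surf : e ∈ surf.conservationSpace) (he : ∀ i, 0 < e i) {D : ℝ} (hD0 : 0 ≤ D)
    (hD : ∀ i, d i ≤ D) {P : ℝ} (hP0 : 0 ≤ P) (hP : ∀ z ∈ closure Ω, ∑ i, e i * c₀ z i ≤ P)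
    {ε : ℝ} (hε : 0 < ε) (hεd : ∀ i, ε ≤ e i * d i)
    {T₀ : ℝ} (hT₀ : (T₀ : EReal) ≤ Tmax) {z : Euc n} (hz : z ∈ closure Ω) :
    eLpNorm (fun t => c t z) 1 (volume.restrict (Set.Ico 0 T₀)) ≤
      ENNReal.ofReal (D * P * T₀ / ε) := by
  rw [eLpNorm_one_eq_lintegral_enorm]
  refine lintegral_Ico_le fun T hT => ?_
  rcases lt_or_ge T 0 with hneg | hpos
  · simp [Set.Ioc_eq_empty_of_le hneg.le]
  have hTm : T ∈ timeInterval Tmax := ⟨hpos, (EReal.coe_lt_coe_iff.2 hT).trans_le hT₀⟩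
  have hpair := h.isDiffusionPair hΩ he_bulk he_surf hTm
  have hc := continuousOn_slice_time (g := fun t z => ∑ i, e i * d i * c t z i) hpair.cont_q hz
  calc ∫⁻ t in Set.Ioc 0 T, ‖c t z‖ₑ
      ≤ ∫⁻ t in Set.Ioc 0 T, ENNReal.ofReal ((∑ i, e i * d i * c t z i) / ε) :=
        setLIntegral_mono' measurableSet_Ioc fun t ht => enorm_le_ofReal_of_norm_le
          (h.norm_le_div hε hεd (Icc_subset_timeInterval hTm le_rfl ⟨ht.1.le, ht.2⟩) hz)
    _ = ENNReal.ofReal ((∫ t in (0 : ℝ)..T, ∑ i, e i * d i * c t z i) / ε) := by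
        rw [intervalIntegral.integral_of_le hpos, ← integral_div,
          ofReal_integral_eq_lintegral_ofReal]
        · exact ((hc.integrableOn_compact isCompact_Icc).mono_set
            Set.Ioc_subset_Icc_self).div_const ε
        · refine (ae_restrict_iff' measurableSet_Ioc).2 (Filter.Eventually.of_forall fun t ht => ?_)
          exact div_nonneg (Finset.sum_nonneg fun i _ => mul_nonneg (hε.le.trans (hεd i))
            (h.nonneg t (Icc_subset_timeInterval hTm le_rfl ⟨ht.1.le, ht.2⟩) z hz i)) hε.le
    _ ≤ _ := by
        refine ENNReal.ofReal_le_ofReal (div_le_div_of_nonneg_right ?_ hε.le)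
        exact (h.primitive_le hΩ he_bulk he_surf he hD0 hD hP hTm hz).trans
          (mul_le_mul_of_nonneg_left hT.le (mul_nonneg hD0 hP0))

theorem norm_sq_le_div (h : IsClassicalSolution Ω d bulk surf eb c₀ Tmax c) {ε : ℝ} (hε : 0 < ε)
    {v w : Fin N → ℝ} (hv : ∀ i, ε ≤ v i) (hw : ∀ i, ε ≤ w i) {t : ℝ}
    (ht : t ∈ timeInterval Tmax) {z : Euc n} (hz : z ∈ closure Ω) :
    ‖c t z‖ ^ 2 ≤ (∑ i, v i * c t z i) * (∑ i, w i * c t z i) / ε ^ 2 := by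
  have h1 := h.norm_le_div hε hv ht hz
  have h2 := h.norm_le_div hε hw ht hz
  calc ‖c t z‖ ^ 2 = ‖c t z‖ * ‖c t z‖ := sq _
    _ ≤ _ := mul_le_mul h1 h2 (norm_nonneg _) ((norm_nonneg _).trans h1)
    _ = _ := by rw [div_mul_div_comm, sq]

/-- The product `p q` dominates `ε² ‖c‖²`. Its space-time integral is at most `B |Ω|` with `B = (D P
T₀) P`, the first factor bounding `w(T)` and the second `p(0)`. -/
theorem eLpNorm_two_le (h : IsClassicalSolution Ω d bulk surf eb c₀ Tmax c)
    (hΩ : IsBoundedC2Domain Ω) (he_bulk : e ∈ bulk.conservationSpace)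
    (he_surf : e ∈ surf.conservationSpace) (he : ∀ i, 0 < e i) {D : ℝ} (hD0 : 0 ≤ D)
    (hD : ∀ i, d i ≤ D) {P : ℝ} (hP0 : 0 ≤ P) (hP : ∀ z ∈ closure Ω, ∑ i, e i * c₀ z i ≤ P)
    {ε : ℝ} (hε : 0 < ε) (hεe : ∀ i, ε ≤ e i) (hεd : ∀ i, ε ≤ e i * d i)
    {T₀ : ℝ} (hT₀ : 0 < T₀) (hTm : (T₀ : EReal) ≤ Tmax) :
    eLpNorm (fun p : ℝ × Euc n => c p.1 p.2) 2
      ((volume.restrict (Set.Ico 0 T₀)).prod (volume.restrict Ω)) ≤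
      ENNReal.ofReal (√(D * P * T₀ * P * volume.real Ω / ε ^ 2)) := by
  have hb := hΩ.isBounded
  have ho := hΩ.isOpen
  set S := D * P * T₀ * P * volume.real Ω / ε ^ 2 with hS
  have hS0 : 0 ≤ S := by positivity
  have hmem : ∀ T, 0 ≤ T → T < T₀ → T ∈ timeInterval Tmax := fun T h0 hT =>
    ⟨h0, (EReal.coe_lt_coe_iff.2 hT).trans_le hTm⟩
  have hmeas : AEMeasurable (fun p : ℝ × Euc n => ‖c p.1 p.2‖ₑ ^ (2 : ℝ))
      ((volume.restrict (Set.Ico 0 T₀)).prod (volume.restrict Ω)) := by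
    rw [← volume_restrict_prod]
    have : ContinuousOn (fun p : ℝ × Euc n => c p.1 p.2) (Set.Ico 0 T₀ ×ˢ Ω) :=
      h.continuousOn.mono (Set.prod_mono (fun t ht => hmem t ht.1 ht.2) subset_closure)
    exact (this.aestronglyMeasurable (measurableSet_Ico.prod ho.measurableSet)).enorm.pow_const _
  have key : ∫⁻ p, ‖c p.1 p.2‖ₑ ^ (2 : ℝ)
      ∂((volume.restrict (Set.Ico 0 T₀)).prod (volume.restrict Ω)) ≤ ENNReal.ofReal S := by
    rw [lintegral_prod _ hmeas]
    refine lintegral_Ico_le fun T hT => ?_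
    rcases lt_or_ge T 0 with hneg | hpos
    · simp [Set.Ioc_eq_empty_of_le hneg.le]
    have hTm' := hmem T hpos hT
    have hpair := h.isDiffusionPair hΩ he_bulk he_surf hTm'
    have hIoc : ∀ t ∈ Set.Ioc 0 T, t ∈ timeInterval Tmax := fun t ht =>
      Icc_subset_timeInterval hTm' le_rfl ⟨ht.1.le, ht.2⟩
    have hpq : IntegrableOn (fun p : ℝ × Euc n => (∑ i, e i * c p.1 p.2 i) *
        (∑ i, e i * d i * c p.1 p.2 i) / ε ^ 2) (Set.Ioc 0 T ×ˢ Ω) := integrableOn_cylinder hb ((hpair.cont_p.mul hpair.cont_q).div_const (ε ^ 2))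
    have hnn : ∀ t ∈ Set.Ioc 0 T, ∀ z ∈ Ω,
        0 ≤ (∑ i, e i * c t z i) * (∑ i, e i * d i * c t z i) / ε ^ 2 := fun t ht z hz =>
      (sq_nonneg ‖c t z‖).trans (h.norm_sq_le_div hε hεe hεd (hIoc t ht) (subset_closure hz))
    calc ∫⁻ t in Set.Ioc 0 T, ∫⁻ z in Ω, ‖c t z‖ₑ ^ (2 : ℝ)
        ≤ ∫⁻ t in Set.Ioc 0 T, ∫⁻ z in Ω, ENNReal.ofReal
            ((∑ i, e i * c t z i) * (∑ i, e i * d i * c t z i) / ε ^ 2) := by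
          refine setLIntegral_mono' measurableSet_Ioc fun t ht =>
            setLIntegral_mono' ho.measurableSet fun z hz => ?_
          rw [← ofReal_norm, ENNReal.ofReal_rpow_of_nonneg (norm_nonneg _) zero_le_two]
          refine ENNReal.ofReal_le_ofReal ?_
          rw [Real.rpow_two]
          exact h.norm_sq_le_div hε hεe hεd (hIoc t ht) (subset_closure hz)
      _ = ENNReal.ofReal (∫ t in (0 : ℝ)..T, ∫ z in Ω,
            (∑ i, e i * c t z i) * (∑ i, e i * d i * c t z i) / ε ^ 2) := by
          rw [← setIntegral_cylinder (g := fun t z => (∑ i, e i * c t z i) *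
            (∑ i, e i * d i * c t z i) / ε ^ 2) hpos hpq, ofReal_integral_eq_lintegral_ofReal hpq
            ((ae_restrict_iff' (measurableSet_Ioc.prod ho.measurableSet)).2
              (Filter.Eventually.of_forall fun p hp => hnn _ hp.1 _ hp.2)), volume_restrict_prod,
            lintegral_prod]
          rw [← volume_restrict_prod]
          exact hpq.aestronglyMeasurable.aemeasurable.ennreal_ofReal
      _ ≤ ENNReal.ofReal S := by
          refine ENNReal.ofReal_le_ofReal ?_
          simp only [integral_div, intervalIntegral.integral_div]
          refine div_le_div_of_nonneg_right ?_ (sq_nonneg ε)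
          refine hpair.intervalIntegral_mul_le hΩ fun z hz => ?_
          have hz' := subset_closure hz
          have h1 := h.primitive_le hΩ he_bulk he_surf he hD0 hD hP hTm' hz'
          have h2 := hP z hz'
          have h3 : 0 ≤ ∑ i, e i * c 0 z i := Finset.sum_nonneg fun i _ =>
            mul_nonneg (he i).le (h.nonneg 0 (hmem 0 le_rfl hT₀) z hz' i)
          simp only [h.initial_eq z hz'] at h3 ⊢
          refine mul_le_mul (h1.trans ?_) h2 h3 (by positivity)
          exact mul_le_mul_of_nonneg_left hT.le (mul_nonneg hD0 hP0)
  have hsq := eLpNorm_nnreal_pow_eq_lintegral (p := 2) (μ := (volume.restrict (Set.Ico 0 T₀)).prod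
    (volume.restrict Ω)) (f := fun p : ℝ × Euc n => c p.1 p.2) two_ne_zero
  have hle := hsq.trans_le key
  rw [← Real.sq_sqrt hS0, ENNReal.ofReal_pow (Real.sqrt_nonneg _)] at hle
  have h2 : ((2 : NNReal) : ℝ) = ((2 : ℕ) : ℝ) := by norm_num
  rw [h2, ENNReal.rpow_natCast] at hle
  exact (ENNReal.pow_le_pow_left_iff two_ne_zero).1 hle

end IsClassicalSolution

end

section

variable {n N m mS nS : ℕ} {Ω : Set (Euc n)}

/-! ### Strict positivity -/

/-- If the second derivative were negative, the point would also be a local maximum, hence the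
function locally constant, with second derivative zero. -/
theorem deriv_deriv_nonneg_of_isLocalMin {f : ℝ → ℝ} {x : ℝ} (h : IsLocalMin f x)
    (hc : ContinuousAt f x) : 0 ≤ deriv (deriv f) x := by
  by_contra! hlt
  have hmax := isLocalMax_of_deriv_deriv_neg hlt h.deriv_eq_zero hc
  have heq : f =ᶠ[nhds x] fun _ => f x := by
    filter_upwards [h, hmax] with y h1 h2 using le_antisymm h2 h1
  have hd : deriv f =ᶠ[nhds x] fun _ => 0 := by
    refine heq.deriv.trans ?_
    simp only [deriv_const']
    exact Filter.EventuallyEq.rfl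
  rw [hd.deriv_eq] at hlt
  simp at hlt

theorem laplacian_eq_covectorDiv (f : Euc n → ℝ) (z : Euc n) :
    Laplacian.laplacian f z = covectorDiv (fderiv ℝ f) z := by
  rw [InnerProductSpace.laplacian_eq_iteratedFDeriv_orthonormalBasis f
    (EuclideanSpace.basisFun (Fin n) ℝ)]
  refine Finset.sum_congr rfl fun j _ => ?_
  rw [iteratedFDeriv_two_apply]
  simp

theorem laplacian_nonneg_of_isLocalMin {f : Euc n → ℝ} {z : Euc n} (h : IsLocalMin f z)
    (hf : ContDiffAt ℝ 2 f z) : 0 ≤ Laplacian.laplacian f z := by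
  rw [laplacian_eq_covectorDiv]
  refine Finset.sum_nonneg fun j _ => ?_
  set w : Euc n := stdVec j
  have hl : ∀ τ : ℝ, HasDerivAt (fun τ : ℝ => z + τ • w) w τ := fun τ => by
    simpa using ((hasDerivAt_id τ).smul_const w).const_add z
  have hz : z + (0 : ℝ) • w = z := by simp
  have htend : Filter.Tendsto (fun τ : ℝ => z + τ • w) (nhds 0) (nhds z) := by
    simpa [hz] using (hl 0).continuousAt.tendsto
  have h1 : deriv (fun τ : ℝ => f (z + τ • w)) =ᶠ[nhds 0] fun τ => fderiv ℝ f (z + τ • w) w := by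
    filter_upwards [htend.eventually (hf.eventually (by simp))] with τ hτ
    exact ((hτ.differentiableAt (by norm_num)).hasFDerivAt.comp_hasDerivAt τ (hl τ)).deriv
  have h2 : HasDerivAt (fun τ : ℝ => fderiv ℝ f (z + τ • w) w) (fderiv ℝ (fderiv ℝ f) z w w) 0 := by
    have hd : DifferentiableAt ℝ (fderiv ℝ f) (z + (0 : ℝ) • w) := by
      rw [hz]
      exact (hf.fderiv_right (m := 1) (by norm_num)).differentiableAt (by norm_num)
    have := (ContinuousLinearMap.apply ℝ ℝ w).hasFDerivAt.comp_hasDerivAt (0 : ℝ)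
      (hd.hasFDerivAt.comp_hasDerivAt (0 : ℝ) (hl 0))
    rw [hz] at this
    exact this
  have hmin : IsLocalMin (fun τ : ℝ => f (z + τ • w)) 0 := by
    filter_upwards [htend.eventually h] with τ hτ
    simpa [hz] using hτ
  have hcont : ContinuousAt (fun τ : ℝ => f (z + τ • w)) 0 :=
    ContinuousAt.comp (f := fun τ : ℝ => z + τ • w) (by rw [hz]; exact hf.continuousAt)
      (hl 0).continuousAt
  have := deriv_deriv_nonneg_of_isLocalMin hmin hcont
  rwa [h1.deriv_eq, h2.deriv] at this

/-- The exponential of a coordinate is an eigenfunction of the Laplacian. -/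
theorem laplacian_exp_coord (j : Fin n) (l b : ℝ) (z : Euc n) :
    Laplacian.laplacian (fun z : Euc n => Real.exp (l * (z j + b))) z =
      l ^ 2 * Real.exp (l * (z j + b)) := by
  have hfd : ∀ z : Euc n, HasFDerivAt (fun z : Euc n => Real.exp (l * (z j + b)))
      ((l * Real.exp (l * (z j + b))) • EuclideanSpace.proj (𝕜 := ℝ) j) z := fun z => by
    have h1 : HasFDerivAt (fun z : Euc n => l * (z j + b))
        (l • EuclideanSpace.proj (𝕜 := ℝ) j) z :=
      ((EuclideanSpace.proj (𝕜 := ℝ) j).hasFDerivAt.add_const b).const_mul l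
    refine h1.exp.congr_fderiv ?_
    rw [smul_smul, mul_comm]
  have hfun : fderiv ℝ (fun z : Euc n => Real.exp (l * (z j + b))) =
      fun z => (l * Real.exp (l * (z j + b))) • EuclideanSpace.proj (𝕜 := ℝ) j :=
    funext fun z => (hfd z).fderiv
  have hd := (hfd z).const_mul l
  rw [laplacian_eq_covectorDiv, hfun, covectorDiv_smul hd.differentiableAt
    (differentiableAt_const _), hd.fderiv]
  have h0 : covectorDiv (fun _ : Euc n => (EuclideanSpace.proj (𝕜 := ℝ) j : Euc n →L[ℝ] ℝ)) z = 0 := by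
    simp [covectorDiv]
  rw [h0, mul_zero, zero_add, Finset.sum_eq_single j]
  · simp; ring
  · intro k _ hk
    simp [hk.symm]
  · simp

/-- The minimum in the barrier argument may occur at the final time, so only comparison with earlier
times is available. -/
theorem deriv_nonpos_of_le_left {f : ℝ → ℝ} {f' x a : ℝ} (hf : HasDerivAt f f' x) (ha : a < x)
    (h : ∀ t ∈ Set.Ioo a x, f x ≤ f t) : f' ≤ 0 := by
  have h1 := (hasDerivWithinAt_iff_tendsto_slope' (s := Set.Iio x) (by simp)).1
    (hf.hasDerivWithinAt (s := Set.Iio x))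
  refine le_of_tendsto h1 ?_
  filter_upwards [Ioo_mem_nhdsLT ha] with t ht
  rw [slope_def_field]
  exact div_nonpos_of_nonneg_of_nonpos (by linarith [h t ht]) (by linarith [ht.2])

/-- A nonnegative supersolution of `∂_t u - d Δu + M u = 0` which is positive on the lateral
boundary is positive. -/
theorem IsC12.pos_of_supersolution (hn : 0 < n) (hΩ : IsOpen Ω) (hb : Bornology.IsBounded Ω)
    {T : EReal} {u : ℝ → Euc n → ℝ} (hu : IsC12 Ω T u) {d M : ℝ} (hd : 0 < d) (hM : 0 ≤ M)
    {s t₁ : ℝ} (hs : 0 ≤ s) (hst : s < t₁) (ht₁ : t₁ ∈ timeInterval T)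
    (hnn : ∀ z ∈ closure Ω, 0 ≤ u s z)
    (hineq : ∀ t ∈ Set.Icc s t₁, ∀ z ∈ Ω, -(M * u t z) ≤
      derivWithin (fun t => u t z) (timeInterval T) t - d * Laplacian.laplacian (u t) z)
    (hbd : ∀ t ∈ Set.Icc s t₁, ∀ z ∈ frontier Ω, 0 < u t z) : ∀ z ∈ Ω, 0 < u t₁ z := by
  have hIcc : Set.Icc s t₁ ⊆ timeInterval T := Icc_subset_timeInterval ht₁ hs
  have hcu : ContinuousOn (fun x : ℝ × Euc n => u x.1 x.2) (Set.Icc s t₁ ×ˢ closure Ω) :=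
    hu.continuousOn.mono (Set.prod_mono hIcc subset_rfl)
  have hfr : IsCompact (frontier Ω) :=
    hb.isCompact_closure.of_isClosed_subset isClosed_frontier frontier_subset_closure
  obtain ⟨δ₀, hδ₀, hδu⟩ := (isCompact_Icc.prod hfr).exists_forall_le'
    (hcu.mono (Set.prod_mono subset_rfl frontier_subset_closure)) (a := 0)
    fun x hx => hbd x.1 hx.1 x.2 hx.2
  set j₀ : Fin n := ⟨0, hn⟩
  obtain ⟨R, hR0, hR⟩ := exists_norm_bound_of_continuousOn_closure hb
    (F := fun z : Euc n => z j₀) (by fun_prop)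
  have hτ : 0 < t₁ - s := sub_pos.2 hst
  -- The speed `K` makes the exponent of the barrier `E` below nonpositive at time `s` and at least
  -- `l > 0` at time `t₁`, as `z j₀` lies in `[-R, R]`.
  set K := (2 * R + 1) / (t₁ - s) with hK
  have hKpos : 0 < K := by positivity
  -- Then `d l² = l (K + M + d)` exceeds `K l + M`: diffusion of the exponential beats its time
  -- derivative and the damping.
  set l := (K + M) / d + 1 with hl
  have hl1 : 1 ≤ l := by rw [hl]; linarith [div_nonneg (add_nonneg hKpos.le hM) hd.le]
  have hlpos : 0 < l := by linarith
  have hstrict : K * l + M < d * l ^ 2 := by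
    have : d * l = K + M + d := by rw [hl]; field_simp
    nlinarith [mul_le_mul_of_nonneg_right hl1 hM, mul_pos hlpos hd]
  set E : ℝ → Euc n → ℝ := fun t z => Real.exp (l * (z j₀ + (K * (t - s) - R))) with hE
  set A := Real.exp (l * (K * (t₁ - s))) with hA
  have hApos : 0 < A := Real.exp_pos _
  -- On the closed cylinder `E ≤ A`, so on the lateral boundary the barrier `δ (E - 1)` stays below
  -- the positive minimum of `u`.
  set δ := δ₀ / A with hδ
  have hδpos : 0 < δ := div_pos hδ₀ hApos
  set v : ℝ → Euc n → ℝ := fun t z => u t z - δ * (E t z - 1) with hv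
  have hcv : ContinuousOn (fun x : ℝ × Euc n => v x.1 x.2) (Set.Icc s t₁ ×ˢ closure Ω) := by
    refine hcu.sub (Continuous.continuousOn ?_)
    simp only [hE]
    fun_prop
  have hvnonneg : ∀ t ∈ Set.Icc s t₁, ∀ z ∈ closure Ω, 0 ≤ v t z := by
    intro t ht z hz
    obtain ⟨⟨t', z'⟩, ⟨ht', hz'⟩, hmin⟩ := (isCompact_Icc.prod hb.isCompact_closure).exists_isMinOn
      ⟨(t, z), ht, hz⟩ hcv
    have hmin' : ∀ t ∈ Set.Icc s t₁, ∀ z ∈ closure Ω, v t' z' ≤ v t z := fun t ht z hz =>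
      hmin (Set.mk_mem_prod ht hz)
    refine le_trans ?_ (hmin' t ht z hz)
    by_contra! hneg
    have hRz := abs_le.1 (hR z' hz')
    -- the minimum is not attained at the initial time
    have hts : s < t' := by
      refine lt_of_le_of_ne ht'.1 fun h => ?_
      subst h
      have hE1 : E s z' ≤ 1 := Real.exp_le_one_iff.2
        (mul_nonpos_of_nonneg_of_nonpos hlpos.le (by linarith))
      have : δ * (E s z' - 1) ≤ 0 := mul_nonpos_of_nonneg_of_nonpos hδpos.le (by linarith)
      simp only [hv] at hneg
      linarith [hnn z' hz']
    -- the minimum is not attained on the boundary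
    have hzΩ : z' ∈ Ω := by
      by_contra hnot
      have hzf : z' ∈ frontier Ω := ⟨hz', fun h => hnot (interior_subset h)⟩
      have h1 := hδu (t', z') ⟨ht', hzf⟩
      have h2 : E t' z' ≤ A := by
        refine Real.exp_le_exp.2 (mul_le_mul_of_nonneg_left ?_ hlpos.le)
        have : K * (t' - s) ≤ K * (t₁ - s) :=
          mul_le_mul_of_nonneg_left (by linarith [ht'.2]) hKpos.le
        linarith
      have h3 : δ * (E t' z' - 1) ≤ δ * A := mul_le_mul_of_nonneg_left (by linarith) hδpos.le
      have h4 : δ * A = δ₀ := div_mul_cancel₀ _ hApos.ne'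
      simp only [hv] at hneg
      linarith
    have ht0 : 0 < t' := hs.trans_lt hts
    have htm := hIcc ht'
    -- first order condition in time
    have htime : derivWithin (fun t => u t z') (timeInterval T) t' - δ * (l * K * E t' z') ≤ 0 := by
      have h1 : HasDerivAt (fun t => E t z') (l * K * E t' z') t' := by
        have h0 : HasDerivAt (fun t : ℝ => l * (z' j₀ + (K * (t - s) - R))) (l * (K * 1)) t' :=
          (((((hasDerivAt_id t').sub_const s).const_mul K).sub_const R).const_add (z' j₀)).const_mul l
        refine h0.exp.congr_deriv ?_
        simp only [hE]; ring
      exact deriv_nonpos_of_le_left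
        ((hu.hasDerivAt htm ht0 hz').sub ((h1.sub_const 1).const_mul δ)) hts
        fun t ht => hmin' t ⟨ht.1.le, ht.2.le.trans ht'.2⟩ z' hz'
    -- second order condition in space
    have hspace : 0 ≤ Laplacian.laplacian (u t') z' - δ * (l ^ 2 * E t' z') := by
      have hcE : ContDiffAt ℝ 2 (fun z => E t' z) z' := by
        have h0 : ContDiff ℝ 2 (fun z : Euc n => z j₀) := (EuclideanSpace.proj (𝕜 := ℝ) j₀).contDiff
        exact ((contDiff_const.mul (h0.add contDiff_const)).exp).contDiffAt
      have hloc : IsLocalMin (u t' - δ • fun z => E t' z) z' := by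
        filter_upwards [hΩ.mem_nhds hzΩ] with y hy
        have := hmin' t' ht' y (subset_closure hy)
        simp only [hv] at this
        simp only [Pi.sub_apply, Pi.smul_apply, smul_eq_mul]
        linarith
      have hcu' : ContDiffAt ℝ 2 (u t') z' := hu.contDiffAt hΩ htm hzΩ
      have hcE' : ContDiffAt ℝ 2 (δ • fun z => E t' z) z' := contDiffAt_const.smul hcE
      have h1 := laplacian_nonneg_of_isLocalMin hloc (hcu'.sub hcE')
      rw [hcu'.laplacian_sub hcE',
        InnerProductSpace.laplacian_smul δ hcE, smul_eq_mul] at h1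
      rwa [laplacian_exp_coord] at h1
    -- At an interior negative minimum, `0 ≤ ∂_t u - d Δu + M u ≤ δ E (K l + M - d l²) - M δ < 0`, a
    -- contradiction.
    have h1 := hineq t' ht' z' hzΩ
    have hEpos : 0 < E t' z' := Real.exp_pos _
    have h2 : M * u t' z' ≤ M * (δ * (E t' z' - 1)) :=
      mul_le_mul_of_nonneg_left (by simp only [hv] at hneg; linarith) hM
    have h3 : d * (δ * (l ^ 2 * E t' z')) ≤ d * Laplacian.laplacian (u t') z' :=
      mul_le_mul_of_nonneg_left (by linarith) hd.le
    have h4 : δ * E t' z' * (K * l + M) < δ * E t' z' * (d * l ^ 2) :=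
      mul_lt_mul_of_pos_left hstrict (mul_pos hδpos hEpos)
    have h5 : 0 ≤ M * δ := mul_nonneg hM hδpos.le
    nlinarith
  intro z hz
  have hRz := abs_le.1 (hR z (subset_closure hz))
  have h1 := hvnonneg t₁ ⟨hst.le, le_rfl⟩ z (subset_closure hz)
  have h2 : 1 < E t₁ z := by
    refine Real.one_lt_exp_iff.2 (mul_pos hlpos ?_)
    have : K * (t₁ - s) = 2 * R + 1 := div_mul_cancel₀ _ hτ.ne'
    linarith
  have h3 : 0 < δ * (E t₁ z - 1) := mul_pos hδpos (by linarith)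
  simp only [hv] at h1
  linarith

/-- One factor `c i` is split off and all the others are bounded by `B`; thus a reaction consuming a
species is at most linear in its concentration. -/
theorem prod_pow_le_mul {c : Fin N → ℝ} {B : ℝ} (hB : 1 ≤ B) (hc0 : ∀ j, 0 ≤ c j)
    (hcB : ∀ j, c j ≤ B) (k : Fin N → ℕ) {i : Fin N} (hi : k i ≠ 0) :
    ∏ j, c j ^ k j ≤ B ^ (∑ j, k j) * c i := by
  have hB0 : 0 ≤ B := by linarith
  rw [← Finset.prod_pow_eq_pow_sum, ← Finset.mul_prod_erase _ _ (Finset.mem_univ i),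
    ← Finset.mul_prod_erase (a := i) (f := fun j => B ^ k j) _ (Finset.mem_univ i), mul_right_comm]
  refine mul_le_mul ?_ (Finset.prod_le_prod (fun j _ => pow_nonneg (hc0 j) _)
    fun j _ => pow_le_pow_left₀ (hc0 j) (hcB j) _) (Finset.prod_nonneg fun j _ =>
      pow_nonneg (hc0 j) _) (mul_nonneg (pow_nonneg hB0 _) (hc0 i))
  obtain ⟨k', hk'⟩ := Nat.exists_eq_succ_of_ne_zero hi
  rw [hk', pow_succ]
  refine mul_le_mul_of_nonneg_right ?_ (hc0 i)
  exact (pow_le_pow_left₀ (hc0 i) (hcB i) _).trans (pow_le_pow_right₀ hB (Nat.le_succ _))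

namespace ReactionNetwork

variable (R : ReactionNetwork N m)

theorem forward_nonneg (a : Fin m) {c : Fin N → ℝ} (hc : ∀ i, 0 ≤ c i) : 0 ≤ R.forward a c :=
  mul_nonneg (R.kf_pos a).le (Finset.prod_nonneg fun i _ => pow_nonneg (hc i) _)

theorem backward_nonneg (a : Fin m) {c : Fin N → ℝ} (hc : ∀ i, 0 ≤ c i) : 0 ≤ R.backward a c :=
  mul_nonneg (R.kb_pos a).le (Finset.prod_nonneg fun i _ => pow_nonneg (hc i) _)

/-- Mass action rates are quasi-positive. -/
theorem exists_neg_mul_le_rate (B : ℝ) (i : Fin N) :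
    ∃ M, 0 ≤ M ∧ ∀ c : Fin N → ℝ, (∀ j, 0 ≤ c j) → (∀ j, c j ≤ B) → -(M * c i) ≤ R.rate c i := by
  set B' := max B 1
  have hB' : 1 ≤ B' := le_max_right _ _
  have hB0 : 0 ≤ B' := by linarith
  refine ⟨∑ a, |R.ν a i| * (R.kf a * B' ^ (∑ j, R.α a j) + R.kb a * B' ^ (∑ j, R.β a j)),
    Finset.sum_nonneg fun a _ => mul_nonneg (abs_nonneg _) (add_nonneg
      (mul_nonneg (R.kf_pos a).le (pow_nonneg hB0 _))
      (mul_nonneg (R.kb_pos a).le (pow_nonneg hB0 _))), fun c hc hcB => ?_⟩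
  have hcB' : ∀ j, c j ≤ B' := fun j => (hcB j).trans (le_max_left _ _)
  rw [Finset.sum_mul, ← Finset.sum_neg_distrib]
  refine Finset.sum_le_sum fun a _ => ?_
  have hf := R.forward_nonneg a hc
  have hbk := R.backward_nonneg a hc
  have hF0 : 0 ≤ R.kf a * B' ^ (∑ j, R.α a j) * c i :=
    mul_nonneg (mul_nonneg (R.kf_pos a).le (pow_nonneg hB0 _)) (hc i)
  have hG0 : 0 ≤ R.kb a * B' ^ (∑ j, R.β a j) * c i :=
    mul_nonneg (mul_nonneg (R.kb_pos a).le (pow_nonneg hB0 _)) (hc i)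
  -- A negative `ν` forces `α ≠ 0`, so the forward rate contains the factor `c i`, while the
  -- backward rate enters with a favourable sign. A positive `ν` exchanges the two roles.
  rcases lt_trichotomy (R.ν a i) 0 with hν | hν | hν
  · have hα : R.α a i ≠ 0 := fun h0 => by
      have : 0 ≤ R.ν a i := by simp [ν, h0]
      linarith
    have h1 : R.forward a c ≤ R.kf a * B' ^ (∑ j, R.α a j) * c i := by
      rw [forward, mul_assoc]
      exact mul_le_mul_of_nonneg_left (prod_pow_le_mul hB' hc hcB' _ hα) (R.kf_pos a).le
    rw [abs_of_neg hν]
    have := mul_le_mul_of_nonneg_left (show R.forward a c - R.backward a c ≤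
      (R.kf a * B' ^ (∑ j, R.α a j) + R.kb a * B' ^ (∑ j, R.β a j)) * c i by
        rw [add_mul]; linarith) (neg_nonneg.2 hν.le)
    linarith
  · simp [hν]
  · have hβ : R.β a i ≠ 0 := fun h0 => by
      have : R.ν a i ≤ 0 := by simp [ν, h0]
      linarith
    have h1 : R.backward a c ≤ R.kb a * B' ^ (∑ j, R.β a j) * c i := by
      rw [backward, mul_assoc]
      exact mul_le_mul_of_nonneg_left (prod_pow_le_mul hB' hc hcB' _ hβ) (R.kb_pos a).le
    rw [abs_of_pos hν]
    have := mul_le_mul_of_nonneg_left (show R.backward a c - R.forward a c ≤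
      (R.kf a * B' ^ (∑ j, R.α a j) + R.kb a * B' ^ (∑ j, R.β a j)) * c i by
        rw [add_mul]; linarith) hν.le
    linarith

end ReactionNetwork

/-- Solutions with positive boundary values are positive. -/
theorem IsClassicalSolution.pos {d : Fin N → ℝ} {bulk : ReactionNetwork N m}
    {surf : ReactionNetwork N mS} {eb : Module.Basis (Fin nS) ℝ surf.conservationSpace}
    {c₀ : Euc n → EuclideanSpace ℝ (Fin N)} {Tmax : EReal}
    {c : ℝ → Euc n → EuclideanSpace ℝ (Fin N)}
    (h : IsClassicalSolution Ω d bulk surf eb c₀ Tmax c) (hn : 0 < n) (hΩ : IsBoundedC2Domain Ω)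
    (hd : ∀ i, 0 < d i)
    (hbd : ∀ t ∈ timeInterval Tmax, 0 < t → ∀ z ∈ frontier Ω, ∀ i, 0 < c t z i)
    {t : ℝ} (ht : t ∈ timeInterval Tmax) (h0 : 0 < t) {z : Euc n} (hz : z ∈ closure Ω)
    (i : Fin N) : 0 < c t z i := by
  by_cases hzΩ : z ∈ Ω
  swap
  · exact hbd t ht h0 z ⟨hz, fun H => hzΩ (interior_subset H)⟩ i
  -- Boundary positivity is only known for positive times, so the barrier starts at `t / 2`, where
  -- nonnegativity of the solution is enough as initial condition.
  have hIcc : Set.Icc (t / 2) t ⊆ timeInterval Tmax := Icc_subset_timeInterval ht (by positivity)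
  obtain ⟨B, hB⟩ := (isCompact_Icc.prod hΩ.isBounded.isCompact_closure).exists_bound_of_continuousOn
    (h.continuousOn.mono (Set.prod_mono hIcc subset_rfl))
  obtain ⟨M, hM0, hM⟩ := bulk.exists_neg_mul_le_rate B i
  refine (h.regular i).pos_of_supersolution hn hΩ.isOpen hΩ.isBounded (hd i) hM0
    (by positivity : 0 ≤ t / 2) (by linarith) ht
    (fun z hz => h.nonneg _ (hIcc ⟨le_rfl, by linarith⟩) z hz i) (fun s hs y hy => ?_)
    (fun s hs y hy => hbd s (hIcc hs) (by linarith [hs.1]) y hy i) z hzΩ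
  rw [h.bulk_eq s (hIcc hs) y hy i]
  have hy' := subset_closure hy
  exact hM _ (fun j => h.nonneg s (hIcc hs) y hy' j) fun j =>
    (le_abs_self _).trans ((PiLp.norm_apply_le (c s y) j).trans (hB (s, y) ⟨hs, hy'⟩))

end

section

variable {n N m mS nS : ℕ} {Ω : Set (Euc n)}

/-! ### The entropy identity -/

theorem norm_gradient_sq (f : Euc n → ℝ) (z : Euc n) :
    ‖gradient f z‖ ^ 2 = ∑ j, fderiv ℝ f z (stdVec j) * fderiv ℝ f z (stdVec j) := by
  rw [← inner_covector_gradient, ← real_inner_self_eq_norm_sq,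
    ← InnerProductSpace.toDual_apply_apply (𝕜 := ℝ)]
  simp [gradient]

namespace ReactionNetwork

variable (R : ReactionNetwork N m)

theorem forward_pos (a : Fin m) {c : Fin N → ℝ} (hc : ∀ i, 0 < c i) : 0 < R.forward a c :=
  mul_pos (R.kf_pos a) (Finset.prod_pos fun i _ => pow_pos (hc i) _)

/-- For positive concentrations `c^β = c^α exp (∑ νᵢ ln cᵢ)`, and the logarithmic closure supplies
the factor `exp (∑ νᵢ μᵢ⁰)`. -/
theorem backward_eq_forward_mul_exp {μ₀ : Fin N → ℝ} (h : R.LogarithmicClosure μ₀) (a : Fin m)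
    {c : Fin N → ℝ} (hc : ∀ i, 0 < c i) :
    R.backward a c = R.forward a c * Real.exp (R.affinity μ₀ a c) := by
  have hk : R.kb a = R.kf a * Real.exp (∑ i, μ₀ i * R.ν a i) := by
    rw [← h a, mul_div_cancel₀ _ (R.kf_pos a).ne']
  have hpow : ∀ i, c i ^ R.β a i = c i ^ R.α a i * Real.exp (Real.log (c i) * R.ν a i) := fun i => by
    have hx : ∀ k : ℕ, c i ^ k = Real.exp (k * Real.log (c i)) := fun k => by
      rw [Real.exp_nat_mul, Real.exp_log (hc i)]
    rw [hx, hx, ← Real.exp_add, ν]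
    congr 1
    ring
  have haff : R.affinity μ₀ a c = (∑ i, μ₀ i * R.ν a i) + ∑ i, Real.log (c i) * R.ν a i := by
    rw [affinity, ← Finset.sum_add_distrib]
    exact Finset.sum_congr rfl fun i _ => add_mul _ _ _
  rw [backward, forward, hk, haff, Real.exp_add, Real.exp_sum (f := fun i => Real.log (c i) * R.ν a i),
    Finset.prod_congr rfl fun i _ => hpow i, Finset.prod_mul_distrib]
  ring

/-- Linear independence upgrades the vanishing of the total rate to detailed balance of each
reaction, so `exp 𝒜ₐ = 1`. On the boundary this makes `μ` orthogonal to all surface stoichiometric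
vectors. -/
theorem affinity_eq_zero_of_rate_eq_zero (hR : LinearIndependent ℝ R.ν) {μ₀ : Fin N → ℝ}
    (h : R.LogarithmicClosure μ₀) {c : Fin N → ℝ} (hc : ∀ i, 0 < c i)
    (hr : ∀ i, R.rate c i = 0) (a : Fin m) : R.affinity μ₀ a c = 0 := by
  have h0 := Fintype.linearIndependent_iff.1 hR (fun a => R.forward a c - R.backward a c) (by
    ext i
    rw [Finset.sum_apply, Pi.zero_apply, ← hr i, rate]
    exact Finset.sum_congr rfl fun a _ => mul_comm _ _) a
  rw [R.backward_eq_forward_mul_exp h a hc, sub_eq_zero, eq_comm,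
    mul_eq_left₀ (R.forward_pos a hc).ne', Real.exp_eq_one_iff] at h0
  exact h0

theorem sum_potential_mul_rate {μ₀ : Fin N → ℝ} (h : R.LogarithmicClosure μ₀)
    {c : Fin N → ℝ} (hc : ∀ i, 0 < c i) :
    ∑ i, (μ₀ i + Real.log (c i)) * R.rate c i = -∑ a, reactionDissipation R μ₀ a c := by
  rw [sum_mul_rate, ← Finset.sum_neg_distrib]
  refine Finset.sum_congr rfl fun a _ => ?_
  rw [R.backward_eq_forward_mul_exp h a hc, reactionDissipation]
  change R.affinity μ₀ a c * _ = _
  ring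

end ReactionNetwork

theorem reactionDissipation_nonneg (R : ReactionNetwork N m) (μ₀ : Fin N → ℝ) (a : Fin m)
    {c : Fin N → ℝ} (hc : ∀ i, 0 ≤ c i) : 0 ≤ reactionDissipation R μ₀ a c := by
  refine mul_nonneg (R.forward_nonneg a hc) ?_
  rcases le_total 0 (R.affinity μ₀ a c) with h | h
  · exact mul_nonneg h (sub_nonneg.2 (Real.one_le_exp h))
  · exact mul_nonneg_of_nonpos_of_nonpos h (sub_nonpos.2 (Real.exp_le_one_iff.2 h))

/-- The diffusive dissipation, with gradients taken within the closed domain. -/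
noncomputable def diffusionDissipationWithin (Ω : Set (Euc n)) (d : Fin N → ℝ)
    (c : Euc n → EuclideanSpace ℝ (Fin N)) (z : Euc n) : ℝ :=
  ∑ i, d i * ((∑ j, fderivWithin ℝ (fun y => c y i) (closure Ω) z (stdVec j) *
    fderivWithin ℝ (fun y => c y i) (closure Ω) z (stdVec j)) / c z i)

/-- The version with derivatives within the closure is continuous up to the boundary wherever `c` is
positive, which is what gives integrability. -/
theorem diffusionDissipation_eq (hΩ : IsOpen Ω) (d : Fin N → ℝ)
    (c : Euc n → EuclideanSpace ℝ (Fin N)) {z : Euc n} (hz : z ∈ Ω) :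
    diffusionDissipation d c z = diffusionDissipationWithin Ω d c z := by
  refine Finset.sum_congr rfl fun i _ => ?_
  rw [norm_gradient_sq, (IsC12.fderivWithin_eventuallyEq hΩ hz).eq_of_nhds]

theorem diffusionDissipation_nonneg {d : Fin N → ℝ} (hd : ∀ i, 0 < d i)
    {c : Euc n → EuclideanSpace ℝ (Fin N)} {z : Euc n} (hc : ∀ i, 0 ≤ c z i) :
    0 ≤ diffusionDissipation d c z :=
  Finset.sum_nonneg fun i _ => mul_nonneg (hd i).le (div_nonneg (sq_nonneg _) (hc i))

theorem continuousOn_setIntegral (hΩ : IsOpen Ω) (hb : Bornology.IsBounded Ω) {a b : ℝ}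
    {g : ℝ → Euc n → ℝ}
    (hg : ContinuousOn (fun p : ℝ × Euc n => g p.1 p.2) (Set.Icc a b ×ˢ closure Ω)) :
    ContinuousOn (fun t => ∫ z in Ω, g t z) (Set.Icc a b) := by
  obtain ⟨C, hC⟩ := (isCompact_Icc.prod hb.isCompact_closure).exists_bound_of_continuousOn hg
  refine continuousOn_of_dominated (bound := fun _ => C) (fun t ht => ?_) (fun t ht => ?_)
    (integrableOn_const hb.measure_lt_top.ne) ?_
  · exact (integrableOn_of_continuousOn_closure hb
      (continuousOn_slice_space hg ht)).aestronglyMeasurable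
  · exact (ae_restrict_iff' hΩ.measurableSet).2 (Filter.Eventually.of_forall fun z hz =>
      hC (t, z) ⟨ht, subset_closure hz⟩)
  · exact (ae_restrict_iff' hΩ.measurableSet).2 (Filter.Eventually.of_forall fun z hz =>
      continuousOn_slice_time hg (subset_closure hz))

/-- A nonnegative function on the cylinder `(0,t] × Ω` whose integrals over `(s,t] × Ω` converge as
`s → 0` is integrable. -/
theorem integrableOn_cylinder_of_tendsto {t : ℝ} (ht : 0 < t) (hΩ : IsOpen Ω)
    {f : ℝ × Euc n → ℝ} {I : ℝ} (hnn : ∀ p ∈ Set.Ioc 0 t ×ˢ Ω, 0 ≤ f p)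
    (hf : ∀ s, 0 < s → s ≤ t → IntegrableOn f (Set.Ioc s t ×ˢ Ω))
    (hlim : Filter.Tendsto (fun s => ∫ p in Set.Ioc s t ×ˢ Ω, f p) (nhdsWithin 0 (Set.Ioi 0))
      (nhds I)) :
    IntegrableOn f (Set.Ioc 0 t ×ˢ Ω) ∧ ∫ p in Set.Ioc 0 t ×ˢ Ω, f p = I := by
  -- Any sequence in `(0, t]` tending to zero would do. The strips `(σ k, t]` exhaust `(0, t]`, and
  -- for a nonnegative integrand convergence of the integrals yields integrability.
  set σ : ℕ → ℝ := fun k => t / (k + 2) with hσ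
  have hσpos : ∀ k, 0 < σ k := fun k => by positivity
  have hσle : ∀ k, σ k ≤ t := fun k =>
    div_le_self ht.le (by have : (0 : ℝ) ≤ k := Nat.cast_nonneg k; linarith)
  have hσlim : Filter.Tendsto σ Filter.atTop (nhds 0) := by
    refine Filter.Tendsto.div_atTop tendsto_const_nhds ?_
    exact Filter.tendsto_atTop_add_const_right _ _ tendsto_natCast_atTop_atTop
  have hmS : MeasurableSet (Set.Ioc 0 t ×ˢ Ω) := measurableSet_Ioc.prod hΩ.measurableSet
  have hcover : AECover (volume.restrict (Set.Ioc 0 t ×ˢ Ω)) Filter.atTop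
      (fun k => Set.Ioc (σ k) t ×ˢ (Set.univ : Set (Euc n))) := by
    refine ⟨(ae_restrict_iff' hmS).2 (Filter.Eventually.of_forall fun p hp => ?_),
      fun k => measurableSet_Ioc.prod MeasurableSet.univ⟩
    filter_upwards [hσlim.eventually_lt_const hp.1.1] with k hk
    exact ⟨⟨hk, hp.1.2⟩, trivial⟩
  have hres : ∀ k, (volume.restrict (Set.Ioc 0 t ×ˢ Ω)).restrict
      (Set.Ioc (σ k) t ×ˢ (Set.univ : Set (Euc n))) = volume.restrict (Set.Ioc (σ k) t ×ˢ Ω) := by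
    intro k
    rw [Measure.restrict_restrict (measurableSet_Ioc.prod MeasurableSet.univ), Set.prod_inter_prod,
      Set.univ_inter, Set.inter_eq_left.2 (Set.Ioc_subset_Ioc_left (hσpos k).le)]
  have hnn' : ∀ᵐ p ∂(volume.restrict (Set.Ioc 0 t ×ˢ Ω)), 0 ≤ f p :=
    (ae_restrict_iff' hmS).2 (Filter.Eventually.of_forall hnn)
  have hfi : ∀ k, IntegrableOn f (Set.Ioc (σ k) t ×ˢ (Set.univ : Set (Euc n)))
      (volume.restrict (Set.Ioc 0 t ×ˢ Ω)) := fun k => by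
    rw [IntegrableOn, hres]
    exact hf _ (hσpos k) (hσle k)
  have hlim' : Filter.Tendsto (fun k => ∫ p in Set.Ioc (σ k) t ×ˢ (Set.univ : Set (Euc n)), f p
      ∂(volume.restrict (Set.Ioc 0 t ×ˢ Ω))) Filter.atTop (nhds I) := by
    simp only [hres]
    exact hlim.comp (tendsto_nhdsWithin_iff.2 ⟨hσlim, Filter.Eventually.of_forall hσpos⟩)
  have hint := hcover.integrable_of_integral_tendsto_of_nonneg_ae I hfi hnn' hlim'
  exact ⟨hint, hcover.integral_eq_of_tendsto I hint hlim'⟩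

namespace IsClassicalSolution

variable {d : Fin N → ℝ} {bulk : ReactionNetwork N m} {surf : ReactionNetwork N mS}
  {eb : Module.Basis (Fin nS) ℝ surf.conservationSpace}
  {c₀ : Euc n → EuclideanSpace ℝ (Fin N)} {Tmax : EReal}
  {c : ℝ → Euc n → EuclideanSpace ℝ (Fin N)} {μ₀ : Fin N → ℝ}

/-- The boundary contribution to the free energy balance vanishes. -/
theorem sum_potential_mul_normalDeriv_eq_zero
    (h : IsClassicalSolution Ω d bulk surf eb c₀ Tmax c) (hsurf : LinearIndependent ℝ surf.ν)
    (hμ : surf.LogarithmicClosure μ₀) {t : ℝ} (ht : t ∈ timeInterval Tmax) {z : Euc n}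
    (hz : z ∈ frontier Ω) (hpos : ∀ i, 0 < c t z i) {ν : Euc n} (hν : IsOuterUnitNormal Ω z ν) :
    ∑ i, (μ₀ i + Real.log (c t z i)) * (d i * normalDeriv Ω (fun y => c t y i) z ν) = 0 := by
  have hb := h.boundary_eq t ht
  refine hb.sum_normalDeriv_eq_zero (v := fun i => μ₀ i + Real.log (c t z i)) (fun a => ?_) hz hν
  exact surf.affinity_eq_zero_of_rate_eq_zero hsurf hμ hpos (hb.2 z hz) a

/-- The free energy balance at a fixed time. -/
theorem setIntegral_potential_mul_deriv (h : IsClassicalSolution Ω d bulk surf eb c₀ Tmax c)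
    (hΩ : IsBoundedC2Domain Ω) (hsurf : LinearIndependent ℝ surf.ν)
    (hμb : bulk.LogarithmicClosure μ₀) (hμ : surf.LogarithmicClosure μ₀) {t : ℝ}
    (ht : t ∈ timeInterval Tmax) (hpos : ∀ z ∈ closure Ω, ∀ i, 0 < c t z i)
    (hD : IntegrableOn (fun z => diffusionDissipation d (c t) z +
      ∑ a, reactionDissipation bulk μ₀ a (fun j => c t z j)) Ω) :
    ∫ z in Ω, ∑ i, (μ₀ i + Real.log (c t z i)) *
        derivWithin (fun s => c s z i) (timeInterval Tmax) t =
      -∫ z in Ω, (diffusionDissipation d (c t) z +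
        ∑ a, reactionDissipation bulk μ₀ a (fun j => c t z j)) := by
  have hb := hΩ.isBounded
  have ho := hΩ.isOpen
  have hlog : ∀ i, IsC1UpTo Ω (fun z => Real.log (c t z i)) := fun i =>
    ((h.regular i).isC1UpTo ho hb ht).comp_real hb
      (fun z hz => Real.hasDerivAt_log (hpos z hz i).ne')
      ((continuousOn_slice_space (g := fun t z => c t z i) (h.regular i).continuousOn ht).inv₀
        fun z hz => (hpos z hz i).ne')
  have hμC : ∀ i, IsC1UpTo Ω (fun z => d i * (μ₀ i + Real.log (c t z i))) := fun i =>
    ((IsC1UpTo.const (μ₀ i)).add (hlog i)).const_smul (d i)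
  have hDc : ∀ i, IsC1UpTo Ω (fderivWithin ℝ (fun y => c t y i) (closure Ω)) := fun i =>
    (h.regular i).isC1UpTo_fderivWithin ho hb ht
  have hFi : ∀ i, IsC1UpTo Ω (fun z => (d i * (μ₀ i + Real.log (c t z i))) •
      fderivWithin ℝ (fun y => c t y i) (closure Ω) z) := fun i => (hμC i).smul hb (hDc i)
  have hF := IsC1UpTo.sum Finset.univ fun i _ => hFi i
  have hzero := setIntegral_covectorDiv_eq_zero hΩ hF fun z hz ν hν => by
    rw [sum_apply, ← h.sum_potential_mul_normalDeriv_eq_zero hsurf hμ ht hz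
      (hpos z (frontier_subset_closure hz)) hν]
    refine Finset.sum_congr rfl fun i _ => ?_
    rw [smul_apply, smul_eq_mul, normalDeriv]
    ring
  rw [← zero_sub, ← hzero, ← integral_sub (hF.integrableOn_covectorDiv ho hb) hD]
  refine setIntegral_congr_fun ho.measurableSet fun z hz => ?_
  have hz' := subset_closure hz
  -- The product rule gives `div (dᵢ μᵢ ∇cᵢ) = μᵢ dᵢ Δcᵢ + dᵢ |∇cᵢ|² / cᵢ`, as `∇μᵢ = ∇cᵢ / cᵢ`.
  have hdiv : ∀ i, covectorDiv (fun z => (d i * (μ₀ i + Real.log (c t z i))) •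
      fderivWithin ℝ (fun y => c t y i) (closure Ω) z) z =
      (μ₀ i + Real.log (c t z i)) * (d i * Laplacian.laplacian (fun y => c t y i) z) +
      d i * ((∑ j, fderivWithin ℝ (fun y => c t y i) (closure Ω) z (stdVec j) *
        fderivWithin ℝ (fun y => c t y i) (closure Ω) z (stdVec j)) / c t z i) := fun i => by
    have h1 : HasFDerivAt (fun z => d i * (μ₀ i + Real.log (c t z i)))
        (d i • ((c t z i)⁻¹ • fderivWithin ℝ (fun y => c t y i) (closure Ω) z)) z :=
      ((((h.regular i).hasFDerivAt ho ht hz).log (hpos z hz' i).ne').const_add (μ₀ i)).const_mul (d i)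
    rw [covectorDiv_smul h1.differentiableAt ((hDc i).differentiableAt z hz), h1.fderiv,
      IsC12.covectorDiv_fderivWithin ho hz, Finset.sum_div, Finset.mul_sum]
    congr 1
    · ring
    · refine Finset.sum_congr rfl fun j _ => ?_
      simp only [smul_apply, smul_eq_mul]
      ring
  simp only
  rw [covectorDiv_sum _ fun i _ => (hFi i).differentiableAt z hz,
    Finset.sum_congr rfl fun i _ => hdiv i, Finset.sum_add_distrib,
    diffusionDissipation_eq ho d (c t) hz]
  have hreact := bulk.sum_potential_mul_rate hμb (c := fun j => c t z j) (hpos z hz')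
  have htime : ∑ i, (μ₀ i + Real.log (c t z i)) *
      derivWithin (fun s => c s z i) (timeInterval Tmax) t =
      ∑ i, (μ₀ i + Real.log (c t z i)) * (d i * Laplacian.laplacian (fun y => c t y i) z) +
      ∑ i, (μ₀ i + Real.log (c t z i)) * bulk.rate (fun j => c t z j) i := by
    rw [← Finset.sum_add_distrib]
    refine Finset.sum_congr rfl fun i _ => ?_
    rw [← h.bulk_eq t ht z hz i]
    ring
  rw [htime, hreact, diffusionDissipationWithin]
  ring

theorem continuousOn_diffusionDissipationWithin
    (h : IsClassicalSolution Ω d bulk surf eb c₀ Tmax c) {s : Set ℝ} (hs : s ⊆ timeInterval Tmax)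
    (hpos : ∀ t ∈ s, ∀ z ∈ closure Ω, ∀ i, 0 < c t z i) :
    ContinuousOn (fun p : ℝ × Euc n => diffusionDissipationWithin Ω d (c p.1) p.2)
      (s ×ˢ closure Ω) := by
  have hsub : s ×ˢ closure Ω ⊆ timeInterval Tmax ×ˢ closure Ω := Set.prod_mono hs subset_rfl
  have hD : ∀ i (j : Fin n), ContinuousOn (fun p : ℝ × Euc n =>
      fderivWithin ℝ (fun y => c p.1 y i) (closure Ω) p.2 (stdVec j)) (s ×ˢ closure Ω) :=
    fun i j => ((h.regular i).continuousOn_fderiv.mono hsub).clm_apply continuousOn_const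
  exact continuousOn_finsetSum _ fun i _ => continuousOn_const.mul
    ((continuousOn_finsetSum _ fun j _ => (hD i j).mul (hD i j)).div
      ((h.regular i).continuousOn.mono hsub) fun p hp => (hpos p.1 hp.1 p.2 hp.2 i).ne')

theorem continuousOn_log (h : IsClassicalSolution Ω d bulk surf eb c₀ Tmax c) {s : Set ℝ}
    (hs : s ⊆ timeInterval Tmax) (hpos : ∀ t ∈ s, ∀ z ∈ closure Ω, ∀ i, 0 < c t z i) (i : Fin N) :
    ContinuousOn (fun p : ℝ × Euc n => Real.log (c p.1 p.2 i)) (s ×ˢ closure Ω) :=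
  ((h.regular i).continuousOn.mono (Set.prod_mono hs subset_rfl)).log
    fun p hp => (hpos p.1 hp.1 p.2 hp.2 i).ne'

theorem continuousOn_reactionDissipation
    (h : IsClassicalSolution Ω d bulk surf eb c₀ Tmax c) {s : Set ℝ} (hs : s ⊆ timeInterval Tmax)
    (hpos : ∀ t ∈ s, ∀ z ∈ closure Ω, ∀ i, 0 < c t z i) (a : Fin m) :
    ContinuousOn (fun p : ℝ × Euc n => reactionDissipation bulk μ₀ a (fun j => c p.1 p.2 j))
      (s ×ˢ closure Ω) := by
  have hc : ∀ i, ContinuousOn (fun p : ℝ × Euc n => c p.1 p.2 i) (s ×ˢ closure Ω) := fun i =>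
    (h.regular i).continuousOn.mono (Set.prod_mono hs subset_rfl)
  have hf : ContinuousOn (fun p : ℝ × Euc n => bulk.forward a (fun j => c p.1 p.2 j))
      (s ×ˢ closure Ω) :=
    continuousOn_const.mul (continuousOn_finsetProd _ fun i _ => (hc i).pow _)
  have ha : ContinuousOn (fun p : ℝ × Euc n => bulk.affinity μ₀ a (fun j => c p.1 p.2 j))
      (s ×ˢ closure Ω) :=
    continuousOn_finsetSum _ fun i _ =>
      (continuousOn_const.add (h.continuousOn_log hs hpos i)).mul continuousOn_const
  exact hf.mul (ha.mul (ha.rexp.sub continuousOn_const))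

/-- Positivity is not required because `x log x` is continuous at zero. This is what allows the
initial time to be included. -/
theorem continuousOn_freeEnergy (h : IsClassicalSolution Ω d bulk surf eb c₀ Tmax c) (μ₀ : Fin N → ℝ)
    {s : Set ℝ} (hs : s ⊆ timeInterval Tmax) :
    ContinuousOn (fun p : ℝ × Euc n =>
      ∑ i, c p.1 p.2 i * (μ₀ i + Real.log (c p.1 p.2 i) - 1)) (s ×ˢ closure Ω) := by
  have hc : ∀ i, ContinuousOn (fun p : ℝ × Euc n => c p.1 p.2 i) (s ×ˢ closure Ω) := fun i =>
    (h.regular i).continuousOn.mono (Set.prod_mono hs subset_rfl)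
  refine continuousOn_finsetSum _ fun i _ => ?_
  refine (((hc i).mul (continuousOn_const (c := μ₀ i - 1))).add
    (Real.continuous_mul_log.comp_continuousOn (hc i))).congr fun p _ => ?_
  change _ = c p.1 p.2 i * (μ₀ i - 1) + c p.1 p.2 i * Real.log (c p.1 p.2 i)
  ring

/-- The free energy balance on time intervals away from the initial time. -/
theorem freeEnergy_sub (h : IsClassicalSolution Ω d bulk surf eb c₀ Tmax c)
    (hΩ : IsBoundedC2Domain Ω) (hsurf : LinearIndependent ℝ surf.ν)
    (hμb : bulk.LogarithmicClosure μ₀) (hμ : surf.LogarithmicClosure μ₀)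
    (hpos : ∀ t ∈ timeInterval Tmax, 0 < t → ∀ z ∈ closure Ω, ∀ i, 0 < c t z i)
    {s t : ℝ} (hs : 0 < s) (hst : s ≤ t) (ht : t ∈ timeInterval Tmax) :
    IntegrableOn (fun p : ℝ × Euc n => diffusionDissipation d (c p.1) p.2 +
      ∑ a, reactionDissipation bulk μ₀ a (fun j => c p.1 p.2 j)) (Set.Ioc s t ×ˢ Ω) ∧
    ∫ p in Set.Ioc s t ×ˢ Ω, (diffusionDissipation d (c p.1) p.2 +
      ∑ a, reactionDissipation bulk μ₀ a (fun j => c p.1 p.2 j)) =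
      freeEnergy Ω μ₀ (c s) - freeEnergy Ω μ₀ (c t) := by
  have hb := hΩ.isBounded
  have ho := hΩ.isOpen
  have hIcc : Set.Icc s t ⊆ timeInterval Tmax := Icc_subset_timeInterval ht hs.le
  have hpos' : ∀ τ ∈ Set.Icc s t, ∀ z ∈ closure Ω, ∀ i, 0 < c τ z i := fun τ hτ =>
    hpos τ (hIcc hτ) (hs.trans_le hτ.1)
  have hDc : ContinuousOn (fun p : ℝ × Euc n => diffusionDissipationWithin Ω d (c p.1) p.2 +
      ∑ a, reactionDissipation bulk μ₀ a (fun j => c p.1 p.2 j)) (Set.Icc s t ×ˢ closure Ω) :=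
    (h.continuousOn_diffusionDissipationWithin hIcc hpos').add
      (continuousOn_finsetSum _ fun a _ => h.continuousOn_reactionDissipation hIcc hpos' a)
  have hDint : IntegrableOn (fun p : ℝ × Euc n => diffusionDissipation d (c p.1) p.2 +
      ∑ a, reactionDissipation bulk μ₀ a (fun j => c p.1 p.2 j)) (Set.Ioc s t ×ˢ Ω) :=
    (integrableOn_cylinder hb hDc).congr_fun
      (fun p hp => by rw [diffusionDissipation_eq ho d (c p.1) hp.2])
      (measurableSet_Ioc.prod ho.measurableSet)
  refine ⟨hDint, ?_⟩
  rw [setIntegral_cylinder (g := fun t z => diffusionDissipation d (c t) z +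
    ∑ a, reactionDissipation bulk μ₀ a (fun j => c t z j)) hst hDint]
  have hc : ∀ i, ContinuousOn (fun p : ℝ × Euc n => c p.1 p.2 i) (Set.Icc s t ×ˢ closure Ω) :=
    fun i => (h.regular i).continuousOn.mono (Set.prod_mono hIcc subset_rfl)
  -- The derivative of `x (μ⁰ + ln x - 1)` is `μ⁰ + ln x`, so the time derivative of the free energy
  -- density is `∑ μᵢ ∂_t cᵢ`.
  have hbal := setIntegral_sub_eq_intervalIntegral hb ho hst
    (g := fun t z => ∑ i, c t z i * (μ₀ i + Real.log (c t z i) - 1))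
    (g' := fun t z => ∑ i, (μ₀ i + Real.log (c t z i)) *
      derivWithin (fun s => c s z i) (timeInterval Tmax) t)
    (h.continuousOn_freeEnergy μ₀ hIcc)
    (continuousOn_finsetSum _ fun i _ =>
      (continuousOn_const.add (h.continuousOn_log hIcc hpos' i)).mul
        ((h.regular i).continuousOn_time_deriv.mono (Set.prod_mono hIcc subset_rfl)))
    (fun z hz τ hτ => by
      have hz' := subset_closure hz
      have hτ' := Set.Ioo_subset_Icc_self hτ
      refine HasDerivAt.fun_sum fun i _ => ?_
      have h1 := (h.regular i).hasDerivAt (hIcc hτ') (hs.trans hτ.1) hz'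
      have h2 := (hpos' τ hτ' z hz' i).ne'
      refine (h1.mul (((h1.log h2).const_add (μ₀ i)).sub_const 1)).congr_deriv ?_
      field_simp
      ring)
  have hslice : ∀ τ ∈ Set.Icc s t, ∫ z in Ω, ∑ i, (μ₀ i + Real.log (c τ z i)) *
      derivWithin (fun s => c s z i) (timeInterval Tmax) τ =
      -∫ z in Ω, (diffusionDissipation d (c τ) z +
        ∑ a, reactionDissipation bulk μ₀ a (fun j => c τ z j)) := fun τ hτ => by
    refine h.setIntegral_potential_mul_deriv hΩ hsurf hμb hμ (hIcc hτ) (hpos' τ hτ) ?_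
    exact (integrableOn_of_continuousOn_closure hb (continuousOn_slice_space
      (g := fun t z => diffusionDissipationWithin Ω d (c t) z +
        ∑ a, reactionDissipation bulk μ₀ a (fun j => c t z j)) hDc hτ)).congr_fun
      (fun z hz => by simp only [diffusionDissipation_eq ho d (c τ) hz]) ho.measurableSet
  rw [intervalIntegral.integral_congr (g := fun τ => -∫ z in Ω, (diffusionDissipation d (c τ) z +
    ∑ a, reactionDissipation bulk μ₀ a (fun j => c τ z j))) (fun τ hτ => by
      rw [Set.uIcc_of_le hst] at hτ
      exact hslice τ hτ), intervalIntegral.integral_neg] at hbal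
  simp only [freeEnergy]
  linarith

/-- Integrability of the dissipation densities up to the initial time, and the entropy identity. -/
theorem entropy_identity (h : IsClassicalSolution Ω d bulk surf eb c₀ Tmax c)
    (hΩ : IsBoundedC2Domain Ω) (hd : ∀ i, 0 < d i) (hsurf : LinearIndependent ℝ surf.ν)
    (hμb : bulk.LogarithmicClosure μ₀) (hμ : surf.LogarithmicClosure μ₀)
    (hpos : ∀ t ∈ timeInterval Tmax, 0 < t → ∀ z ∈ closure Ω, ∀ i, 0 < c t z i)
    {t : ℝ} (ht : t ∈ timeInterval Tmax) :
    IntegrableOn (fun p : ℝ × Euc n => diffusionDissipation d (c p.1) p.2) (Set.Ioc 0 t ×ˢ Ω) ∧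
    (∀ a, IntegrableOn (fun p : ℝ × Euc n =>
      reactionDissipation bulk μ₀ a (fun j => c p.1 p.2 j)) (Set.Ioc 0 t ×ˢ Ω)) ∧
    freeEnergy Ω μ₀ (c t) + (∫ s in (0 : ℝ)..t, ∫ z in Ω, diffusionDissipation d (c s) z)
      + ∑ a, (∫ s in (0 : ℝ)..t, ∫ z in Ω, reactionDissipation bulk μ₀ a (fun j => c s z j))
      = freeEnergy Ω μ₀ c₀ := by
  have hb := hΩ.isBounded
  have ho := hΩ.isOpen
  have hinit : freeEnergy Ω μ₀ (c 0) = freeEnergy Ω μ₀ c₀ :=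
    setIntegral_congr_fun ho.measurableSet fun z hz => by
      simp only [h.initial_eq z (subset_closure hz)]
  rcases ht.1.eq_or_lt with h0 | h0
  · subst h0
    simp [hinit]
  have hIoc : Set.Ioc 0 t ⊆ timeInterval Tmax := Set.Ioc_subset_Icc_self.trans
    (Icc_subset_timeInterval ht le_rfl)
  have hpos' : ∀ τ ∈ Set.Ioc 0 t, ∀ z ∈ closure Ω, ∀ i, 0 < c τ z i := fun τ hτ =>
    hpos τ (hIoc hτ) hτ.1
  have hms : MeasurableSet (Set.Ioc 0 t ×ˢ Ω) := measurableSet_Ioc.prod ho.measurableSet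
  have hdn : ∀ p ∈ Set.Ioc 0 t ×ˢ Ω, 0 ≤ diffusionDissipation d (c p.1) p.2 := fun p hp =>
    diffusionDissipation_nonneg hd fun i => (hpos' p.1 hp.1 p.2 (subset_closure hp.2) i).le
  have hrn : ∀ p ∈ Set.Ioc 0 t ×ˢ Ω, ∀ a, 0 ≤ reactionDissipation bulk μ₀ a
      (fun j => c p.1 p.2 j) := fun p hp a =>
    reactionDissipation_nonneg bulk μ₀ a fun i => (hpos' p.1 hp.1 p.2 (subset_closure hp.2) i).le
  -- The total dissipation over `(s, t]` is a difference of free energies, and the free energy is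
  -- continuous down to time zero, so it has a finite limit even though `c⁰` may vanish somewhere.
  have hΦ : Filter.Tendsto (fun s => ∫ p in Set.Ioc s t ×ˢ Ω, (diffusionDissipation d (c p.1) p.2 +
      ∑ a, reactionDissipation bulk μ₀ a (fun j => c p.1 p.2 j))) (nhdsWithin 0 (Set.Ioi 0))
      (nhds (freeEnergy Ω μ₀ c₀ - freeEnergy Ω μ₀ (c t))) := by
    have hcont := continuousOn_setIntegral ho hb
      (g := fun t z => ∑ i, c t z i * (μ₀ i + Real.log (c t z i) - 1))
      (h.continuousOn_freeEnergy μ₀ (Icc_subset_timeInterval ht le_rfl))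
    have h1 : Filter.Tendsto (fun s => freeEnergy Ω μ₀ (c s)) (nhdsWithin 0 (Set.Ioi 0))
        (nhds (freeEnergy Ω μ₀ (c 0))) := by
      refine (hcont 0 ⟨le_rfl, h0.le⟩).mono_left ?_
      rw [← nhdsWithin_Ioc_eq_nhdsGT h0]
      exact nhdsWithin_mono _ Set.Ioc_subset_Icc_self
    rw [hinit] at h1
    refine (h1.sub_const (freeEnergy Ω μ₀ (c t))).congr' ?_
    filter_upwards [Ioc_mem_nhdsGT h0] with s hs
    exact (h.freeEnergy_sub hΩ hsurf hμb hμ hpos hs.1 hs.2 ht).2.symm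
  obtain ⟨hint, heq⟩ := integrableOn_cylinder_of_tendsto h0 ho
    (fun p hp => add_nonneg (hdn p hp) (Finset.sum_nonneg fun a _ => hrn p hp a))
    (fun s hs hst => (h.freeEnergy_sub hΩ hsurf hμb hμ hpos hs hst ht).1) hΦ
  have hsub : Set.Ioc 0 t ×ˢ Ω ⊆ Set.Ioc 0 t ×ˢ closure Ω :=
    Set.prod_mono subset_rfl subset_closure
  -- All densities are nonnegative, so each is dominated by the integrable sum.
  have hdi : IntegrableOn (fun p : ℝ × Euc n => diffusionDissipation d (c p.1) p.2)
      (Set.Ioc 0 t ×ˢ Ω) := by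
    refine hint.mono' ?_ ((ae_restrict_iff' hms).2 (Filter.Eventually.of_forall fun p hp => ?_))
    · refine ((((h.continuousOn_diffusionDissipationWithin hIoc hpos').mono hsub).congr
        fun p hp => ?_).aestronglyMeasurable hms)
      exact diffusionDissipation_eq ho d (c p.1) hp.2
    · rw [Real.norm_of_nonneg (hdn p hp)]
      exact le_add_of_nonneg_right (Finset.sum_nonneg fun a _ => hrn p hp a)
  have hri : ∀ a, IntegrableOn (fun p : ℝ × Euc n =>
      reactionDissipation bulk μ₀ a (fun j => c p.1 p.2 j)) (Set.Ioc 0 t ×ˢ Ω) := fun a => by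
    refine hint.mono' ?_ ((ae_restrict_iff' hms).2 (Filter.Eventually.of_forall fun p hp => ?_))
    · exact ((h.continuousOn_reactionDissipation hIoc hpos' a).mono hsub).aestronglyMeasurable hms
    · rw [Real.norm_of_nonneg (hrn p hp a)]
      exact (Finset.single_le_sum (fun a _ => hrn p hp a) (Finset.mem_univ a)).trans
        (le_add_of_nonneg_left (hdn p hp))
  refine ⟨hdi, hri, ?_⟩
  rw [integral_add hdi (integrable_finsetSum _ fun a _ => hri a),
    integral_finsetSum _ fun a _ => hri a,
    setIntegral_cylinder (g := fun t z => diffusionDissipation d (c t) z) h0.le hdi,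
    Finset.sum_congr rfl fun a _ => setIntegral_cylinder
      (g := fun t z => reactionDissipation bulk μ₀ a (fun j => c t z j)) h0.le (hri a)] at heq
  linarith

end IsClassicalSolution

end

/-! ### Choice of the constants and conclusion -/

theorem mainTheorem3 {n N m mS nS : ℕ} (hn : 0 < n)
    (Ω : Set (EuclideanSpace ℝ (Fin n))) (hΩ : IsBoundedC2Domain Ω)
    (d : Fin N → ℝ) (hd : ∀ i, 0 < d i)
    (bulk : ReactionNetwork N m) (surf : ReactionNetwork N mS)
    (hsurf : LinearIndependent ℝ surf.ν)
    (eb : Module.Basis (Fin nS) ℝ surf.conservationSpace)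
    (e : Fin N → ℝ) (he_pos : ∀ i, 0 < e i)
    (he_bulk : e ∈ bulk.conservationSpace) (he_surf : e ∈ surf.conservationSpace)
    (c₀ : EuclideanSpace ℝ (Fin n) → EuclideanSpace ℝ (Fin N))
    (hc₀ : IsAdmissibleInitialDatum Ω d surf eb c₀)
    (T₀ : ℝ) (hT₀ : 0 < T₀) :
    ∃ C : ℝ, 0 < C ∧
      ∀ (Tmax : EReal) (c : ℝ → EuclideanSpace ℝ (Fin n) → EuclideanSpace ℝ (Fin N)),
        IsMaximalClassicalSolution Ω d bulk surf eb c₀ Tmax c → (T₀ : EReal) ≤ Tmax →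
        -- the three a-priori bounds
        (∀ t ∈ Set.Ico 0 T₀, eLpNorm (c t) 1 (volume.restrict Ω) ≤
          ENNReal.ofReal C * eLpNorm c₀ 1 (volume.restrict Ω)) ∧
        (∀ z ∈ closure Ω, eLpNorm (fun t => c t z) 1 (volume.restrict (Set.Ico 0 T₀)) ≤
          ENNReal.ofReal C) ∧
        eLpNorm (fun p : ℝ × EuclideanSpace ℝ (Fin n) => c p.1 p.2) 2
          ((volume.restrict (Set.Ico 0 T₀)).prod (volume.restrict Ω)) ≤ ENNReal.ofReal C ∧
        -- the entropy identity, for solutions whose boundary values are strictly positive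
        (∀ μ₀ : Fin N → ℝ, bulk.LogarithmicClosure μ₀ → surf.LogarithmicClosure μ₀ →
          (∀ t ∈ timeInterval Tmax, 0 < t → ∀ z ∈ frontier Ω, ∀ i, 0 < c t z i) →
          -- strict positivity, so that all logarithms and quotients are defined for `t > 0`
          (∀ t ∈ Set.Ioo 0 T₀, ∀ z ∈ closure Ω, ∀ i, 0 < c t z i) ∧
          -- the boundary contribution vanishes
          (∀ t ∈ Set.Ioo 0 T₀, ∀ z ∈ frontier Ω, ∀ ν, IsOuterUnitNormal Ω z ν →
            ∑ i, (μ₀ i + Real.log (c t z i)) *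
              (d i * normalDeriv Ω (fun y => c t y i) z ν) = 0) ∧
          (∀ t ∈ Set.Ico 0 T₀,
            IntegrableOn (fun p : ℝ × EuclideanSpace ℝ (Fin n) =>
              diffusionDissipation d (c p.1) p.2) (Set.Ioc 0 t ×ˢ Ω) ∧
            (∀ a, IntegrableOn (fun p : ℝ × EuclideanSpace ℝ (Fin n) =>
              reactionDissipation bulk μ₀ a (fun j => c p.1 p.2 j)) (Set.Ioc 0 t ×ˢ Ω)) ∧
            freeEnergy Ω μ₀ (c t)
              + (∫ s in (0 : ℝ)..t, ∫ z in Ω, diffusionDissipation d (c s) z)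
              + ∑ a, (∫ s in (0 : ℝ)..t, ∫ z in Ω,
                  reactionDissipation bulk μ₀ a (fun j => c s z j))
              = freeEnergy Ω μ₀ c₀)) := by
  obtain ⟨ε₁, hε₁, hε₁e⟩ := exists_pos_forall_le he_pos
  obtain ⟨ε₂, hε₂, hε₂e⟩ := exists_pos_forall_le fun i => mul_pos (he_pos i) (hd i)
  set ε := min ε₁ ε₂
  have hε : 0 < ε := lt_min hε₁ hε₂
  have hεe : ∀ i, ε ≤ e i := fun i => (min_le_left _ _).trans (hε₁e i)
  have hεd : ∀ i, ε ≤ e i * d i := fun i => (min_le_right _ _).trans (hε₂e i)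
  set D := ∑ i, d i
  have hD0 : 0 ≤ D := Finset.sum_nonneg fun i _ => (hd i).le
  have hD : ∀ i, d i ≤ D := fun i =>
    Finset.single_le_sum (fun j _ => (hd j).le) (Finset.mem_univ i)
  obtain ⟨P, hP0, hP⟩ := exists_norm_bound_of_continuousOn_closure hΩ.isBounded
    (F := fun z => ∑ i, e i * c₀ z i)
    (continuousOn_finsetSum _ fun i _ => continuousOn_const.mul (hc₀.contDiffOn i).continuousOn)
  have hP' : ∀ z ∈ closure Ω, ∑ i, e i * c₀ z i ≤ P := fun z hz => (le_abs_self _).trans (hP z hz)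
  set C₁ := (∑ i, e i) / ε
  set C₂ := D * P * T₀ / ε
  set C₃ := √(D * P * T₀ * P * volume.real Ω / ε ^ 2)
  have hC₁ : 0 ≤ C₁ := div_nonneg (Finset.sum_nonneg fun i _ => (he_pos i).le) hε.le
  have hC₂ : 0 ≤ C₂ := by positivity
  have hC₃ : 0 ≤ C₃ := Real.sqrt_nonneg _
  -- The three constants depend only on the data, on `T₀` and on the bound `P` for the initial
  -- weighted mass density. The summand `1` ensures strict positivity.
  refine ⟨C₁ + C₂ + C₃ + 1, by positivity, fun Tmax c hc hTmax => ?_⟩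
  have hsol := hc.isSolution
  have hmem : ∀ t, 0 ≤ t → t < T₀ → t ∈ timeInterval Tmax := fun t h0 ht =>
    ⟨h0, (EReal.coe_lt_coe_iff.2 ht).trans_le hTmax⟩
  refine ⟨fun t ht => ?_, fun z hz => ?_, ?_, fun μ₀ hμb hμ hbd => ?_⟩
  · refine (hsol.eLpNorm_one_le hΩ he_bulk he_surf hε hεe (hmem t ht.1 ht.2)).trans ?_
    gcongr
    linarith
  · exact (hsol.eLpNorm_time_le hΩ he_bulk he_surf he_pos hD0 hD hP0 hP' hε hεd hTmax hz).trans
      (ENNReal.ofReal_le_ofReal (by linarith))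
  · exact (hsol.eLpNorm_two_le hΩ he_bulk he_surf he_pos hD0 hD hP0 hP' hε hεe hεd hT₀
      hTmax).trans (ENNReal.ofReal_le_ofReal (by linarith))
  · have hpos : ∀ t ∈ timeInterval Tmax, 0 < t → ∀ z ∈ closure Ω, ∀ i, 0 < c t z i :=
      fun t ht h0 z hz i => hsol.pos hn hΩ hd hbd ht h0 hz i
    refine ⟨fun t ht => hpos t (hmem t ht.1.le ht.2) ht.1, fun t ht z hz ν hν => ?_, fun t ht => ?_⟩
    · have htm := hmem t ht.1.le ht.2
      exact hsol.sum_potential_mul_normalDeriv_eq_zero hsurf hμ htm hz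
        (hbd t htm ht.1 z hz) hν
    · exact hsol.entropy_identity hΩ hd hsurf hμb hμ hpos (hmem t ht.1 ht.2)
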